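/- Let $S$ be a locally compact Hausdorff topological semigroup (with jointly continuous multiplication) with identity. $M(S)$ is the Banach space of bounded complex Radon measures on $S$, and $M_a(S)$ is the set of $\mu\in M(S)$ for which the maps $x\mapsto\delta_x*|\mu|$ and $x\mapsto|\mu|*\delta_x$ from $S$ into $M(S)$ are continuous for the weak topology $\sigma(M(S),M(S)')$. Assume that $S$ is a foundation semigroup, i.e. $\bigcup\{\operatorname{supp}\mu:\mu\in M_a(S)\}$ is dense in $S$. Let $\omega:S\to[0,\infty)$ be a weight function: $\omega$ is continuous, $\omega$ and $1/\omega$ are bounded on compact sets (so $\omega>0$), and $\omega(xy)\le\omega(x)\omega(y)$ for all $x,y\in S$. Let $M(S,\omega)$ be the algebra of complex Radon measures $\mu$ with $\omega\mu\in M(S)$, with norm $\|\mu\|_\omega=\int\omega\,d|\mu|$ and convolution $\int f\,d(\mu*\nu)=\iint f(xy)\,d\mu(x)\,d\nu(y)$ for continuous $f$ with compact support, and let $M_a(S,\omega)=\{\mu\in M(S,\omega):\omega\mu\in M_a(S)\}$. For $A=M_a(S,\omega)$ or $A=M(S,\omega)$, a Banach $A$-module $E$ is a complex Banach space with commuting bounded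 bilinear left and right actions of $A$ that are compatible with the product; it is neo-unital if $E=\{a\cdot x\cdot b:a,b\in A,\ x\in E\}$. The dual $E'$ carries the actions $\langle x,a\cdot\varphi\rangle=\langle x\cdot a,\varphi\rangle$ and $\langle x,\varphi\cdot a\rangle=\langle a\cdot x,\varphi\rangle$, and $Z^1(A,E')$ is the set of bounded linear maps $D:A\to E'$ with $D(ab)=D(a)\cdot b+a\cdot D(b)$. The so-topology on $M(S,\omega)$ is the coarsest one for which $\mu\mapsto\mu*\nu$ and $\mu\mapsto\nu*\mu$ are continuous into $(M(S,\omega),\|\cdot\|_\omega)$ for every $\nu\in M_a(S,\omega)$. **Corollary 2.5.** Let $E$ be a neo-unital Banach $M_a(S,\omega)$-module. Then the actions of $M_a(S,\omega)$ on $E$ extend to actions of $M(S,\omega)$ that make $E$ a neo-unital Banach $M(S,\omega)$-module, such that for every $D\in Z^1(M_a(S,\omega),E')$ there is a unique $\tilde D\in Z^1(M(S,\omega),E')$ that extends $D$ and is continuous from the so-topology on $M(S,\omega)$ to the $w^*$-topology on $E'$. Moreover, $\tilde D$ is determined by its values on the point masses: any two elements of $Z^1(M(S,\omega),E')$ that are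 continuous from the so-topology to the $w^*$-topology and agree at $\delta_s$ for every $s\in S$ are equal. -/

import Mathlib

open MeasureTheory Topology Set

/-! ### Bounded complex Radon measures on a Hausdorff space -/

section RadonMeasures

/-- A measure dominated by a finite regular Borel measure is regular. -/
theorem regular_of_le_of_regular {S : Type*} [TopologicalSpace S] [T2Space S]
    [MeasurableSpace S] [BorelSpace S] {m n : Measure S} [IsFiniteMeasure n] (hn : n.Regular)
    (h : m ≤ n) : m.Regular := by
  have : IsFiniteMeasure m := isFiniteMeasure_of_le n h
  have : m.InnerRegular := by
    constructor
    intro A hA r hr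
    have hpos : m A - r ≠ 0 := (tsub_pos_of_lt hr).ne'
    obtain ⟨K, hKA, hK, hlt⟩ := hA.exists_isCompact_lt_add (measure_ne_top n A) hpos
    refine ⟨K, hKA, hK, ?_⟩
    have h1 : n (A \ K) < m A - r :=
      measure_sdiff_lt_of_lt_add hK.measurableSet.nullMeasurableSet hKA (measure_ne_top n K) hlt
    have h2 : m A ≤ m K + m (A \ K) := by
      calc m A = m (K ∪ A \ K) := by rw [union_sdiff_cancel hKA]
        _ ≤ _ := measure_union_le _ _
    by_contra hcon
    rw [not_lt] at hcon
    have h3 : m (A \ K) < m A - r := lt_of_le_of_lt (h _) h1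
    have h4 : r + m (A \ K) < m A := by
      rw [add_comm]
      exact lt_tsub_iff_right.mp h3
    have h5 : m K + m (A \ K) ≤ r + m (A \ K) := by gcongr
    exact absurd (h2.trans h5) (not_le.mpr h4)
  infer_instance

/-- `M(S)`: the space of bounded complex Radon measures, that is, of complex Borel measures whose
total variation is a finite regular measure. -/
noncomputable def boundedRadon (S : Type*) [TopologicalSpace S] [T2Space S]
    [MeasurableSpace S] [BorelSpace S] : Submodule ℂ (ComplexMeasure S) where
  carrier := {μ | IsFiniteMeasure μ.variation ∧ μ.variation.Regular}
  zero_mem' := by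
    simp only [mem_ofPred_eq, VectorMeasure.variation_zero]
    exact ⟨inferInstance, inferInstance⟩
  add_mem' := by
    rintro μ ν ⟨hμ, hμ'⟩ ⟨hν, hν'⟩
    have hle : (μ + ν).variation ≤ μ.variation + ν.variation := VectorMeasure.variation_add_le
    have : (μ.variation + ν.variation).InnerRegular := inferInstance
    exact ⟨isFiniteMeasure_of_le _ hle, regular_of_le_of_regular inferInstance hle⟩
  smul_mem' := by
    rintro c μ ⟨hμ, hμ'⟩
    refine ⟨inferInstance, ?_⟩
    rw [VectorMeasure.variation_smul]
    infer_instance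

variable {S : Type*} [TopologicalSpace S] [T2Space S] [MeasurableSpace S] [BorelSpace S]

/-- The total variation `|μ|` of `μ ∈ M(S)`, as a positive measure. -/
noncomputable def absMeasure (μ : boundedRadon S) : Measure S :=
  (μ : ComplexMeasure S).variation

instance isFiniteMeasure_absMeasure (μ : boundedRadon S) : IsFiniteMeasure (absMeasure μ) := μ.2.1

instance regular_absMeasure (μ : boundedRadon S) : (absMeasure μ).Regular := μ.2.2

/-- The total variation norm `‖μ‖ = |μ|(S)` on `M(S)`. -/
noncomputable instance boundedRadon.instNormedAddCommGroup :
    NormedAddCommGroup (boundedRadon S) :=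
  AddGroupNorm.toNormedAddCommGroup
    { toFun := fun μ => (absMeasure μ univ).toReal
      map_zero' := by simp [absMeasure]
      add_le' := fun μ ν => by
        rw [← ENNReal.toReal_add (measure_ne_top _ _) (measure_ne_top _ _)]
        refine ENNReal.toReal_mono
          (ENNReal.add_ne_top.2 ⟨measure_ne_top _ _, measure_ne_top _ _⟩) ?_
        exact VectorMeasure.variation_add_le (μ := (μ : ComplexMeasure S)) univ
      neg' := fun μ => by
        simp [absMeasure]
      eq_zero_of_map_eq_zero' := fun μ h => by
        have h1 : absMeasure μ univ = 0 := by
          rcases (ENNReal.toReal_eq_zero_iff _).1 h with h | h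
          · exact h
          · exact absurd h (measure_ne_top _ _)
        have h2 : (μ : ComplexMeasure S).variation = 0 := Measure.measure_univ_eq_zero.1 h1
        exact Subtype.ext (VectorMeasure.variation_eq_zero.1 h2) }

theorem boundedRadon.norm_def (μ : boundedRadon S) : ‖μ‖ = (absMeasure μ univ).toReal := rfl

noncomputable instance boundedRadon.instNormedSpace : NormedSpace ℂ (boundedRadon S) where
  norm_smul_le c μ := by
    have h : absMeasure (c • μ) = ‖c‖₊ • absMeasure μ := VectorMeasure.variation_smul
    rw [boundedRadon.norm_def, boundedRadon.norm_def, h]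
    simp [ENNReal.toReal_mul]

/-- A finite positive regular measure, seen as an element of `M(S)`. -/
noncomputable def ofFiniteMeasure (m : Measure S) [IsFiniteMeasure m] [m.Regular] :
    boundedRadon S :=
  ⟨m.withDensityᵥ (fun _ => (1 : ℂ)), by
    have h : (m.withDensityᵥ (fun _ => (1 : ℂ))).variation = m := by
      rw [Measure.variation_withDensityᵥ (integrable_const _)]
      simp
    simp only [boundedRadon, Submodule.mem_mk, AddSubmonoid.mem_mk, AddSubsemigroup.mem_mk,
      mem_ofPred_eq, h]
    exact ⟨inferInstance, inferInstance⟩⟩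

/-- The image of `|μ|` under a continuous map `g : S → S`, as an element of `M(S)`. -/
noncomputable def mapAbs (μ : boundedRadon S) (g : C(S, S)) : boundedRadon S :=
  have : ((absMeasure μ).map g).InnerRegular := Measure.InnerRegular.map_of_continuous g.continuous
  ofFiniteMeasure ((absMeasure μ).map g)

end RadonMeasures

/-! ### The space `M_a(S)` and foundation semigroups -/

section Foundation

variable (S : Type*) [Monoid S] [TopologicalSpace S] [T2Space S] [ContinuousMul S]
  [MeasurableSpace S] [BorelSpace S]

/-- `M_a(S)`: the measures `μ ∈ M(S)` for which `x ↦ δ_x * |μ|` and `x ↦ |μ| * δ_x` are continuous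
from `S` into `M(S)` with its weak topology `σ(M(S), M(S)')`. Here `δ_x * |μ|` and `|μ| * δ_x` are
the images of `|μ|` under `y ↦ x y` and `y ↦ y x`. -/
def absContMeasures : Set (boundedRadon S) :=
  {μ | Continuous (fun x : S => toWeakSpace ℂ (boundedRadon S)
          (mapAbs μ ⟨fun y => x * y, continuous_const_mul x⟩)) ∧
       Continuous (fun x : S => toWeakSpace ℂ (boundedRadon S)
          (mapAbs μ ⟨fun y => y * x, continuous_mul_const x⟩))}

/-- `S` is a foundation semigroup: the supports of the measures in `M_a(S)` have dense union. -/
def IsFoundationSemigroup : Prop :=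
  closure (⋃ μ ∈ absContMeasures S, (absMeasure μ).support) = univ

end Foundation

/-! ### Weights and the weighted measure algebra `M(S, ω)` -/

/-- `ω : S → [0, ∞)` is a weight function: continuous, submultiplicative, with `ω` and `1/ω` bounded
on compact sets (in particular `ω` does not vanish). -/
structure IsWeight {S : Type*} [Monoid S] [TopologicalSpace S] (ω : S → ℝ) : Prop where
  nonneg : ∀ x, 0 ≤ ω x
  continuous : Continuous ω
  bddOn_compact : ∀ K : Set S, IsCompact K → ∃ C, ∀ x ∈ K, ω x ≤ C
  inv_bddOn_compact : ∀ K : Set S, IsCompact K → ∃ c, 0 < c ∧ ∀ x ∈ K, c ≤ ω x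
  submul : ∀ x y, ω (x * y) ≤ ω x * ω y

section Weighted

variable {S : Type*} [TopologicalSpace S] [T2Space S] [MeasurableSpace S] [BorelSpace S]

/-- `M(S, ω)`: the complex Radon measures `μ` on `S` (not necessarily bounded) with `ωμ ∈ M(S)`.
Since `ω` is continuous and positive, `μ` is recorded by the bounded measure `ωμ`: every `ν ∈ M(S)`
is `ωμ` for exactly one complex Radon measure `μ`, namely `μ = (1/ω)ν`. Linear operations and the
norm `‖μ‖_ω = ‖ωμ‖ = ∫ ω d|μ|` are those of `ωμ` in `M(S)`. -/
def WeightedMeasure (_ω : S → ℝ) : Type _ := boundedRadon S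

variable {ω : S → ℝ}

noncomputable instance WeightedMeasure.instNormedAddCommGroup :
    NormedAddCommGroup (WeightedMeasure ω) :=
  inferInstanceAs (NormedAddCommGroup (boundedRadon S))

noncomputable instance WeightedMeasure.instNormedSpace : NormedSpace ℂ (WeightedMeasure ω) :=
  inferInstanceAs (NormedSpace ℂ (boundedRadon S))

/-- The isometric isomorphism `μ ↦ ωμ` of `M(S, ω)` onto `M(S)`. -/
noncomputable def WeightedMeasure.weighted : WeightedMeasure ω ≃ₗᵢ[ℂ] boundedRadon S :=
  LinearIsometryEquiv.refl ℂ (boundedRadon S)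

/-- `∫ f dμ` for `μ ∈ M(S, ω)`, that is, `∫ (f/ω) d(ωμ)`. It exists for every `ω`-bounded Borel
function `f`. -/
noncomputable def WeightedMeasure.integral (μ : WeightedMeasure ω) (f : S → ℂ) : ℂ :=
  VectorMeasure.integral ((μ.weighted : boundedRadon S) : ComplexMeasure S)
    (fun x => f x / (ω x : ℂ)) (ContinuousLinearMap.mul ℝ ℂ)

open scoped Classical in
/-- The convolution on `M(S, ω)`: `μ * ν` is the measure `κ ∈ M(S, ω)` determined by
`∫ f dκ = ∫∫ f(xy) dμ(x) dν(y)` for all continuous `f` with compact support (existence and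
uniqueness of `κ` being the Riesz representation theorem). -/
noncomputable instance WeightedMeasure.instMul [Mul S] : Mul (WeightedMeasure ω) where
  mul μ ν :=
    if h : ∃ κ : WeightedMeasure ω, ∀ f : S → ℂ, Continuous f → HasCompactSupport f →
        κ.integral f = ν.integral (fun y => μ.integral (fun x => f (x * y)))
    then h.choose else 0

/-- The point mass `δ_s ∈ M(S, ω)`; it is recorded by `ω δ_s = ω(s) δ_s`. -/
noncomputable def WeightedMeasure.pointMass (ω : S → ℝ) (s : S) : WeightedMeasure ω :=
  WeightedMeasure.weighted.symm
    ⟨VectorMeasure.dirac s (ω s : ℂ), by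
      have : (Measure.dirac s).InnerRegular := by
        constructor
        intro A hA r hr
        by_cases hs : s ∈ A
        · exact ⟨{s}, by simpa using hs, isCompact_singleton, by
            simpa [hs, Measure.dirac_apply' s hA] using hr⟩
        · simp [hs, Measure.dirac_apply' s hA] at hr
      refine ⟨inferInstance, ?_⟩
      rw [VectorMeasure.variation_dirac, enorm_eq_nnnorm]
      have : IsFiniteMeasure ((‖(ω s : ℂ)‖₊ : ENNReal) • Measure.dirac s) :=
        inferInstanceAs (IsFiniteMeasure (‖(ω s : ℂ)‖₊ • Measure.dirac s))
      infer_instance⟩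

/-- `M_a(S, ω)`: the measures `μ ∈ M(S, ω)` with `ωμ ∈ M_a(S)`. -/
def weightedAbsCont [Monoid S] [ContinuousMul S] (ω : S → ℝ) : Set (WeightedMeasure ω) :=
  {μ | μ.weighted ∈ absContMeasures S}

end Weighted

/-! ### Modules, derivations and the strong operator topology

Throughout, `A` is a subset of a normed space `B` with a product, to be thought of as a subalgebra;
actions of `A` and maps on `A` are given by maps on `B` of which only the values on `A` matter. -/

section Modules

variable {B E : Type*} [NormedAddCommGroup B] [NormedSpace ℂ B] [Mul B]
  [NormedAddCommGroup E] [NormedSpace ℂ E]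

/-- With the left action `a · x = l a x` and the right action `x · a = r a x`, the space `E` is a
Banach `A`-bimodule. -/
structure IsBanachBimodule (A : Set B) (l r : B → E →L[ℂ] E) : Prop where
  left_add : ∀ a ∈ A, ∀ b ∈ A, l (a + b) = l a + l b
  left_smul : ∀ c : ℂ, ∀ a ∈ A, l (c • a) = c • l a
  left_mul : ∀ a ∈ A, ∀ b ∈ A, ∀ x, l (a * b) x = l a (l b x)
  right_add : ∀ a ∈ A, ∀ b ∈ A, r (a + b) = r a + r b
  right_smul : ∀ c : ℂ, ∀ a ∈ A, r (c • a) = c • r a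
  right_mul : ∀ a ∈ A, ∀ b ∈ A, ∀ x, r (a * b) x = r b (r a x)
  left_right : ∀ a ∈ A, ∀ b ∈ A, ∀ x, r b (l a x) = l a (r b x)
  bounded : ∃ K : ℝ, ∀ a ∈ A, ∀ x, ‖l a x‖ ≤ K * ‖a‖ * ‖x‖ ∧ ‖r a x‖ ≤ K * ‖a‖ * ‖x‖

/-- `E` is a neo-unital Banach `A`-bimodule: `E = {a · x · b : a, b ∈ A, x ∈ E}`. -/
structure IsNeoUnitalBanachBimodule (A : Set B) (l r : B → E →L[ℂ] E) : Prop
    extends IsBanachBimodule A l r where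
  neoUnital : ∀ y : E, ∃ a ∈ A, ∃ b ∈ A, ∃ x : E, y = l a (r b x)

/-- `D ∈ Z¹(A, E')`: `D` is a continuous derivation from `A` into the dual bimodule `E'`, whose
actions are `⟨x, a · φ⟩ = ⟨x · a, φ⟩` and `⟨x, φ · a⟩ = ⟨a · x, φ⟩`; thus
`D(ab) = D(a) · b + a · D(b)`. -/
structure IsContDerivation (A : Set B) (l r : B → E →L[ℂ] E) (D : B → StrongDual ℂ E) :
    Prop where
  map_add : ∀ a ∈ A, ∀ b ∈ A, D (a + b) = D a + D b
  map_smul : ∀ c : ℂ, ∀ a ∈ A, D (c • a) = c • D a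
  leibniz : ∀ a ∈ A, ∀ b ∈ A, D (a * b) = (D a).comp (l b) + (D b).comp (r a)
  bounded : ∃ K : ℝ, ∀ a ∈ A, ‖D a‖ ≤ K * ‖a‖

/-- The strong operator (strict) topology on `B` with respect to `A`: the coarsest topology for
which `b ↦ b a` and `b ↦ a b` are continuous into the normed space `B`, for all `a ∈ A`. -/
abbrev strongOperatorTopology (A : Set B) : TopologicalSpace B :=
  ⨅ a ∈ A, TopologicalSpace.induced (fun b => b * a) inferInstance ⊓
    TopologicalSpace.induced (fun b => a * b) inferInstance

/-- `D` is continuous from `B` with the so-topology with respect to `A` into `E'` with the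
`w*`-topology. -/
def IsSoWeakStarContinuous (A : Set B) (D : B → StrongDual ℂ E) : Prop :=
  Continuous[strongOperatorTopology A, inferInstance]
    (fun b => StrongDual.toWeakDual (D b) : B → WeakDual ℂ E)

end Modules

/-! A measure in M(S, ω) is handled through the bounded measure ωμ. Convolution then becomes the
image of θ·(μ ⊗ ν) under multiplication, with θ(x, y) = ω(xy) / (ω(x)ω(y)) ≤ 1. Two facts carry the
theorem: M_a(S, ω) is a two-sided ideal of M(S, ω) with a bounded two-sided approximate identity,
and for a in M_a(S, ω) every bounded functional F satisfies, up to the weight, F(μ * a) = ∫ F(δ_x *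
a) dμ(x), and likewise on the other side.

The analytic core is a uniformity statement. Weak continuity of the translates of |μ| amounts to
continuity of their values on each Borel set. By a Borel-Cantelli and Dini argument
(`BorelCont.exists_finset`), over a compact set of parameters such a family is uniformly absolutely
continuous with respect to finite sums of its members. On measures dominated by one control measure
a functional is integration against a bounded Borel function, so over that compact set it is
uniformly close to integration against a single continuous function with compact support
(`UnifAC.exists_approx`). Identities known for such functions therefore pass to all functionals
(`ConvKernel.functional_conv`). This yields the ideal property. It also shows that normalized
restrictions e of measures in M_a to small neighbourhoods of 1, available because S is a foundation
semigroup, satisfy e * a → a and a * e → a weakly; Mazur's lemma upgrades this to norm convergence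
(`ConvKernel.exists_approximate_identity`).

The rest is algebra. By neo-unitality every y in E is a · x, so the action of μ must send it to (μ *
a) · x, and the Leibniz rule forces D̃(μ)(a · x) = D(μ * a)(x) - D(a)(x · μ). Both right-hand sides
are limits along the approximate identity, hence independent of the factorization
(`IsApproxIdeal.exists_extension`, `IsApproxIdeal.exists_derivation`). Writing also x = z · b turns
the last term into D(a)(z · (b * μ)). Now μ occurs only in μ * a and b * μ, which gives so-w*
continuity, and integration over point masses shows that the values at the δ_s determine D̃. -/

section VectorIntegral

/-! ### Integration against complex measures with a density -/

variable {X : Type*} [MeasurableSpace X]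

theorem ComplexMeasure.re_apply (μ : ComplexMeasure X) (s : Set X) :
    ComplexMeasure.re μ s = (μ s).re := rfl

theorem ComplexMeasure.im_apply (μ : ComplexMeasure X) (s : Set X) :
    ComplexMeasure.im μ s = (μ s).im := rfl

/-- A function integrable for `‖h‖ m` gives, multiplied by `h`, an `m`-integrable function. -/
theorem integrable_mul_of_integrable_withDensity {m : Measure X} {h f : X → ℂ}
    (hh : Integrable h m) (hf : Integrable f (m.withDensity fun x => ‖h x‖ₑ)) :
    Integrable (fun x => f x * h x) m ∧
      ∫ x, f x * h x ∂m = ∫ x, f x * (h x / ‖h x‖) ∂(m.withDensity fun x => ‖h x‖ₑ) := by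
  have hm : AEMeasurable (fun x => ‖h x‖ₑ) m := hh.1.enorm
  have hlt : ∀ᵐ x ∂m, ‖h x‖ₑ < ⊤ := by simp
  -- Polar decomposition of `h`. Where `h x = 0` the quotient is `0` by convention, and both sides
  -- vanish.
  have key : ∀ x, f x * h x = (‖h x‖ₑ.toReal • f x) * (h x / ‖h x‖) := by
    intro x
    by_cases h0 : h x = 0
    · simp [h0]
    · have : (‖h x‖ : ℂ) ≠ 0 := by simpa using h0
      simp only [toReal_enorm, Complex.real_smul]
      field_simp
  constructor
  · have h1 : Integrable (fun x => ‖h x‖ₑ.toReal • f x) m :=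
      (integrable_withDensity_iff_integrable_smul₀' hm hlt).1 hf
    simp_rw [key]
    refine h1.mul_bdd (c := 1) ?_ (Filter.Eventually.of_forall fun x => ?_)
    · exact (hh.1.aemeasurable.div (Complex.measurable_ofReal.comp_aemeasurable
        hh.1.norm.aemeasurable)).aestronglyMeasurable
    · by_cases h0 : h x = 0
      · simp [h0]
      · simp [h0]
  · rw [integral_withDensity_eq_integral_toReal_smul₀ hm hlt]
    refine integral_congr_ae (Filter.Eventually.of_forall fun x => ?_)
    simp only [key, smul_mul_assoc]

/-- Both sides are additive and continuous in `f` for the `L¹` norm of `‖h‖ m`, and they agree on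
multiples of indicators. -/
theorem integral_withDensityᵥ {m : Measure X} [IsFiniteMeasure m] {h f : X → ℂ}
    (hh : Integrable h m) (hf : Integrable f (m.withDensityᵥ h).variation) :
    VectorMeasure.integral (m.withDensityᵥ h) f (ContinuousLinearMap.mul ℝ ℂ)
      = ∫ x, f x * h x ∂m := by
  have hv := Measure.variation_withDensityᵥ hh
  have : IsFiniteMeasure (m.withDensityᵥ h).variation := by
    rw [hv]
    exact isFiniteMeasure_withDensity (by simpa using hh.2.ne)
  revert f
  refine Integrable.induction _ ?_ ?_ ?_ ?_
  · intro c s hs _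
    rw [VectorMeasure.integral_indicator hs, VectorMeasure.integral_const,
      VectorMeasure.restrict_apply _ hs MeasurableSet.univ, univ_inter, withDensityᵥ_apply hh hs]
    have : (fun x => s.indicator (fun _ => c) x * h x) = s.indicator (fun x => c * h x) := by
      ext x
      by_cases hx : x ∈ s <;> simp [hx]
    rw [this, integral_indicator hs, integral_const_mul]
    simp
  · intro f g _ hf hg h1 h2
    rw [VectorMeasure.integral_add hf hg, h1, h2]
    rw [hv] at hf hg
    rw [← integral_add (integrable_mul_of_integrable_withDensity hh hf).1
      (integrable_mul_of_integrable_withDensity hh hg).1]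
    simp [add_mul]
  · refine isClosed_eq VectorMeasure.continuous_integral ?_
    have hi : ∀ f : X →₁[(m.withDensityᵥ h).variation] ℂ,
        Integrable f (m.withDensity fun x => ‖h x‖ₑ) := fun f => hv ▸ L1.integrable_coeFn f
    refine (LipschitzWith.of_dist_le_mul (K := 1) fun f g => ?_).continuous
    obtain ⟨h1, e1⟩ := integrable_mul_of_integrable_withDensity hh (hi f)
    obtain ⟨h2, e2⟩ := integrable_mul_of_integrable_withDensity hh (hi g)
    obtain ⟨h3, e3⟩ := integrable_mul_of_integrable_withDensity hh ((hi f).sub (hi g))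
    rw [dist_eq_norm, ← integral_sub h1 h2]
    have : ∀ x, f x * h x - g x * h x = (⇑f - ⇑g) x * h x := by
      intro x
      simp [sub_mul]
    simp_rw [this, e3]
    rw [NNReal.coe_one, one_mul, L1.dist_eq_integral_dist]
    refine (norm_integral_le_integral_norm _).trans ?_
    rw [← hv]
    refine integral_mono_of_nonneg (Filter.Eventually.of_forall fun x => norm_nonneg _) ?_
      (Filter.Eventually.of_forall fun x => ?_)
    · simp_rw [dist_eq_norm]
      exact ((L1.integrable_coeFn f).sub (L1.integrable_coeFn g)).norm
    · simp only [Pi.sub_apply, norm_mul, dist_eq_norm, norm_div, Complex.norm_real, norm_norm]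
      exact mul_le_of_le_one_right (norm_nonneg _) (div_self_le_one _)
  · intro f g hfg hf h1
    rw [VectorMeasure.integral_congr_ae hfg.symm, h1]
    rw [hv] at hf
    have hg : Integrable g (m.withDensity fun x => ‖h x‖ₑ) := by
      rw [← hv] at hf ⊢
      exact hf.congr hfg
    rw [(integrable_mul_of_integrable_withDensity hh hf).2,
      (integrable_mul_of_integrable_withDensity hh hg).2, ← hv]
    refine integral_congr_ae ?_
    filter_upwards [hfg] with x hx using by rw [hx]

/-- The Radon-Nikodym theorem for complex measures. -/
theorem exists_withDensityᵥ_eq {μ : ComplexMeasure X} {m : Measure X} [IsFiniteMeasure m]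
    (h : ∀ s, MeasurableSet s → m s = 0 → μ s = 0) :
    ∃ f : X → ℂ, Integrable f m ∧ μ = m.withDensityᵥ f := by
  have hr : ComplexMeasure.re μ ≪ᵥ m.toENNRealVectorMeasure := by
    refine VectorMeasure.AbsolutelyContinuous.mk fun s hs h0 => ?_
    rw [Measure.toENNRealVectorMeasure_apply_measurable hs] at h0
    rw [ComplexMeasure.re_apply, h s hs h0, Complex.zero_re]
  have hi : ComplexMeasure.im μ ≪ᵥ m.toENNRealVectorMeasure := by
    refine VectorMeasure.AbsolutelyContinuous.mk fun s hs h0 => ?_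
    rw [Measure.toENNRealVectorMeasure_apply_measurable hs] at h0
    rw [ComplexMeasure.im_apply, h s hs h0, Complex.zero_im]
  have er := SignedMeasure.withDensityᵥ_rnDeriv_eq _ _ hr
  have ei := SignedMeasure.withDensityᵥ_rnDeriv_eq _ _ hi
  refine ⟨μ.rnDeriv m, ComplexMeasure.integrable_rnDeriv μ m, ?_⟩
  ext s hs
  have hint := ComplexMeasure.integrable_rnDeriv μ m
  rw [withDensityᵥ_apply hint hs]
  apply Complex.ext
  · have h1 : (∫ x in s, μ.rnDeriv m x ∂m).re = ∫ x in s, (μ.rnDeriv m x).re ∂m :=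
      (integral_re (𝕜 := ℂ) hint.integrableOn).symm
    rw [h1]
    have h2 := congrArg (fun v => v s) er
    simp only [withDensityᵥ_apply (SignedMeasure.integrable_rnDeriv _ _) hs] at h2
    simp only [ComplexMeasure.rnDeriv]
    rw [h2, ComplexMeasure.re_apply]
  · have h1 : (∫ x in s, μ.rnDeriv m x ∂m).im = ∫ x in s, (μ.rnDeriv m x).im ∂m :=
      (integral_im (𝕜 := ℂ) hint.integrableOn).symm
    rw [h1]
    have h2 := congrArg (fun v => v s) ei
    simp only [withDensityᵥ_apply (SignedMeasure.integrable_rnDeriv _ _) hs] at h2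
    simp only [ComplexMeasure.rnDeriv]
    rw [h2, ComplexMeasure.im_apply]

end VectorIntegral

theorem integrable_of_norm_le {X : Type*} [MeasurableSpace X] {f : X → ℂ} {m : Measure X}
    [IsFiniteMeasure m] (hf : Measurable f) {C : ℝ} (hC : ∀ x, ‖f x‖ ≤ C) : Integrable f m :=
  Integrable.of_bound hf.aestronglyMeasurable C (Filter.Eventually.of_forall hC)

/-! ### Integration on M(S) and positive decompositions -/

section BoundedRadon

variable {S : Type*} [TopologicalSpace S] [T2Space S] [MeasurableSpace S] [BorelSpace S]

/-- The integral `∫ f dμ` of a complex function against `μ ∈ M(S)`. -/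
noncomputable def cint (μ : boundedRadon S) (f : S → ℂ) : ℂ :=
  VectorMeasure.integral (μ : ComplexMeasure S) f (ContinuousLinearMap.mul ℝ ℂ)

/-- The integral of `f` over a set is small once the set has small `m`-measure, so compact sets that
are `m`-close to `A` from inside are also close for the new measure. -/
theorem regular_withDensity {m : Measure S} [IsFiniteMeasure m] [m.Regular] {f : S → ENNReal}
    (hf : ∫⁻ x, f x ∂m ≠ ⊤) : (m.withDensity f).Regular := by
  have : IsFiniteMeasure (m.withDensity f) := isFiniteMeasure_withDensity hf
  have : (m.withDensity f).InnerRegular := by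
    constructor
    intro A hA r hr
    have hpos : m.withDensity f A - r ≠ 0 := (tsub_pos_of_lt hr).ne'
    obtain ⟨δ, hδ, hδ'⟩ := exists_pos_setLIntegral_lt_of_measure_lt hf hpos
    obtain ⟨K, hKA, hK, hlt⟩ := hA.exists_isCompact_lt_add (measure_ne_top m A) hδ.ne'
    refine ⟨K, hKA, hK, ?_⟩
    have h1 : m.withDensity f (A \ K) < m.withDensity f A - r := by
      rw [withDensity_apply _ (hA.diff hK.measurableSet)]
      exact hδ' _ (measure_sdiff_lt_of_lt_add hK.measurableSet.nullMeasurableSet hKA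
        (measure_ne_top m K) hlt)
    have h4 : r + m.withDensity f (A \ K) < m.withDensity f A := by
      rw [add_comm]
      exact lt_tsub_iff_right.mp h1
    have h2 : m.withDensity f A ≤ m.withDensity f K + m.withDensity f (A \ K) := by
      calc m.withDensity f A = m.withDensity f (K ∪ A \ K) := by rw [union_sdiff_cancel hKA]
        _ ≤ _ := measure_union_le _ _
    by_contra hcon
    rw [not_lt] at hcon
    have h5 : m.withDensity f K + m.withDensity f (A \ K) ≤ r + m.withDensity f (A \ K) := by
      gcongr
    exact absurd (h2.trans h5) (not_le.mpr h4)
  infer_instance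

/-- The measure `h m ∈ M(S)` with integrable density `h` with respect to `m`. -/
noncomputable def dens (m : Measure S) [IsFiniteMeasure m] [m.Regular] (h : S → ℂ)
    (hh : Integrable h m) : boundedRadon S :=
  ⟨m.withDensityᵥ h, by
    have hv := Measure.variation_withDensityᵥ hh
    have hf : ∫⁻ x, ‖h x‖ₑ ∂m ≠ ⊤ := hh.2.ne
    change IsFiniteMeasure _ ∧ _
    rw [hv]
    exact ⟨isFiniteMeasure_withDensity hf, regular_withDensity hf⟩⟩

section

variable {m : Measure S} [IsFiniteMeasure m] [m.Regular]

theorem absMeasure_dens {h : S → ℂ} (hh : Integrable h m) :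
    absMeasure (dens m h hh) = m.withDensity fun x => ‖h x‖ₑ :=
  Measure.variation_withDensityᵥ hh

theorem cint_dens {h f : S → ℂ} (hh : Integrable h m)
    (hf : Integrable f (absMeasure (dens m h hh))) :
    cint (dens m h hh) f = ∫ x, f x * h x ∂m :=
  integral_withDensityᵥ hh hf

/-- Radon-Nikodym. With `m = absMeasure κ` it is the polar decomposition of `κ`, which reduces
complex scalars in `cint` to ordinary integrals. -/
theorem exists_eq_dens {κ : boundedRadon S} (h : absMeasure κ ≪ m) :
    ∃ (f : S → ℂ) (hf : Integrable f m), κ = dens m f hf := by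
  obtain ⟨f, hf, e⟩ := exists_withDensityᵥ_eq (μ := (κ : ComplexMeasure S)) (m := m)
    (fun s _ h0 => by
      have h1 := VectorMeasure.enorm_measure_le_variation (κ : ComplexMeasure S) s
      have h2 : (κ : ComplexMeasure S).variation s = 0 := h h0
      rw [h2] at h1
      simpa using h1)
  exact ⟨f, hf, Subtype.ext e⟩

theorem ofFiniteMeasure_eq_dens :
    ofFiniteMeasure m = dens m (fun _ => (1 : ℂ)) (integrable_const _) := rfl

@[simp]
theorem absMeasure_ofFiniteMeasure : absMeasure (ofFiniteMeasure m) = m := by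
  rw [ofFiniteMeasure_eq_dens, absMeasure_dens]
  simp

theorem ofFiniteMeasure_apply {s : Set S} (hs : MeasurableSet s) :
    (ofFiniteMeasure m : ComplexMeasure S) s = (m.real s : ℂ) := by
  change m.withDensityᵥ (fun _ => (1 : ℂ)) s = _
  rw [withDensityᵥ_apply (integrable_const _) hs]
  simp

theorem cint_ofFiniteMeasure {f : S → ℂ} (hf : Integrable f m) :
    cint (ofFiniteMeasure m) f = ∫ x, f x ∂m := by
  rw [ofFiniteMeasure_eq_dens, cint_dens]
  · simp
  · rw [← ofFiniteMeasure_eq_dens, absMeasure_ofFiniteMeasure]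
    exact hf

theorem norm_ofFiniteMeasure : ‖ofFiniteMeasure m‖ = m.real univ := by
  rw [boundedRadon.norm_def, absMeasure_ofFiniteMeasure, measureReal_def]

end

theorem ofFiniteMeasure_congr {m n : Measure S} [IsFiniteMeasure m] [m.Regular]
    [IsFiniteMeasure n] [n.Regular] (h : m = n) : ofFiniteMeasure m = ofFiniteMeasure n := by
  subst h
  rfl

variable (μ ν : boundedRadon S)

theorem absMeasure_add_le : absMeasure (μ + ν) ≤ absMeasure μ + absMeasure ν :=
  VectorMeasure.variation_add_le

theorem absMeasure_smul (c : ℂ) : absMeasure (c • μ) = ‖c‖₊ • absMeasure μ :=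
  VectorMeasure.variation_smul

theorem norm_apply_le (s : Set S) : ‖(μ : ComplexMeasure S) s‖ ≤ ‖μ‖ := by
  refine (VectorMeasure.norm_measure_le_variation (measure_ne_top (absMeasure μ) s)).trans ?_
  exact ENNReal.toReal_mono (measure_ne_top _ _) (measure_mono (subset_univ _))

theorem norm_eq_real : ‖μ‖ = (absMeasure μ).real univ := rfl

variable {μ ν} {f g : S → ℂ}

theorem norm_cint_le : ‖cint μ f‖ ≤ ∫ x, ‖f x‖ ∂(absMeasure μ) := by
  refine (VectorMeasure.norm_integral_le_integral_norm (μ := (μ : ComplexMeasure S))).trans ?_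
  refine mul_le_of_le_one_left (integral_nonneg fun x => norm_nonneg _) ?_
  exact ContinuousLinearMap.opNorm_mul_le ℝ ℂ

theorem norm_cint_le_of_norm_le {C : ℝ} (hC : ∀ x, ‖f x‖ ≤ C) : ‖cint μ f‖ ≤ C * ‖μ‖ := by
  refine norm_cint_le.trans ?_
  refine (integral_mono_of_nonneg (Filter.Eventually.of_forall fun x => norm_nonneg _)
    (integrable_const C) (Filter.Eventually.of_forall hC)).trans ?_
  simp [norm_eq_real, mul_comm]

theorem cint_add (hf : Integrable f (absMeasure μ)) (hg : Integrable g (absMeasure μ)) :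
    cint μ (fun x => f x + g x) = cint μ f + cint μ g :=
  VectorMeasure.integral_fun_add hf hg

theorem cint_sub (hf : Integrable f (absMeasure μ)) (hg : Integrable g (absMeasure μ)) :
    cint μ (fun x => f x - g x) = cint μ f - cint μ g :=
  VectorMeasure.integral_fun_sub hf hg

theorem cint_add_measure (hf : Integrable f (absMeasure μ)) (hg : Integrable f (absMeasure ν)) :
    cint (μ + ν) f = cint μ f + cint ν f :=
  VectorMeasure.integral_add_vectorMeasure hf hg

theorem cint_smul_measure (c : ℂ) (hf : Integrable f (absMeasure μ)) :
    cint (c • μ) f = c * cint μ f := by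
  obtain ⟨h, hh, e⟩ := exists_eq_dens (κ := μ) (m := absMeasure μ) Measure.AbsolutelyContinuous.rfl
  have e2 : c • μ = dens (absMeasure μ) (c • h) (hh.smul c) := by
    apply Subtype.ext
    change c • (μ : ComplexMeasure S) = (absMeasure μ).withDensityᵥ (c • h)
    rw [withDensityᵥ_smul, congrArg Subtype.val e]
    rfl
  have hf2 : Integrable f (absMeasure (c • μ)) := by
    rw [absMeasure_smul]
    exact hf.smul_measure_nnreal
  have e3 : cint μ f = ∫ x, f x * h x ∂(absMeasure μ) := by
    have : cint μ f = cint (dens (absMeasure μ) h hh) f := by rw [← e]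
    rw [this, cint_dens]
    rw [← e]
    exact hf
  rw [e3, ← integral_const_mul]
  have : cint (c • μ) f = cint (dens (absMeasure μ) (c • h) (hh.smul c)) f := by rw [← e2]
  rw [this, cint_dens]
  · refine integral_congr_ae (Filter.Eventually.of_forall fun x => ?_)
    simp only [Pi.smul_apply, smul_eq_mul]
    ring
  · rw [← e2]
    exact hf2

theorem cint_const_mul (c : ℂ) (hf : Integrable f (absMeasure μ)) :
    cint μ (fun x => c * f x) = c * cint μ f := by
  obtain ⟨h, hh, e⟩ := exists_eq_dens (κ := μ) (m := absMeasure μ) Measure.AbsolutelyContinuous.rfl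
  have e3 : ∀ k : S → ℂ, Integrable k (absMeasure μ) →
      cint μ k = ∫ x, k x * h x ∂(absMeasure μ) := by
    intro k hk
    have : cint μ k = cint (dens (absMeasure μ) h hh) k := by rw [← e]
    rw [this, cint_dens]
    rw [← e]
    exact hk
  rw [e3 _ hf, e3 _ (hf.const_mul c), ← integral_const_mul]
  simp_rw [mul_assoc]

theorem cint_indicator {s : Set S} (hs : MeasurableSet s) :
    cint μ (s.indicator fun _ => 1) = (μ : ComplexMeasure S) s := by
  have : IsFiniteMeasure ((μ : ComplexMeasure S).restrict s).variation :=
    isFiniteMeasure_of_le ((absMeasure μ).restrict s) VectorMeasure.variation_restrict_le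
  rw [cint, VectorMeasure.integral_indicator hs, VectorMeasure.integral_const,
    VectorMeasure.restrict_apply _ hs MeasurableSet.univ]
  simp

theorem norm_cint_sub_le (hf : Integrable f (absMeasure μ)) (hg : Integrable g (absMeasure μ)) :
    ‖cint μ f - cint μ g‖ ≤ ∫ x, ‖f x - g x‖ ∂(absMeasure μ) := by
  rw [← cint_sub hf hg]
  exact norm_cint_le

/-- An element of `M(S)` that is a positive measure. -/
def IsPos (μ : boundedRadon S) : Prop := μ = ofFiniteMeasure (absMeasure μ)

theorem isPos_ofFiniteMeasure (m : Measure S) [IsFiniteMeasure m] [m.Regular] :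
    IsPos (ofFiniteMeasure m) :=
  ofFiniteMeasure_congr absMeasure_ofFiniteMeasure.symm

theorem IsPos.eq {μ : boundedRadon S} (h : IsPos μ) : μ = ofFiniteMeasure (absMeasure μ) := h

theorem IsPos.cint_eq (h : IsPos μ) (hf : Integrable f (absMeasure μ)) :
    cint μ f = ∫ x, f x ∂(absMeasure μ) := by
  have : cint μ f = cint (ofFiniteMeasure (absMeasure μ)) f := by rw [← h]
  rw [this, cint_ofFiniteMeasure hf]

theorem exists_isPos_sub {s : SignedMeasure S} (hs : s.variation ≤ absMeasure μ) :
    ∃ a b : boundedRadon S, IsPos a ∧ IsPos b ∧ absMeasure a ≤ absMeasure μ ∧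
      absMeasure b ≤ absMeasure μ ∧
      ∀ B, MeasurableSet B →
        (s B : ℂ) = (a : ComplexMeasure S) B - (b : ComplexMeasure S) B := by
  rw [← SignedMeasure.totalVariation_eq_variation, SignedMeasure.totalVariation] at hs
  have h1 : s.toJordanDecomposition.posPart ≤ absMeasure μ :=
    (Measure.le_add_right le_rfl).trans hs
  have h2 : s.toJordanDecomposition.negPart ≤ absMeasure μ :=
    (Measure.le_add_left le_rfl).trans hs
  have r1 := regular_of_le_of_regular inferInstance h1
  have r2 := regular_of_le_of_regular inferInstance h2
  refine ⟨ofFiniteMeasure s.toJordanDecomposition.posPart,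
    ofFiniteMeasure s.toJordanDecomposition.negPart, isPos_ofFiniteMeasure _,
    isPos_ofFiniteMeasure _, by simpa using h1, by simpa using h2, fun B hB => ?_⟩
  rw [ofFiniteMeasure_apply hB, ofFiniteMeasure_apply hB, ← Complex.ofReal_sub]
  congr 1
  conv_lhs => rw [← s.toSignedMeasure_toJordanDecomposition]
  rw [JordanDecomposition.toSignedMeasure, sub_apply,
    Measure.toSignedMeasure_apply_measurable hB, Measure.toSignedMeasure_apply_measurable hB]

/-- Jordan decomposition of the real and imaginary parts. The domination of all four parts by `|μ|`
matters later: having continuous translates passes to dominated measures, so the parts of an element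
of M_a stay in M_a. -/
theorem exists_isPos_decomposition (μ : boundedRadon S) :
    ∃ a b c d : boundedRadon S, (IsPos a ∧ IsPos b ∧ IsPos c ∧ IsPos d) ∧
      (absMeasure a ≤ absMeasure μ ∧ absMeasure b ≤ absMeasure μ ∧
        absMeasure c ≤ absMeasure μ ∧ absMeasure d ≤ absMeasure μ) ∧
      μ = (a - b) + Complex.I • (c - d) := by
  have hr : (ComplexMeasure.re (μ : ComplexMeasure S)).variation ≤ absMeasure μ := by
    refine VectorMeasure.variation_le_of_forall_enorm_le fun B hB => ?_
    refine le_trans ?_ (VectorMeasure.enorm_measure_le_variation (μ : ComplexMeasure S) B)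
    rw [ComplexMeasure.re_apply, enorm_le_iff_norm_le]
    exact Complex.abs_re_le_norm _
  have hi : (ComplexMeasure.im (μ : ComplexMeasure S)).variation ≤ absMeasure μ := by
    refine VectorMeasure.variation_le_of_forall_enorm_le fun B hB => ?_
    refine le_trans ?_ (VectorMeasure.enorm_measure_le_variation (μ : ComplexMeasure S) B)
    rw [ComplexMeasure.im_apply, enorm_le_iff_norm_le]
    exact Complex.abs_im_le_norm _
  obtain ⟨a, b, ha, hb, ha', hb', e1⟩ := exists_isPos_sub hr
  obtain ⟨c, d, hc, hd, hc', hd', e2⟩ := exists_isPos_sub hi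
  refine ⟨a, b, c, d, ⟨ha, hb, hc, hd⟩, ⟨ha', hb', hc', hd'⟩, ?_⟩
  apply Subtype.ext
  refine VectorMeasure.ext fun B hB => ?_
  change (μ : ComplexMeasure S) B = ((a : ComplexMeasure S) B - (b : ComplexMeasure S) B) +
    Complex.I • ((c : ComplexMeasure S) B - (d : ComplexMeasure S) B)
  rw [← e1 B hB, ← e2 B hB, ComplexMeasure.re_apply, ComplexMeasure.im_apply, smul_eq_mul, mul_comm,
    Complex.re_add_im]

theorem boundedRadon.isPos_induction {P : boundedRadon S → Prop} (hpos : ∀ a, IsPos a → P a)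
    (hadd : ∀ a b, P a → P b → P (a + b)) (hsmul : ∀ (c : ℂ) a, P a → P (c • a))
    (μ : boundedRadon S) : P μ := by
  obtain ⟨a, b, c, d, ⟨ha, hb, hc, hd⟩, -, e⟩ := exists_isPos_decomposition μ
  have hsub : ∀ a b, P a → P b → P (a - b) := fun a b ha hb => by
    rw [sub_eq_add_neg, ← neg_one_smul ℂ b]
    exact hadd _ _ ha (hsmul _ _ hb)
  rw [e]
  exact hadd _ _ (hsub _ _ (hpos _ ha) (hpos _ hb))
    (hsmul _ _ (hsub _ _ (hpos _ hc) (hpos _ hd)))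

/-- In a locally compact Hausdorff space, integrable functions are approximated in `L¹` by
continuous functions with compact support (no normality is assumed). -/
theorem exists_hasCompactSupport_integral_norm_sub_le [LocallyCompactSpace S] {m : Measure S}
    [IsFiniteMeasure m] [m.Regular] {f : S → ℂ} (hf : Integrable f m) {ε : ℝ} (hε : 0 < ε) :
    ∃ g : S → ℂ, Continuous g ∧ HasCompactSupport g ∧ ∫ x, ‖f x - g x‖ ∂m ≤ ε := by
  have hε' : ENNReal.ofReal ε ≠ 0 := by simpa using hε
  have hind : ∀ (c : ℂ) ⦃s : Set S⦄, MeasurableSet s → m s < ⊤ → ∀ {ε : ENNReal}, ε ≠ 0 →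
      ∃ g : S → ℂ, eLpNorm (g - s.indicator fun _ => c) 1 m ≤ ε ∧
        (Continuous g ∧ HasCompactSupport g) := by
    intro c s hs hms ε hε
    obtain ⟨η, hη, hlt⟩ := ENNReal.exists_nnreal_pos_mul_lt (a := 2 * ‖c‖ₑ) (by finiteness) hε
    have hη' : (η : ENNReal) ≠ 0 := by simpa using hη.ne'
    obtain ⟨K, hKs, hK, hmK⟩ := hs.exists_isCompact_sdiff_lt hms.ne hη'
    obtain ⟨U, hsU, hU, -, hmU⟩ := hs.exists_isOpen_sdiff_lt hms.ne hη'
    obtain ⟨u, hu1, hu2, hu3, hu4⟩ :=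
      exists_continuousMap_one_of_isCompact_subset_isOpen hK hU (hKs.trans hsU)
    -- Off `U \ K` the function `u c` coincides with the indicator, and on it the difference is at
    -- most `‖c‖`. The set has measure at most `2η`, which explains the choice of `η`.
    refine ⟨fun x => (u x : ℂ) * c, ?_, by fun_prop, ?_⟩
    · rw [eLpNorm_one_eq_lintegral_enorm]
      have hmeas : MeasurableSet (U \ K) := hU.measurableSet.diff hK.measurableSet
      calc _ ≤ ∫⁻ x, (U \ K).indicator (fun _ => ‖c‖ₑ) x ∂m := by
            refine lintegral_mono fun x => ?_
            simp only [Pi.sub_apply]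
            by_cases hxK : x ∈ K
            · have : u x = 1 := hu1 hxK
              simp [this, hKs hxK]
            by_cases hxU : x ∈ U
            · have hx : x ∈ U \ K := ⟨hxU, hxK⟩
              rw [indicator_of_mem hx, enorm_le_iff_norm_le]
              by_cases hxs : x ∈ s
              · rw [indicator_of_mem hxs]
                have : (u x : ℂ) * c - c = ((u x - 1 : ℝ) : ℂ) * c := by push_cast; ring
                rw [this, norm_mul, Complex.norm_real]
                refine mul_le_of_le_one_left (norm_nonneg _) ?_
                rw [Real.norm_eq_abs, abs_le]
                constructor <;> linarith [(hu4 x).1, (hu4 x).2]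
              · rw [indicator_of_notMem hxs, sub_zero, norm_mul, Complex.norm_real]
                refine mul_le_of_le_one_left (norm_nonneg _) ?_
                rw [Real.norm_eq_abs, abs_le]
                constructor <;> linarith [(hu4 x).1, (hu4 x).2]
            · have h0 : u x = 0 := image_eq_zero_of_notMem_tsupport fun h => hxU (hu3 h)
              have hxs : x ∉ s := fun h => hxU (hsU h)
              simp [h0, hxs, hxU]
        _ = ‖c‖ₑ * m (U \ K) := lintegral_indicator_const hmeas _
        _ ≤ ‖c‖ₑ * (η + η) := by
            gcongr
            calc m (U \ K) ≤ m (U \ s ∪ s \ K) := by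
                  refine measure_mono fun x hx => ?_
                  by_cases hxs : x ∈ s
                  · exact Or.inr ⟨hxs, hx.2⟩
                  · exact Or.inl ⟨hx.1, hxs⟩
              _ ≤ _ := (measure_union_le _ _).trans (add_le_add hmU.le hmK.le)
        _ = η * (2 * ‖c‖ₑ) := by ring
        _ ≤ ε := hlt.le
    · have : HasCompactSupport u := hu2
      exact (this.comp_left (g := fun t : ℝ => (t : ℂ)) (by simp)).mul_right
  obtain ⟨g, hle, hg, hg'⟩ := MemLp.induction_dense (p := 1) (by simp)
    (fun g : S → ℂ => Continuous g ∧ HasCompactSupport g) hind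
    (fun g k hg hk => ⟨hg.1.add hk.1, hg.2.add hk.2⟩)
    (fun g hg => hg.1.aestronglyMeasurable) (memLp_one_iff_integrable.2 hf) hε'
  refine ⟨g, hg, hg', ?_⟩
  rw [eLpNorm_one_eq_lintegral_enorm] at hle
  change ∫ x, ‖(f - g) x‖ ∂m ≤ ε
  rw [integral_norm_eq_lintegral_enorm
    (hf.1.sub hg.aestronglyMeasurable)]
  exact ENNReal.toReal_le_of_le_ofReal hε.le hle

/-- Elements of `M(S)` are determined by the integrals of continuous functions with compact
support. -/
theorem boundedRadon.ext_of_cint [LocallyCompactSpace S] {κ κ' : boundedRadon S}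
    (h : ∀ g : S → ℂ, Continuous g → HasCompactSupport g → cint κ g = cint κ' g) : κ = κ' := by
  rw [← sub_eq_zero]
  set ρ := κ - κ' with hρ
  have hint : ∀ {g : S → ℂ} {m : Measure S} [IsFiniteMeasure m], Continuous g →
      HasCompactSupport g → Integrable g m := fun hg hg' => hg.integrable_of_hasCompactSupport hg'
  have h0 : ∀ g : S → ℂ, Continuous g → HasCompactSupport g → cint ρ g = 0 := by
    intro g hg hg'
    rw [hρ, sub_eq_add_neg, ← neg_one_smul ℂ κ', cint_add_measure (hint hg hg') (hint hg hg'),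
      cint_smul_measure _ (hint hg hg'), h g hg hg']
    ring
  apply Subtype.ext
  refine VectorMeasure.ext fun B hB => ?_
  change (ρ : ComplexMeasure S) B = 0
  rw [← norm_le_zero_iff]
  refine le_of_forall_pos_le_add fun ε hε => ?_
  have hi : Integrable (B.indicator fun _ => (1 : ℂ)) (absMeasure ρ) :=
    (integrable_const _).indicator hB
  obtain ⟨g, hg, hg', hle⟩ := exists_hasCompactSupport_integral_norm_sub_le hi hε
  have := norm_cint_sub_le hi (hint hg hg')
  rw [h0 g hg hg', sub_zero, cint_indicator hB] at this
  linarith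

end BoundedRadon

/-! ### Tightness and Fubini's theorem -/

section Tight

variable {S : Type*} [TopologicalSpace S] [T2Space S] [MeasurableSpace S] [BorelSpace S]

theorem integral_norm_le_add {X : Type*} [MeasurableSpace X] {m : Measure X} [IsFiniteMeasure m]
    {f : X → ℂ} {Q : Set X} (hQ : MeasurableSet Q) {δ C : ℝ} (hδ : 0 ≤ δ)
    (h1 : ∀ x ∈ Q, ‖f x‖ ≤ δ) (h2 : ∀ x, ‖f x‖ ≤ C) :
    ∫ x, ‖f x‖ ∂m ≤ δ * m.real univ + C * m.real Qᶜ := by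
  have hi : Integrable (fun x => δ + Qᶜ.indicator (fun _ => C) x) m :=
    (integrable_const δ).add ((integrable_const C).indicator hQ.compl)
  refine (integral_mono_of_nonneg (Filter.Eventually.of_forall fun x => norm_nonneg _) hi
    (Filter.Eventually.of_forall fun x => ?_)).trans ?_
  · by_cases hx : x ∈ Q
    · simpa [hx] using h1 x hx
    · simp only [mem_compl_iff, hx, not_false_eq_true, indicator_of_mem]
      linarith [h2 x]
  · rw [integral_add (integrable_const δ) ((integrable_const C).indicator hQ.compl),
      integral_indicator_const _ hQ.compl]
    simp [mul_comm]

theorem exists_isCompact_real_compl_lt (m : Measure S) [IsFiniteMeasure m] [m.Regular] {δ : ℝ}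
    (hδ : 0 < δ) : ∃ Q : Set S, IsCompact Q ∧ m.real Qᶜ < δ := by
  obtain ⟨Q, -, hQ, hlt⟩ := (MeasurableSet.univ (α := S)).exists_isCompact_sdiff_lt
    (μ := m) (measure_ne_top _ _) (ε := ENNReal.ofReal δ) (by simpa using hδ)
  refine ⟨Q, hQ, ?_⟩
  rw [← compl_eq_univ_sdiff] at hlt
  exact (ENNReal.lt_ofReal_iff_toReal_lt (measure_ne_top _ _)).1 hlt

/-- Integration of a bounded jointly continuous function in one variable against a Radon measure
gives a continuous function. -/
theorem continuous_cint {X : Type*} [TopologicalSpace X] (a : boundedRadon S) {H : X → S → ℂ}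
    (hH : Continuous (Function.uncurry H)) {C : ℝ} (hC : ∀ x y, ‖H x y‖ ≤ C) :
    Continuous fun x => cint a (H x) := by
  have hHx : ∀ x, Continuous (H x) := fun x => hH.comp (Continuous.prodMk_right x)
  have hi : ∀ x, Integrable (H x) (absMeasure a) := fun x =>
    integrable_of_norm_le (hHx x).measurable (hC x)
  rw [continuous_iff_continuousAt]
  intro x₀
  refine Metric.tendsto_nhds.2 fun ε hε => ?_
  have hden : 0 < ‖a‖ + 2 * |C| + 1 := by positivity
  set δ := ε / (‖a‖ + 2 * |C| + 1) with hδ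
  have hδ0 : 0 < δ := by positivity
  obtain ⟨Q, hQ, hlt⟩ := exists_isCompact_real_compl_lt (absMeasure a) hδ0
  -- The difference vanishes at `x = x₀`, so compactness of `Q` gives one neighbourhood of `x₀` that
  -- serves all `y ∈ Q`.
  have hev : ∀ᶠ x in 𝓝 x₀, ∀ y ∈ Q, ‖H x y - H x₀ y‖ < δ := by
    refine hQ.eventually_forall_of_forall_eventually fun y _ => ?_
    have hc : Continuous fun z : X × S => ‖H z.1 z.2 - H x₀ z.2‖ :=
      (hH.sub ((hHx x₀).comp continuous_snd)).norm
    have := hc.tendsto (x₀, y)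
    simp only [sub_self, norm_zero] at this
    exact this.eventually_lt_const hδ0
  filter_upwards [hev] with x hx
  rw [dist_eq_norm]
  refine (norm_cint_sub_le (hi x) (hi x₀)).trans_lt ?_
  refine (integral_norm_le_add (δ := δ) (C := 2 * |C|) hQ.measurableSet hδ0.le
    (fun y hy => (hx y hy).le) fun y => ?_).trans_lt ?_
  · refine (norm_sub_le _ _).trans ?_
    linarith [hC x y, hC x₀ y, le_abs_self C]
  · rw [← norm_eq_real]
    have : 2 * |C| * (absMeasure a).real Qᶜ ≤ 2 * |C| * δ := by gcongr
    have e : δ * (‖a‖ + 2 * |C| + 1) = ε := by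
      rw [hδ]
      field_simp
    nlinarith

theorem norm_cint_le_of_norm_le_add (a : boundedRadon S) {f : S → ℂ} {Q : Set S}
    (hQ : MeasurableSet Q) {δ C : ℝ} (hδ : 0 ≤ δ)
    (h1 : ∀ x ∈ Q, ‖f x‖ ≤ δ) (h2 : ∀ x, ‖f x‖ ≤ C) :
    ‖cint a f‖ ≤ δ * ‖a‖ + C * (absMeasure a).real Qᶜ :=
  norm_cint_le.trans (integral_norm_le_add hQ hδ h1 h2)

theorem integrable_cint {a b : boundedRadon S} {H : S → S → ℂ}
    (hH : Continuous (Function.uncurry H)) {C : ℝ} (hC : ∀ x y, ‖H x y‖ ≤ C) :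
    Integrable (fun x => cint b (H x)) (absMeasure a) :=
  integrable_of_norm_le (continuous_cint b hH hC).measurable
    (fun x => norm_cint_le_of_norm_le (hC x))

omit [MeasurableSpace S] [BorelSpace S] in
theorem exists_cutoff [LocallyCompactSpace S] {Q : Set S} (hQ : IsCompact Q) :
    ∃ u : S → ℂ, Continuous u ∧ HasCompactSupport u ∧ (∀ x ∈ Q, u x = 1) ∧ (∀ x, ‖u x‖ ≤ 1) ∧
      ∀ x, ‖1 - u x‖ ≤ 1 := by
  obtain ⟨u, hu1, hu2, -, hu4⟩ :=
    exists_continuousMap_one_of_isCompact_subset_isOpen hQ isOpen_univ (subset_univ _)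
  have : HasCompactSupport u := hu2
  refine ⟨fun x => (u x : ℂ), by fun_prop, this.comp_left (g := fun t : ℝ => (t : ℂ)) (by simp),
    fun x hx => by simp [hu1 hx], fun x => ?_, fun x => ?_⟩
  · rw [Complex.norm_real, Real.norm_eq_abs, abs_le]
    constructor <;> linarith [(hu4 x).1, (hu4 x).2]
  · rw [← Complex.ofReal_one, ← Complex.ofReal_sub, Complex.norm_real, Real.norm_eq_abs, abs_le]
    constructor <;> linarith [(hu4 x).1, (hu4 x).2]

/-- `H` need not be measurable for the product of the Borel σ-algebras, so the usual Fubini theorem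
does not apply. The interchange holds for compactly supported continuous kernels, and tightness of
both measures bounds the cost of cutting `H` off. -/
theorem cint_cint_swap_of_isPos [LocallyCompactSpace S] {μ ν : boundedRadon S} (hμ : IsPos μ)
    (hν : IsPos ν) {H : S → S → ℂ} (hH : Continuous (Function.uncurry H)) {C : ℝ}
    (hC : ∀ x y, ‖H x y‖ ≤ C) :
    cint μ (fun x => cint ν fun y => H x y) = cint ν fun y => cint μ fun x => H x y := by
  -- The kernels agree on `Q × Q` and differ by at most `2C` elsewhere, and one of the two variables
  -- is then in the complement of `Q`, of mass at most `δ`.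
  have approx : ∀ {a b : boundedRadon S} {K G : S → S → ℂ} {Q : Set S} {δ C : ℝ},
      IsCompact Q → 0 ≤ δ → 0 ≤ C → (absMeasure a).real Qᶜ ≤ δ → (absMeasure b).real Qᶜ ≤ δ →
      Continuous (Function.uncurry K) → Continuous (Function.uncurry G) →
      (∀ x y, ‖K x y‖ ≤ C) → (∀ x y, ‖G x y‖ ≤ C) →
      (∀ x ∈ Q, ∀ y ∈ Q, G x y = K x y) →
      ‖cint a (fun x => cint b (K x)) - cint a (fun x => cint b (G x))‖ ≤
        2 * C * δ * (‖a‖ + ‖b‖) := by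
    intro a b K G Q δ C hQ hδ hC0 ha hb hK hG hKC hGC hKG
    rw [← cint_sub (integrable_cint hK hKC) (integrable_cint hG hGC)]
    have hi : ∀ {K : S → S → ℂ}, Continuous (Function.uncurry K) → (∀ x y, ‖K x y‖ ≤ C) →
        ∀ x, Integrable (K x) (absMeasure b) := fun hK hC x =>
      integrable_of_norm_le (hK.comp (Continuous.prodMk_right x)).measurable (hC x)
    have hd : ∀ x y, ‖K x y - G x y‖ ≤ 2 * C := fun x y =>
      (norm_sub_le _ _).trans (by linarith [hKC x y, hGC x y])
    have hx : ∀ x, cint b (K x) - cint b (G x) = cint b (fun y => K x y - G x y) := fun x =>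
      (cint_sub (hi hK hKC x) (hi hG hGC x)).symm
    refine (norm_cint_le_of_norm_le_add a (δ := 2 * C * δ) (C := 2 * C * ‖b‖) hQ.measurableSet
      (by positivity) (fun x hxQ => ?_) fun x => ?_).trans ?_
    · rw [hx]
      refine (norm_cint_le_of_norm_le_add b (δ := 0) (C := 2 * C) hQ.measurableSet le_rfl
        (fun y hy => ?_) (hd x)).trans ?_
      · simp [hKG x hxQ y hy]
      · rw [zero_mul, zero_add]
        gcongr
    · rw [hx]
      exact norm_cint_le_of_norm_le (hd x)
    · have := mul_le_mul_of_nonneg_left ha (show 0 ≤ 2 * C * ‖b‖ by positivity)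
      nlinarith
  have hH' : Continuous (Function.uncurry fun y x => H x y) := hH.comp continuous_swap
  rw [← sub_eq_zero, ← norm_le_zero_iff]
  refine le_of_forall_pos_le_add fun ε hε => ?_
  -- Cutting off is paid once for each order of integration, hence twice the bound `2 |C| δ (‖μ‖ +
  -- ‖ν‖)`.
  have hden : 0 < 4 * |C| * (‖μ‖ + ‖ν‖) + 1 := by positivity
  set δ := ε / (4 * |C| * (‖μ‖ + ‖ν‖) + 1) with hδ
  have hδ0 : 0 < δ := by positivity
  obtain ⟨Q₁, hQ₁, h1⟩ := exists_isCompact_real_compl_lt (absMeasure μ) hδ0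
  obtain ⟨Q₂, hQ₂, h2⟩ := exists_isCompact_real_compl_lt (absMeasure ν) hδ0
  have h1' : (absMeasure μ).real (Q₁ ∪ Q₂)ᶜ ≤ δ :=
    (measureReal_mono (compl_subset_compl.2 subset_union_left)).trans h1.le
  have h2' : (absMeasure ν).real (Q₁ ∪ Q₂)ᶜ ≤ δ :=
    (measureReal_mono (compl_subset_compl.2 subset_union_right)).trans h2.le
  have hQ := hQ₁.union hQ₂
  obtain ⟨u, hu, hu', hu1, hu2, -⟩ := exists_cutoff hQ
  set G : S → S → ℂ := fun x y => u x * u y * H x y with hGdef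
  have hG : Continuous (Function.uncurry G) :=
    ((hu.comp continuous_fst).mul (hu.comp continuous_snd)).mul hH
  have hG' : Continuous (Function.uncurry fun y x => G x y) := hG.comp continuous_swap
  have hHC : ∀ x y, ‖H x y‖ ≤ |C| := fun x y => (hC x y).trans (le_abs_self C)
  have hGC : ∀ x y, ‖G x y‖ ≤ |C| := fun x y => by
    rw [hGdef]
    simp only [norm_mul]
    calc ‖u x‖ * ‖u y‖ * ‖H x y‖ ≤ 1 * 1 * |C| := by
          gcongr
          exacts [hu2 x, hu2 y, hHC x y]
      _ = |C| := by ring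
  have hGs : HasCompactSupport (Function.uncurry G) := by
    refine HasCompactSupport.of_support_subset_isCompact (hu'.isCompact.prod hu'.isCompact) ?_
    rintro ⟨x, y⟩ hxy
    simp only [Function.mem_support, Function.uncurry_apply_pair, hGdef, mul_ne_zero_iff] at hxy
    exact ⟨subset_tsupport _ hxy.1.1, subset_tsupport _ hxy.1.2⟩
  have e : cint μ (fun x => cint ν fun y => G x y) = cint ν fun y => cint μ fun x => G x y := by
    rw [hμ.cint_eq (integrable_cint hG hGC), hν.cint_eq (integrable_cint hG' fun y x => hGC x y)]
    have e1 : ∀ x, cint ν (fun y => G x y) = ∫ y, G x y ∂(absMeasure ν) := fun x =>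
      hν.cint_eq (integrable_of_norm_le (hG.comp (Continuous.prodMk_right x)).measurable (hGC x))
    have e2 : ∀ y, cint μ (fun x => G x y) = ∫ x, G x y ∂(absMeasure μ) := fun y =>
      hμ.cint_eq (integrable_of_norm_le (hG.comp (Continuous.prodMk_left y)).measurable
        fun x => hGC x y)
    simp_rw [e1, e2]
    exact integral_integral_swap_of_hasCompactSupport hG hGs
  have a1 := approx (a := μ) (b := ν) (K := H) (G := G) hQ hδ0.le (abs_nonneg C) h1' h2' hH hG hHC
    hGC fun x hx y hy => by simp [hGdef, hu1 x hx, hu1 y hy]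
  have a2 := approx (a := ν) (b := μ) (K := fun y x => H x y) (G := fun y x => G x y) hQ hδ0.le
    (abs_nonneg C) h2' h1' hH' hG' (fun y x => hHC x y) (fun y x => hGC x y)
    fun y hy x hx => by simp [hGdef, hu1 x hx, hu1 y hy]
  have key : cint μ (fun x => cint ν fun y => H x y) - cint ν (fun y => cint μ fun x => H x y) =
      (cint μ (fun x => cint ν fun y => H x y) - cint μ (fun x => cint ν fun y => G x y)) -
      (cint ν (fun y => cint μ fun x => H x y) - cint ν (fun y => cint μ fun x => G x y)) := by
    rw [e]
    ring
  rw [key, zero_add]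
  refine (norm_sub_le _ _).trans ((add_le_add a1 a2).trans ?_)
  have e : δ * (4 * |C| * (‖μ‖ + ‖ν‖) + 1) = ε := by
    rw [hδ]
    field_simp
  nlinarith

/-- Fubini's theorem for Radon measures and bounded continuous functions. -/
theorem cint_cint_swap [LocallyCompactSpace S] (μ ν : boundedRadon S) {H : S → S → ℂ}
    (hH : Continuous (Function.uncurry H)) {C : ℝ} (hC : ∀ x y, ‖H x y‖ ≤ C) :
    cint μ (fun x => cint ν fun y => H x y) = cint ν fun y => cint μ fun x => H x y := by
  have hH' : Continuous (Function.uncurry fun y x => H x y) := hH.comp continuous_swap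
  have hix : ∀ a : boundedRadon S, ∀ x, Integrable (fun y => H x y) (absMeasure a) := fun a x =>
    integrable_of_norm_le (hH.comp (Continuous.prodMk_right x)).measurable (hC x)
  have hiy : ∀ a : boundedRadon S, ∀ y, Integrable (fun x => H x y) (absMeasure a) := fun a y =>
    integrable_of_norm_le (hH.comp (Continuous.prodMk_left y)).measurable (fun x => hC x y)
  have hI : ∀ a b : boundedRadon S, Integrable (fun x => cint b fun y => H x y) (absMeasure a) :=
    fun a b => integrable_cint hH hC
  have hI' : ∀ a b : boundedRadon S, Integrable (fun y => cint b fun x => H x y) (absMeasure a) :=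
    fun a b => integrable_cint hH' fun y x => hC x y
  induction μ using boundedRadon.isPos_induction with
  | hpos a ha =>
    induction ν using boundedRadon.isPos_induction with
    | hpos b hb => exact cint_cint_swap_of_isPos ha hb hH hC
    | hadd b c hb hc =>
      rw [cint_add_measure (hI' _ _) (hI' _ _), ← hb, ← hc, ← cint_add (hI _ _) (hI _ _)]
      congr 1
      ext x
      exact cint_add_measure (hix _ _) (hix _ _)
    | hsmul c b hb =>
      rw [cint_smul_measure _ (hI' _ _), ← hb, ← cint_const_mul _ (hI _ _)]
      congr 1
      ext x
      exact cint_smul_measure _ (hix _ _)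
  | hadd a b ha hb =>
    rw [cint_add_measure (hI _ _) (hI _ _), ha, hb, ← cint_add (hI' _ _) (hI' _ _)]
    congr 1
    ext x
    exact (cint_add_measure (hiy _ _) (hiy _ _)).symm
  | hsmul c a ha =>
    rw [cint_smul_measure _ (hI _ _), ha, ← cint_const_mul _ (hI' _ _)]
    congr 1
    ext x
    exact (cint_smul_measure _ (hiy _ _)).symm

end Tight

/-! ### Setwise continuous families are uniformly absolutely continuous -/

section Families

variable {X : Type*} [TopologicalSpace X] {S : Type*} [MeasurableSpace S]

/-- A family of measures whose values on each measurable set depend continuously on the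
parameter. -/
def BorelCont (ν : X → Measure S) : Prop :=
  ∀ B, MeasurableSet B → Continuous fun x => ν x B

/-- On a compact set of parameters, a `BorelCont` family of finite measures is uniformly absolutely
continuous with respect to sums of finitely many of its members. -/
theorem BorelCont.exists_finset {ν : X → Measure S} [∀ x, IsFiniteMeasure (ν x)]
    (hν : BorelCont ν) {K : Set X} (hK : IsCompact K) {ε : ENNReal} (hε : ε ≠ 0) :
    ∃ s : Finset X, ↑s ⊆ K ∧ ∃ δ : ENNReal, δ ≠ 0 ∧
      ∀ B, MeasurableSet B → ∑ x ∈ s, ν x B < δ → ∀ x ∈ K, ν x B ≤ ε := by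
  classical
  by_contra! hcon
  -- If the claim fails, one selects triples (xₙ, Bₙ, kₙ) with `ν xₙ Bₙ > ε` while `ν xₘ Bₙ <
  -- 2^(-kₙ)` for all `m < n`. The third entry only forces the exponents to increase strictly.
  obtain ⟨f, hf, hr⟩ := exists_seq_of_forall_finset_exists
    (fun a : X × Set S × ℕ => a.1 ∈ K ∧ MeasurableSet a.2.1 ∧ ε < ν a.1 a.2.1)
    (fun a b => ν a.1 b.2.1 < 2⁻¹ ^ b.2.2 ∧ a.2.2 < b.2.2) (by
      intro s hs
      obtain ⟨B, hB, hlt, x, hx, hxB⟩ := hcon (s.image Prod.fst)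
        (by
          intro x hx
          simp only [Finset.coe_image, mem_image, Finset.mem_coe] at hx
          obtain ⟨a, ha, rfl⟩ := hx
          exact (hs a ha).1)
        (2⁻¹ ^ (s.sup (fun a => a.2.2) + 1)) (by simp)
      refine ⟨(x, B, s.sup (fun a => a.2.2) + 1), ⟨hx, hB, hxB⟩, fun a ha => ⟨?_, ?_⟩⟩
      · exact (Finset.single_le_sum (f := fun y => ν y B) (fun _ _ => zero_le)
          (Finset.mem_image_of_mem Prod.fst ha)).trans_lt hlt
      · exact Nat.lt_succ_of_le (Finset.le_sup (f := fun a : X × Set S × ℕ => a.2.2) ha))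
  have hmono : StrictMono fun n => (f n).2.2 := fun m n h => (hr m n h).2
  have hsmall : ∀ m n, m < n → ν (f m).1 (f n).2.1 ≤ 2⁻¹ ^ n := fun m n h =>
    (hr m n h).1.le.trans (pow_le_pow_right_of_le_one' (by simp) (hmono.le_apply))
  set C : ℕ → Set S := fun j => ⋃ n, (f (n + j)).2.1 with hC
  have hCm : ∀ j, MeasurableSet (C j) := fun j => MeasurableSet.iUnion fun n => (hf _).2.1
  have hCanti : Antitone C := by
    refine antitone_nat_of_succ_le fun j => ?_
    refine iUnion_subset fun n => ?_
    have : n + (j + 1) = (n + 1) + j := by ring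
    rw [this]
    exact subset_iUnion (fun n => (f (n + j)).2.1) (n + 1)
  -- The limit superior of the `Bₙ`. By Borel-Cantelli it is null for every `ν xₘ`.
  set L : Set S := ⋂ j, C j with hL
  have hLm : MeasurableSet L := MeasurableSet.iInter hCm
  have hL0 : ∀ m, ν (f m).1 L = 0 := by
    intro m
    have hle : ∀ j, ν (f m).1 L ≤ 2⁻¹ ^ j * (2⁻¹ ^ (m + 1) * 2) := by
      intro j
      calc ν (f m).1 L ≤ ν (f m).1 (C (j + (m + 1))) := measure_mono (iInter_subset _ _)
        _ ≤ ∑' n, ν (f m).1 (f (n + (j + (m + 1)))).2.1 := measure_iUnion_le _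
        _ ≤ ∑' n, (2⁻¹ : ENNReal) ^ (n + (j + (m + 1))) :=
            ENNReal.tsum_le_tsum fun n => hsmall _ _ (by omega)
        _ = 2⁻¹ ^ j * (2⁻¹ ^ (m + 1) * 2) := by
            simp_rw [pow_add _ _ (j + (m + 1)), ENNReal.tsum_mul_right]
            rw [ENNReal.tsum_geometric, ENNReal.one_sub_inv_two, inv_inv, pow_add]
            ring
    have ht : Filter.Tendsto (fun j : ℕ => (2⁻¹ : ENNReal) ^ j * (2⁻¹ ^ (m + 1) * 2)) Filter.atTop
        (𝓝 (0 * (2⁻¹ ^ (m + 1) * 2))) :=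
      ENNReal.Tendsto.mul_const (ENNReal.tendsto_pow_atTop_nhds_zero_of_lt_one (by simp))
        (Or.inr (by finiteness))
    rw [zero_mul] at ht
    exact le_antisymm (ge_of_tendsto' ht hle) zero_le
  -- The functions `x ↦ ν x (C j \ L)` are continuous and decrease to `0`, so Dini's theorem makes
  -- the convergence uniform on `K`. At `x = xⱼ` this contradicts `ν xⱼ Bⱼ > ε`.
  have hdini : TendstoUniformlyOn (fun j x => (ν x (C j \ L)).toReal) (fun _ => 0)
      Filter.atTop K := by
    refine Antitone.tendstoUniformlyOn_of_forall_tendsto hK (fun j => ?_) (fun x _ i j hij => ?_)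
      continuousOn_const fun x _ => ?_
    · exact (ENNReal.continuousOn_toReal.comp_continuous (hν _ ((hCm j).diff hLm))
        fun x => measure_ne_top _ _).continuousOn
    · exact ENNReal.toReal_mono (measure_ne_top _ _)
        (measure_mono (sdiff_subset_sdiff_left (hCanti hij)))
    · have h1 := tendsto_measure_iInter_atTop (μ := ν x) (s := fun j => C j \ L)
        (fun j => ((hCm j).diff hLm).nullMeasurableSet)
        (fun i j hij => sdiff_subset_sdiff_left (hCanti hij)) ⟨0, measure_ne_top _ _⟩
      have h2 : ⋂ j, C j \ L = ∅ := by
        rw [eq_empty_iff_forall_notMem]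
        intro y hy
        rw [mem_iInter] at hy
        exact (hy 0).2 (mem_iInter.2 fun j => (hy j).1)
      rw [h2, measure_empty] at h1
      have := (ENNReal.tendsto_toReal (by simp : (0 : ENNReal) ≠ ⊤)).comp h1
      rw [ENNReal.toReal_zero] at this
      exact this
  have hε' : ε ≠ ⊤ := ((hf 0).2.2.trans_le le_top).ne
  obtain ⟨j, hj⟩ := (Metric.tendstoUniformlyOn_iff.1 hdini ε.toReal
    (ENNReal.toReal_pos hε hε')).exists
  have h1 := hj _ (hf j).1
  rw [dist_zero_left, Real.norm_eq_abs, abs_of_nonneg ENNReal.toReal_nonneg,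
    ENNReal.toReal_lt_toReal (measure_ne_top _ _) hε'] at h1
  have h2 : ν (f j).1 (f j).2.1 ≤ ν (f j).1 (C j \ L) := by
    calc ν (f j).1 (f j).2.1 ≤ ν (f j).1 (C j) := by
          refine measure_mono ?_
          have := subset_iUnion (fun n => (f (n + j)).2.1) 0
          simpa using this
      _ ≤ ν (f j).1 (C j \ L) + ν (f j).1 L := by
          refine (measure_mono fun y hy => ?_).trans (measure_union_le _ _)
          by_cases hyL : y ∈ L
          · exact Or.inr hyL
          · exact Or.inl ⟨hy, hyL⟩
      _ = _ := by rw [hL0, add_zero]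
  exact absurd ((hf j).2.2.trans_le h2) (not_lt.2 h1.le)

end Families

/-! ### Control measures -/

section UnifAC

variable {X : Type*} {S : Type*} [TopologicalSpace S] [T2Space S] [MeasurableSpace S] [BorelSpace S]

/-- Uniform absolute continuity of a family of measures, up to each `ε`, with respect to some finite
regular measure. -/
def UnifAC (K : Set X) (ν : X → Measure S) : Prop :=
  ∀ ε : ENNReal, ε ≠ 0 → ∃ m : Measure S, IsFiniteMeasure m ∧ m.Regular ∧ ∃ δ : ENNReal, δ ≠ 0 ∧
    ∀ B, MeasurableSet B → m B < δ → ∀ x ∈ K, ν x B ≤ ε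

theorem regular_finsetSum {ι : Type*} (s : Finset ι) (ν : ι → Measure S)
    [∀ x, IsFiniteMeasure (ν x)] [∀ x, (ν x).Regular] :
    IsFiniteMeasure (∑ x ∈ s, ν x) ∧ (∑ x ∈ s, ν x).Regular := by
  have : IsFiniteMeasure (∑ x ∈ s, ν x) := inferInstance
  have : (∑ x ∈ s, ν x).InnerRegular := inferInstance
  exact ⟨inferInstance, inferInstance⟩

theorem BorelCont.unifAC [TopologicalSpace X] {ν : X → Measure S} [∀ x, IsFiniteMeasure (ν x)]
    [∀ x, (ν x).Regular] (hν : BorelCont ν) {K : Set X} (hK : IsCompact K) : UnifAC K ν := by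
  intro ε hε
  obtain ⟨s, -, δ, hδ, h⟩ := hν.exists_finset hK hε
  obtain ⟨h1, h2⟩ := regular_finsetSum s ν
  refine ⟨∑ x ∈ s, ν x, h1, h2, δ, hδ, fun B hB hlt => h B hB ?_⟩
  rwa [Measure.finsetSum_apply] at hlt

/-- A uniformly absolutely continuous family has a control measure. -/
theorem UnifAC.exists_control {K : Set X} {ν : X → Measure S} (h : UnifAC K ν) :
    ∃ m : Measure S, IsFiniteMeasure m ∧ m.Regular ∧ ∀ ε : ENNReal, ε ≠ 0 → ∃ δ : ENNReal, δ ≠ 0 ∧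
      ∀ B, MeasurableSet B → m B < δ → ∀ x ∈ K, ν x B ≤ ε := by
  choose m hm hmr δ hδ hd using fun n : ℕ => h ((n : ENNReal)⁻¹) (by simp)
  -- Weights giving the sum of the `c n • m n` total mass at most `2`. Since `c n • m n ≤ M`, the
  -- threshold for `m n` becomes one for `M` after multiplication by `c n`.
  set c : ℕ → ENNReal := fun n => 2⁻¹ ^ n / (m n univ + 1) with hc
  have hc0 : ∀ n, c n ≠ 0 := fun n => by
    rw [hc]
    simp only [ne_eq, ENNReal.div_eq_zero_iff, not_or]
    exact ⟨by simp, by finiteness⟩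
  have hct : ∀ n, c n ≠ ⊤ := fun n => by
    rw [hc]
    exact ENNReal.div_ne_top (by finiteness) (by simp)
  set M := Measure.sum fun n => c n • m n with hM
  have hfin : IsFiniteMeasure M := by
    constructor
    rw [hM, Measure.sum_apply _ MeasurableSet.univ]
    calc ∑' n, (c n • m n) univ ≤ ∑' n, (2⁻¹ : ENNReal) ^ n := by
          refine ENNReal.tsum_le_tsum fun n => ?_
          rw [Measure.smul_apply, smul_eq_mul, hc]
          simp only
          rw [ENNReal.mul_comm_div]
          refine mul_le_of_le_one_right' ?_
          exact ENNReal.div_le_of_le_mul (by rw [one_mul]; exact le_self_add)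
      _ < ⊤ := by
          rw [ENNReal.tsum_geometric, ENNReal.one_sub_inv_two, inv_inv]
          simp
  have hir : M.InnerRegular := by
    have : ∀ n, (c n • m n).InnerRegular := fun n => inferInstance
    rw [hM]
    infer_instance
  refine ⟨M, hfin, inferInstance, fun ε hε => ?_⟩
  obtain ⟨n, hn⟩ := ENNReal.exists_inv_nat_lt hε
  refine ⟨c n * δ n, mul_ne_zero (hc0 n) (hδ n), fun B hB hlt x hx => ?_⟩
  refine (hd n B hB ?_ x hx).trans hn.le
  have h1 : c n * m n B ≤ M B := by
    rw [hM, Measure.sum_apply _ hB]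
    exact ENNReal.le_tsum (f := fun n => (c n • m n) B) n
  exact (ENNReal.mul_lt_mul_iff_right (hc0 n) (hct n)).1 (h1.trans_lt hlt)

end UnifAC

/-! ### Bounded functionals on M(S) and their approximation -/

section Dual

variable {S : Type*} [TopologicalSpace S] [T2Space S] [MeasurableSpace S] [BorelSpace S]

section

variable {m : Measure S} [IsFiniteMeasure m] [m.Regular] {h k : S → ℂ}

theorem dens_add (hh : Integrable h m) (hk : Integrable k m) :
    dens m (h + k) (hh.add hk) = dens m h hh + dens m k hk :=
  Subtype.ext (withDensityᵥ_add hh hk)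

theorem dens_sub (hh : Integrable h m) (hk : Integrable k m) :
    dens m (h - k) (hh.sub hk) = dens m h hh - dens m k hk :=
  Subtype.ext (withDensityᵥ_sub hh hk)

theorem dens_smul (c : ℂ) (hh : Integrable h m) :
    dens m (c • h) (hh.smul c) = c • dens m h hh :=
  Subtype.ext (withDensityᵥ_smul h c)

theorem dens_congr (hh : Integrable h m) (hk : Integrable k m) (e : h =ᵐ[m] k) :
    dens m h hh = dens m k hk :=
  Subtype.ext (WithDensityᵥEq.congr_ae e)

theorem norm_dens (hh : Integrable h m) : ‖dens m h hh‖ = ∫ x, ‖h x‖ ∂m := by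
  rw [norm_eq_real, absMeasure_dens, measureReal_def, withDensity_apply _ MeasurableSet.univ,
    Measure.restrict_univ, integral_norm_eq_lintegral_enorm hh.1]

/-- A bounded functional on `M(S)` is given by a bounded function on the measures with density
with respect to a fixed finite measure. -/
theorem exists_bounded_density (m : Measure S) [IsFiniteMeasure m] [m.Regular]
    (F : StrongDual ℂ (boundedRadon S)) :
    ∃ φ : S → ℂ, Measurable φ ∧ (∀ x, ‖φ x‖ ≤ ‖F‖) ∧
      ∀ (h : S → ℂ) (hh : Integrable h m), F (dens m h hh) = ∫ x, φ x * h x ∂m := by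
  classical
  have hint : ∀ {s : Set S}, MeasurableSet s → Integrable (s.indicator fun _ => (1 : ℂ)) m :=
    fun hs => (integrable_const _).indicator hs
  -- The set function `s ↦ F(1_s m)`, bounded by `‖F‖ m`. It is a complex measure, and its density
  -- with respect to `m` is the required function up to a null set.
  set v : Set S → ℂ := fun s => if hs : MeasurableSet s then F (dens m _ (hint hs)) else 0 with hv
  have hvs : ∀ {s : Set S} (hs : MeasurableSet s), v s = F (dens m _ (hint hs)) := fun hs => by
    simp [hv, hs]
  have hbd : ∀ s, ‖v s‖ₑ ≤ (‖F‖₊ • m) s := by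
    intro s
    by_cases hs : MeasurableSet s
    · have h1 : ‖v s‖ ≤ ‖F‖ * m.real s := by
        rw [hvs hs]
        refine (F.le_opNorm _).trans (le_of_eq ?_)
        rw [norm_dens]
        congr 1
        have : (fun x => ‖s.indicator (fun _ => (1 : ℂ)) x‖) = s.indicator fun _ => (1 : ℝ) := by
          ext x
          by_cases hx : x ∈ s <;> simp [hx]
        rw [this, integral_indicator_const _ hs]
        simp
      have h2 : (‖F‖₊ • m) s = ENNReal.ofReal (‖F‖ * m.real s) := by
        rw [ENNReal.ofReal_mul (norm_nonneg _), ofReal_norm, ofReal_measureReal]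
        rfl
      rw [h2, ← ofReal_norm]
      exact ENNReal.ofReal_le_ofReal h1
    · simp [hv, hs]
  set V : ComplexMeasure S := VectorMeasure.of_additive_of_le_measure v hbd
    (fun s t hs ht hst => by
      rw [hvs hs, hvs ht, hvs (hs.union ht), ← map_add, ← dens_add]
      congr 1
      refine dens_congr _ _ (Filter.EventuallyEq.of_eq ?_)
      exact indicator_union_of_disjoint hst _)
    (fun s hs => by simp [hv, hs]) with hV
  have hVs : ∀ {s : Set S} (hs : MeasurableSet s), V s = F (dens m _ (hint hs)) := fun hs => hvs hs
  obtain ⟨φ₀, hφ₀, e⟩ := exists_withDensityᵥ_eq (μ := V) (m := m) (fun s hs h0 => by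
    have := hbd s
    rw [Measure.smul_apply, h0, smul_zero] at this
    exact enorm_eq_zero.1 (le_antisymm this zero_le))
  have hle : m.withDensity (fun x => ‖φ₀ x‖ₑ) ≤ ‖F‖₊ • m := by
    rw [← Measure.variation_withDensityᵥ hφ₀, ← e]
    exact VectorMeasure.variation_le_of_forall_enorm_le fun s _ => hbd s
  set φ₁ := hφ₀.1.mk φ₀ with hφ₁
  have hφ₁m : Measurable φ₁ := hφ₀.1.stronglyMeasurable_mk.measurable
  have hae : φ₀ =ᵐ[m] φ₁ := hφ₀.1.ae_eq_mk
  have hle' : ∀ᵐ x ∂m, ‖φ₁ x‖ ≤ ‖F‖ := by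
    have h1 : (fun x => ‖φ₁ x‖ₑ) ≤ᵐ[m] fun _ => (‖F‖₊ : ENNReal) := by
      refine ae_le_of_forall_setLIntegral_le_of_sigmaFinite hφ₁m.enorm fun s hs _ => ?_
      have h2 := hle s
      rw [withDensity_apply _ hs] at h2
      rw [setLIntegral_const]
      refine le_trans (le_of_eq ?_) h2
      refine setLIntegral_congr_fun_ae hs ?_
      filter_upwards [hae] with x hx _
      rw [hx]
    filter_upwards [h1] with x hx
    exact_mod_cast hx
  -- The bound `‖F‖` holds only almost everywhere for `φ₁`; resetting the exceptional points to `0`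
  -- makes it hold everywhere.
  set φ : S → ℂ := fun x => if ‖φ₁ x‖ ≤ ‖F‖ then φ₁ x else 0 with hφ
  have hφm : Measurable φ :=
    Measurable.ite (measurableSet_le hφ₁m.norm measurable_const) hφ₁m measurable_const
  have hφb : ∀ x, ‖φ x‖ ≤ ‖F‖ := by
    intro x
    rw [hφ]
    simp only
    split_ifs with h
    · exact h
    · simp
  have hφae : φ =ᵐ[m] φ₀ := by
    filter_upwards [hae, hle'] with x hx hx'
    simp [hφ, hx', hx]
  have hmul : ∀ {h : S → ℂ}, Integrable h m → Integrable (fun x => φ x * h x) m := fun hh =>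
    hh.bdd_mul (c := ‖F‖) hφm.aestronglyMeasurable (Filter.Eventually.of_forall hφb)
  refine ⟨φ, hφm, hφb, ?_⟩
  have key : ∀ ⦃h : S → ℂ⦄, Integrable h m →
      ∀ hh : Integrable h m, F (dens m h hh) = ∫ x, φ x * h x ∂m := by
    refine Integrable.induction
      (fun h => ∀ hh : Integrable h m, F (dens m h hh) = ∫ x, φ x * h x ∂m) ?_ ?_ ?_ ?_
    · intro c s hs _ hh
      have e1 : dens m (s.indicator fun _ => c) hh = c • dens m _ (hint hs) := by
        rw [← dens_smul]
        refine dens_congr _ _ (Filter.EventuallyEq.of_eq ?_)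
        ext x
        by_cases hx : x ∈ s <;> simp [hx]
      have e2 : (fun x => φ x * s.indicator (fun _ => c) x) = s.indicator fun x => c * φ x := by
        ext x
        by_cases hx : x ∈ s <;> simp [hx, mul_comm]
      rw [e1, map_smul, ← hVs hs, e2, integral_indicator hs, integral_const_mul, e,
        withDensityᵥ_apply hφ₀ hs, smul_eq_mul]
      congr 1
      exact integral_congr_ae (ae_restrict_of_ae hφae.symm)
    · intro h k _ hh hk h1 h2 hhk
      rw [show dens m (h + k) hhk = dens m h hh + dens m k hk from dens_add hh hk, map_add, h1 hh,
        h2 hk, ← integral_add (hmul hh) (hmul hk)]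
      simp [mul_add]
    · have : {f : S →₁[m] ℂ | ∀ hh : Integrable f m, F (dens m f hh) = ∫ x, φ x * f x ∂m} =
          {f : S →₁[m] ℂ | F (dens m f (L1.integrable_coeFn f)) = ∫ x, φ x * f x ∂m} := by
        ext f
        exact ⟨fun h => h _, fun h _ => h⟩
      rw [this]
      refine isClosed_eq ?_ ?_
      · refine F.continuous.comp ?_
        refine (LipschitzWith.of_dist_le_mul (K := 1) fun f g => ?_).continuous
        rw [dist_eq_norm, ← dens_sub, norm_dens, NNReal.coe_one, one_mul, L1.dist_eq_integral_dist]
        simp_rw [dist_eq_norm]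
        rfl
      · refine (LipschitzWith.of_dist_le_mul (K := ‖F‖₊) fun f g => ?_).continuous
        rw [dist_eq_norm, ← integral_sub (hmul (L1.integrable_coeFn f))
          (hmul (L1.integrable_coeFn g)), L1.dist_eq_integral_dist, coe_nnnorm,
          ← integral_const_mul]
        refine norm_integral_le_of_norm_le ?_ (Filter.Eventually.of_forall fun x => ?_)
        · simp_rw [dist_eq_norm]
          exact (((L1.integrable_coeFn f).sub (L1.integrable_coeFn g)).norm).const_mul _
        · rw [← mul_sub, norm_mul, dist_eq_norm]
          gcongr
          exact hφb x
    · intro h k hhk hh h1 hk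
      rw [← dens_congr hh hk hhk, h1 hh]
      refine integral_congr_ae ?_
      filter_upwards [hhk] with x hx using by rw [hx]
  exact fun h hh => key hh hh

/-- The dual of `L¹(m)` is `L^∞(m)`. The function depends on `m`, but one function serves all `κ ≪
m`, hence the need for control measures. -/
theorem exists_functional_eq_cint (m : Measure S) [IsFiniteMeasure m] [m.Regular]
    (F : StrongDual ℂ (boundedRadon S)) :
    ∃ φ : S → ℂ, Measurable φ ∧ (∀ x, ‖φ x‖ ≤ ‖F‖) ∧
      ∀ κ : boundedRadon S, absMeasure κ ≪ m → F κ = cint κ φ := by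
  obtain ⟨φ, hφ, hb, h⟩ := exists_bounded_density m F
  refine ⟨φ, hφ, hb, fun κ hκ => ?_⟩
  obtain ⟨f, hf, rfl⟩ := exists_eq_dens hκ
  rw [h, cint_dens hf (integrable_of_norm_le hφ hb)]

end

/-- Radial truncation of complex numbers to the closed ball of radius `M`. -/
noncomputable def radialTrunc (M : ℝ) (z : ℂ) : ℂ := ((M / max M ‖z‖ : ℝ) : ℂ) * z

theorem radialTrunc_zero (M : ℝ) : radialTrunc M 0 = 0 := by simp [radialTrunc]

theorem continuous_radialTrunc {M : ℝ} (hM : 0 < M) : Continuous (radialTrunc M) := by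
  refine Continuous.mul (Complex.continuous_ofReal.comp ?_) continuous_id
  refine continuous_const.div (continuous_const.max continuous_norm) fun z => ?_
  exact (hM.trans_le (le_max_left _ _)).ne'

theorem norm_radialTrunc_le {M : ℝ} (hM : 0 < M) (z : ℂ) : ‖radialTrunc M z‖ ≤ M := by
  have h0 : 0 < max M ‖z‖ := hM.trans_le (le_max_left _ _)
  rw [radialTrunc, norm_mul, Complex.norm_real, Real.norm_eq_abs, abs_of_nonneg (by positivity),
    div_mul_eq_mul_div, div_le_iff₀ h0]
  gcongr
  exact le_max_right _ _

/-- Truncation moves `z` by the amount by which `‖z‖` exceeds `M`, which is at most `‖w - z‖`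
because `w` lies in the ball. -/
theorem norm_sub_radialTrunc_le {M : ℝ} (hM : 0 < M) {w : ℂ} (hw : ‖w‖ ≤ M) (z : ℂ) :
    ‖w - radialTrunc M z‖ ≤ 2 * ‖w - z‖ := by
  have h0 : 0 < max M ‖z‖ := hM.trans_le (le_max_left _ _)
  have h1 : ‖z - radialTrunc M z‖ ≤ ‖w - z‖ := by
    have e : z - radialTrunc M z = ((1 - M / max M ‖z‖ : ℝ) : ℂ) * z := by
      rw [radialTrunc]
      push_cast
      ring
    have hle : M / max M ‖z‖ ≤ 1 := (div_le_one h0).2 (le_max_left _ _)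
    rw [e, norm_mul, Complex.norm_real, Real.norm_eq_abs, abs_of_nonneg (by linarith)]
    rcases le_total ‖z‖ M with h | h
    · rw [max_eq_left h, div_self hM.ne']
      simp
    · rw [max_eq_right h]
      have hz : ‖z‖ ≠ 0 := (hM.trans_le h).ne'
      have : (1 - M / ‖z‖) * ‖z‖ = ‖z‖ - M := by field_simp
      rw [this]
      have := norm_sub_norm_le z w
      rw [norm_sub_rev] at this
      linarith
  calc ‖w - radialTrunc M z‖ = ‖(w - z) + (z - radialTrunc M z)‖ := by congr 1; ring
    _ ≤ ‖w - z‖ + ‖z - radialTrunc M z‖ := norm_add_le _ _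
    _ ≤ _ := by linarith

theorem exists_hasCompactSupport_norm_le_integral_norm_sub_le [LocallyCompactSpace S]
    {m : Measure S} [IsFiniteMeasure m] [m.Regular] {φ : S → ℂ} (hφ : Measurable φ) {M : ℝ}
    (hM : 0 < M) (hφM : ∀ x, ‖φ x‖ ≤ M) {ε : ℝ} (hε : 0 < ε) :
    ∃ g : S → ℂ, Continuous g ∧ HasCompactSupport g ∧ (∀ x, ‖g x‖ ≤ M) ∧
      ∫ x, ‖φ x - g x‖ ∂m ≤ ε := by
  obtain ⟨g₀, hg₀, hg₀', hle⟩ := exists_hasCompactSupport_integral_norm_sub_le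
    (integrable_of_norm_le hφ hφM : Integrable φ m) (half_pos hε)
  have hgc : Continuous fun x => radialTrunc M (g₀ x) := (continuous_radialTrunc hM).comp hg₀
  have hgM : ∀ x, ‖radialTrunc M (g₀ x)‖ ≤ M := fun x => norm_radialTrunc_le hM _
  refine ⟨fun x => radialTrunc M (g₀ x), hgc,
    hg₀'.comp_left (g := radialTrunc M) (radialTrunc_zero M), hgM, ?_⟩
  have hig : Integrable (fun x => φ x - radialTrunc M (g₀ x)) m :=
    (integrable_of_norm_le hφ hφM).sub (integrable_of_norm_le hgc.measurable hgM)
  have h1 : Integrable (fun x => ‖φ x - g₀ x‖) m :=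
    ((integrable_of_norm_le hφ hφM).sub (hg₀.integrable_of_hasCompactSupport hg₀')).norm
  calc ∫ x, ‖φ x - radialTrunc M (g₀ x)‖ ∂m ≤ ∫ x, 2 * ‖φ x - g₀ x‖ ∂m :=
        integral_mono hig.norm (h1.const_mul 2) fun x => norm_sub_radialTrunc_le hM (hφM x) _
    _ = 2 * ∫ x, ‖φ x - g₀ x‖ ∂m := integral_const_mul _ _
    _ ≤ _ := by linarith

/-- On the measures dominated by a uniformly absolutely continuous family, a bounded functional on
`M(S)` is uniformly approximated by integration against a continuous function with compact
support. -/
theorem UnifAC.exists_approx [LocallyCompactSpace S] {X : Type*} {K : Set X} {ν : X → Measure S}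
    [∀ x, IsFiniteMeasure (ν x)] (h : UnifAC K ν) {C : ℝ} (hC : ∀ x ∈ K, (ν x).real univ ≤ C)
    (F : StrongDual ℂ (boundedRadon S)) {ε : ℝ} (hε : 0 < ε) :
    ∃ g : S → ℂ, Continuous g ∧ HasCompactSupport g ∧ (∀ y, ‖g y‖ ≤ ‖F‖ + 1) ∧
      ∀ x ∈ K, ∀ κ : boundedRadon S, absMeasure κ ≤ ν x → ‖F κ - cint κ g‖ ≤ ε := by
  obtain ⟨m, hm, hmr, hctl⟩ := h.exists_control
  obtain ⟨φ, hφ, hφb, hF⟩ := exists_functional_eq_cint m F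
  -- The summand `1` keeps the truncation radius positive when `F = 0`.
  obtain ⟨M, hM⟩ : ∃ M, M = ‖F‖ + 1 := ⟨_, rfl⟩
  have hM0 : 0 < M := by rw [hM]; positivity
  have hφM : ∀ x, ‖φ x‖ ≤ M := fun x => (hφb x).trans (by linarith)
  -- `τ` is the pointwise error tolerated off a bad set `B`, and `ε'` the mass that the measures may
  -- have on `B`, where the error is at most `2M`. Each contributes at most `ε / 2`.
  obtain ⟨τ, hτ0, e1⟩ : ∃ τ : ℝ, 0 < τ ∧ τ * (|C| + 1) = ε / 2 :=
    ⟨ε / (2 * (|C| + 1)), by positivity, by field_simp⟩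
  obtain ⟨ε', hε'0, e2⟩ : ∃ ε' : ℝ, 0 < ε' ∧ 2 * M * ε' = ε / 2 :=
    ⟨ε / (2 * (2 * M)), by positivity, by field_simp⟩
  obtain ⟨δ, hδ, hd⟩ := hctl (ENNReal.ofReal ε') (by simpa using hε'0)
  obtain ⟨δ', hδ'0, hδ'le⟩ : ∃ δ' : ℝ, 0 < δ' ∧ ENNReal.ofReal δ' ≤ δ := by
    refine ⟨(min δ 1).toReal, ENNReal.toReal_pos (by simp [hδ]) (by simp), ?_⟩
    rw [ENNReal.ofReal_toReal (by simp)]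
    exact min_le_left _ _
  -- By Markov's inequality this `L¹` error forces `m B ≤ δ' / 2`, where `B` is the set on which the
  -- error reaches `τ`.
  obtain ⟨g, hgc, hgs, hgM, hm1⟩ := exists_hasCompactSupport_norm_le_integral_norm_sub_le (m := m)
    hφ hM0 hφM (ε := τ * (δ' / 2)) (by positivity)
  have hig : ∀ {n : Measure S} [IsFiniteMeasure n], Integrable (fun x => φ x - g x) n :=
    (integrable_of_norm_le hφ hφb).sub (integrable_of_norm_le hgc.measurable hgM)
  obtain ⟨B, hB⟩ : ∃ B : Set S, B = {x | τ ≤ ‖φ x - g x‖} := ⟨_, rfl⟩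
  have hBm : MeasurableSet B := by
    rw [hB]
    exact measurableSet_le measurable_const (hφ.sub hgc.measurable).norm
  have hmB : m B < δ := by
    refine lt_of_lt_of_le ?_ hδ'le
    rw [ENNReal.lt_ofReal_iff_toReal_lt (measure_ne_top _ _)]
    have h1 := mul_meas_ge_le_integral_of_nonneg
      (Filter.Eventually.of_forall fun x => norm_nonneg (φ x - g x)) (hig (n := m)).norm τ
    rw [← hB] at h1
    have h3 := le_of_mul_le_mul_left (h1.trans hm1) hτ0
    change m.real B < δ'
    linarith
  refine ⟨g, hgc, hgs, fun x => hM ▸ hgM x, fun x hx κ hκ => ?_⟩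
  have hac : absMeasure κ ≪ m := by
    refine Measure.AbsolutelyContinuous.mk fun s hs h0 => ?_
    refine le_antisymm (le_of_forall_pos_le_add fun e he => ?_) zero_le
    obtain ⟨d, hd0, hd'⟩ := hctl e he.ne'
    rw [zero_add]
    exact (hκ s).trans (hd' s hs (by rw [h0]; exact pos_iff_ne_zero.2 hd0) x hx)
  rw [hF κ hac]
  refine (norm_cint_sub_le (integrable_of_norm_le hφ hφb)
    (integrable_of_norm_le hgc.measurable hgM)).trans ?_
  have hκB : (absMeasure κ).real Bᶜᶜ ≤ ε' := by
    rw [compl_compl]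
    exact ENNReal.toReal_le_of_le_ofReal hε'0.le ((hκ B).trans (hd B hBm hmB x hx))
  have hκu : (absMeasure κ).real univ ≤ |C| := by
    refine (ENNReal.toReal_mono (measure_ne_top _ _) (hκ univ)).trans ?_
    exact (hC x hx).trans (le_abs_self C)
  refine (integral_norm_le_add (δ := τ) (C := 2 * M) hBm.compl hτ0.le (fun y hy => ?_)
    fun y => ?_).trans ?_
  · rw [hB, mem_compl_iff, mem_ofPred_eq, not_le] at hy
    exact hy.le
  · exact (norm_sub_le _ _).trans (by linarith [hφM y, hgM y])
  · have h3 : τ * (absMeasure κ).real univ ≤ τ * |C| := by gcongr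
    have h4 : 2 * M * (absMeasure κ).real Bᶜᶜ ≤ 2 * M * ε' := by gcongr
    nlinarith

end Dual

/-! ### From test functions to functionals along a family -/

section FunctionalOfFamily

variable {S : Type*} [TopologicalSpace S] [T2Space S] [LocallyCompactSpace S] [MeasurableSpace S]
  [BorelSpace S]

/-- On a compact neighbourhood of each point, `x ↦ F (κ x)` is a uniform limit of the continuous
functions `x ↦ cint (κ x) g`. -/
theorem continuous_functional_family {X : Type*} [TopologicalSpace X] [LocallyCompactSpace X]
    {ν : X → Measure S} [∀ x, IsFiniteMeasure (ν x)]
    (hU : ∀ K : Set X, IsCompact K → UnifAC K ν) {C : ℝ} (hC : ∀ x, (ν x).real univ ≤ C)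
    {κ : X → boundedRadon S} (hκ : ∀ x, absMeasure (κ x) ≤ ν x)
    (hcont : ∀ g : S → ℂ, Continuous g → HasCompactSupport g → Continuous fun x => cint (κ x) g)
    (F : StrongDual ℂ (boundedRadon S)) : Continuous fun x => F (κ x) := by
  rw [continuous_iff_continuousAt]
  intro x
  refine continuousAt_of_locally_uniform_approx_of_continuousAt fun u hu => ?_
  obtain ⟨ε, hε, hεu⟩ := Metric.mem_uniformity_dist.1 hu
  obtain ⟨K, hK, hxK⟩ := exists_compact_mem_nhds x
  obtain ⟨g, hg, hg', -, hF⟩ := (hU K hK).exists_approx (fun x _ => hC x) F (half_pos hε)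
  refine ⟨K, hxK, fun x => cint (κ x) g, (hcont g hg hg').continuousAt, fun y hy => ?_⟩
  refine hεu ?_
  rw [dist_eq_norm]
  exact (hF y hy _ (hκ y)).trans_lt (half_lt_self hε)

/-- `F` is replaced by integration against one test function, for which the identity is assumed. The
error is uniform over a compact set carrying most of `μ`, and boundedness handles the remainder. -/
theorem functional_eq_cint_family [Nonempty S] {ν : S → Measure S} [∀ x, IsFiniteMeasure (ν x)]
    [∀ x, (ν x).Regular] (hν : BorelCont ν) {C : ℝ} (hC : ∀ x, (ν x).real univ ≤ C)
    {κ : S → boundedRadon S} (hκ : ∀ x, absMeasure (κ x) ≤ ν x)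
    (hcont : ∀ g : S → ℂ, Continuous g → HasCompactSupport g → Continuous fun x => cint (κ x) g)
    {μ κ₀ : boundedRadon S} (h : ∀ g : S → ℂ, Continuous g → HasCompactSupport g →
      cint κ₀ g = cint μ fun x => cint (κ x) g)
    (F : StrongDual ℂ (boundedRadon S)) : F κ₀ = cint μ fun x => F (κ x) := by
  obtain ⟨x₀⟩ := ‹Nonempty S›
  have hFc := continuous_functional_family (fun K hK => hν.unifAC hK) hC hκ hcont F
  have hC0 : 0 ≤ C := measureReal_nonneg.trans (hC x₀)
  have hκn : ∀ x, ‖κ x‖ ≤ C := fun x =>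
    (ENNReal.toReal_mono (measure_ne_top _ _) (hκ x univ)).trans (hC x)
  have hFκ : ∀ x, ‖F (κ x)‖ ≤ ‖F‖ * C := fun x => by
    refine (F.le_opNorm _).trans ?_
    gcongr
    exact hκn x
  rw [← sub_eq_zero, ← norm_le_zero_iff]
  refine le_of_forall_pos_le_add fun ε hε => ?_
  -- The three summands account for the error at `κ₀`, the error on the compact set, and the part of
  -- `μ` outside it.
  obtain ⟨δ, hδ, e⟩ : ∃ δ : ℝ, 0 < δ ∧ δ * (1 + ‖μ‖ + (2 * ‖F‖ + 1) * C) = ε :=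
    ⟨ε / (1 + ‖μ‖ + (2 * ‖F‖ + 1) * C), by positivity, by field_simp⟩
  obtain ⟨Q₀, hQ₀, hlt₀⟩ := exists_isCompact_real_compl_lt (absMeasure μ) hδ
  -- Adding `|κ₀|` to every member of the family lets the same test function serve `κ₀`; the point
  -- `x₀` ensures that there is a member to use for this.
  have hQ : IsCompact (insert x₀ Q₀) := hQ₀.insert x₀
  have hlt : (absMeasure μ).real (insert x₀ Q₀)ᶜ ≤ δ :=
    (measureReal_mono (compl_subset_compl.2 (subset_insert _ _))).trans hlt₀.le
  have hν' : BorelCont fun x => ν x + absMeasure κ₀ := fun B hB => by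
    simp only [Measure.add_apply]
    exact (hν B hB).add continuous_const
  have hreg : ∀ x, (ν x + absMeasure κ₀).Regular := fun x => by
    have : (ν x + absMeasure κ₀).InnerRegular := inferInstance
    infer_instance
  obtain ⟨g, hg, hg', hgb, hF⟩ := (hν'.unifAC hQ).exists_approx (C := C + ‖κ₀‖) (fun x _ => by
    rw [measureReal_add_apply, norm_eq_real]
    linarith [hC x]) F hδ
  have h1 : ‖F κ₀ - cint κ₀ g‖ ≤ δ := hF x₀ (mem_insert _ _) κ₀ (Measure.le_add_left le_rfl)
  have hgκ : ∀ x, ‖cint (κ x) g‖ ≤ (‖F‖ + 1) * C := fun x => by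
    refine (norm_cint_le_of_norm_le hgb).trans ?_
    gcongr
    exact hκn x
  have hi1 : Integrable (fun x => cint (κ x) g) (absMeasure μ) :=
    integrable_of_norm_le (hcont g hg hg').measurable hgκ
  have hi2 : Integrable (fun x => F (κ x)) (absMeasure μ) :=
    integrable_of_norm_le hFc.measurable hFκ
  have h2 : ‖cint μ fun x => cint (κ x) g - F (κ x)‖ ≤
      δ * ‖μ‖ + ((2 * ‖F‖ + 1) * C) * (absMeasure μ).real (insert x₀ Q₀)ᶜ := by
    refine norm_cint_le_of_norm_le_add μ hQ.measurableSet hδ.le (fun x hx => ?_) fun x => ?_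
    · rw [norm_sub_rev]
      exact hF x hx _ ((hκ x).trans (Measure.le_add_right le_rfl))
    · exact (norm_sub_le _ _).trans (by linarith [hgκ x, hFκ x])
  have h3 : ((2 * ‖F‖ + 1) * C) * (absMeasure μ).real (insert x₀ Q₀)ᶜ ≤
      ((2 * ‖F‖ + 1) * C) * δ := by gcongr
  have key : F κ₀ - cint μ (fun x => F (κ x)) =
      (F κ₀ - cint κ₀ g) + cint μ fun x => cint (κ x) g - F (κ x) := by
    rw [cint_sub hi1 hi2, ← h g hg hg']
    ring
  rw [key]
  refine (norm_add_le _ _).trans ?_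
  nlinarith

/-- Evaluation on a set, as a bounded functional on `M(S)`. -/
noncomputable def evalSet (B : Set S) : StrongDual ℂ (boundedRadon S) :=
  LinearMap.mkContinuous
    { toFun := fun μ => (μ : ComplexMeasure S) B
      map_add' := fun _ _ => rfl
      map_smul' := fun _ _ => rfl } 1 fun μ => by
    rw [one_mul]
    exact norm_apply_le μ B

omit [LocallyCompactSpace S] in
theorem evalSet_apply (B : Set S) (μ : boundedRadon S) :
    evalSet B μ = (μ : ComplexMeasure S) B := rfl

omit [LocallyCompactSpace S] in
theorem continuous_measure_of_continuous_evalSet {X : Type*} [TopologicalSpace X]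
    {ν : X → Measure S} [∀ x, IsFiniteMeasure (ν x)] [∀ x, (ν x).Regular] {B : Set S}
    (hB : MeasurableSet B) (h : Continuous fun x => evalSet B (ofFiniteMeasure (ν x))) :
    Continuous fun x => ν x B := by
  simp_rw [evalSet_apply, ofFiniteMeasure_apply hB] at h
  have h2 : Continuous fun x => (ν x).real B := by
    have := Complex.continuous_re.comp h
    simpa [Function.comp_def] using this
  have := ENNReal.continuous_ofReal.comp h2
  simpa [Function.comp_def] using this

end FunctionalOfFamily

/-! ### Measures with continuous translates -/

section TransCont

variable {S : Type*} [TopologicalSpace S] [T2Space S] [MeasurableSpace S] [BorelSpace S]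

/-- The images of `m` under the maps `p x` depend continuously on `x`, when evaluated on
measurable sets. -/
def TransCont (p : S → S → S) (m : Measure S) : Prop := BorelCont fun x => m.map (p x)

theorem regular_map {m : Measure S} [IsFiniteMeasure m] [m.Regular] {f : S → S}
    (hf : Continuous f) : (m.map f).Regular := by
  have : (m.map f).InnerRegular := Measure.InnerRegular.map_of_continuous hf
  infer_instance

variable {p : S → S → S}

omit [T2Space S] in
theorem transCont_iff (hp : Continuous (Function.uncurry p)) {m : Measure S} :
    TransCont p m ↔ ∀ B, MeasurableSet B → Continuous fun x => m (p x ⁻¹' B) := by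
  have : ∀ x, Measurable (p x) := fun x => (hp.comp (Continuous.prodMk_right x)).measurable
  refine forall₂_congr fun B hB => ?_
  simp_rw [Measure.map_apply (this _) hB]

omit [T2Space S] in
theorem TransCont.add (hp : Continuous (Function.uncurry p)) {m n : Measure S}
    (hm : TransCont p m) (hn : TransCont p n) : TransCont p (m + n) := by
  rw [transCont_iff hp] at *
  intro B hB
  simp only [Measure.add_apply]
  exact (hm B hB).add (hn B hB)

omit [T2Space S] in
theorem TransCont.smul (hp : Continuous (Function.uncurry p)) {m : Measure S}
    (hm : TransCont p m) (c : NNReal) : TransCont p (c • m) := by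
  rw [transCont_iff hp] at *
  intro B hB
  simp only [Measure.smul_apply]
  have : (fun x => c • m (p x ⁻¹' B)) = fun x => (c : ENNReal) * m (p x ⁻¹' B) := rfl
  rw [this]
  exact (ENNReal.continuous_const_mul ENNReal.coe_ne_top).comp (hm B hB)

omit [T2Space S] in
theorem TransCont.finsetSum (hp : Continuous (Function.uncurry p)) {ι : Type*} (s : Finset ι)
    {m : ι → Measure S} (hm : ∀ i ∈ s, TransCont p (m i)) : TransCont p (∑ i ∈ s, m i) := by
  rw [transCont_iff hp]
  intro B hB
  simp only [Measure.finsetSum_apply]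
  exact continuous_finsetSum s fun i hi => (transCont_iff hp).1 (hm i hi) B hB

theorem cint_ofFiniteMeasure_map {m : Measure S} [IsFiniteMeasure m] [m.Regular] {f : S → S}
    (hf : Continuous f) [(m.map f).Regular] {g : S → ℂ} (hg : Continuous g) {C : ℝ}
    (hC : ∀ x, ‖g x‖ ≤ C) :
    cint (ofFiniteMeasure (m.map f)) g = cint (ofFiniteMeasure m) fun y => g (f y) := by
  have hi : Integrable (fun y => g (f y)) m :=
    integrable_of_norm_le (hg.comp hf).measurable fun y => hC _
  rw [cint_ofFiniteMeasure (integrable_of_norm_le hg.measurable hC), cint_ofFiniteMeasure hi,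
    integral_map hf.aemeasurable hg.aestronglyMeasurable]

variable [LocallyCompactSpace S]

/-- The translates of `n` are dominated by those of `m`, hence uniformly absolutely continuous over
compact sets, and they are always vaguely continuous. Evaluation on a Borel set is a functional, so
it too is continuous along them. -/
theorem TransCont.mono (hp : Continuous (Function.uncurry p)) {m n : Measure S}
    [IsFiniteMeasure m] [m.Regular] (hm : TransCont p m) (h : n ≤ m) : TransCont p n := by
  have hpx : ∀ x, Continuous (p x) := fun x => hp.comp (Continuous.prodMk_right x)
  have : IsFiniteMeasure n := isFiniteMeasure_of_le m h
  have : n.Regular := regular_of_le_of_regular inferInstance h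
  have hnr : ∀ x, (n.map (p x)).Regular := fun x => regular_map (hpx x)
  have hmr : ∀ x, (m.map (p x)).Regular := fun x => regular_map (hpx x)
  intro B hB
  refine continuous_measure_of_continuous_evalSet hB ?_
  refine continuous_functional_family (ν := fun x => m.map (p x)) (fun K hK => hm.unifAC hK)
    (C := m.real univ) (fun x => ?_) (fun x => ?_) (fun g hg hg' => ?_) _
  · rw [measureReal_def, measureReal_def, Measure.map_apply (hpx x).measurable MeasurableSet.univ,
      preimage_univ]
  · rw [absMeasure_ofFiniteMeasure]
    exact Measure.map_mono h (hpx x).measurable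
  · obtain ⟨C, hC⟩ := hg'.exists_bound_of_continuous hg
    simp_rw [cint_ofFiniteMeasure_map (hpx _) hg hC]
    exact continuous_cint (H := fun x y => g (p x y)) _ (hg.comp hp) fun x y => hC _

/-- Translates `x ↦ κ x` dominated by the translates of a `TransCont` measure are weakly continuous
as soon as they are vaguely continuous. -/
theorem TransCont.continuous_functional (hp : Continuous (Function.uncurry p)) {m : Measure S}
    [IsFiniteMeasure m] [m.Regular] (hm : TransCont p m) {κ : S → boundedRadon S}
    (hκ : ∀ x, absMeasure (κ x) ≤ m.map (p x))
    (hcont : ∀ g : S → ℂ, Continuous g → HasCompactSupport g → Continuous fun x => cint (κ x) g)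
    (F : StrongDual ℂ (boundedRadon S)) : Continuous fun x => F (κ x) := by
  have hpx : ∀ x, Continuous (p x) := fun x => hp.comp (Continuous.prodMk_right x)
  have hmr : ∀ x, (m.map (p x)).Regular := fun x => regular_map (hpx x)
  refine continuous_functional_family (ν := fun x => m.map (p x)) (fun K hK => hm.unifAC hK)
    (C := m.real univ) (fun x => ?_) hκ hcont F
  rw [measureReal_def, measureReal_def, Measure.map_apply (hpx x).measurable MeasurableSet.univ,
    preimage_univ]

theorem TransCont.functional_eq_cint [Nonempty S] (hp : Continuous (Function.uncurry p))
    {m : Measure S} [IsFiniteMeasure m] [m.Regular] (hm : TransCont p m) {κ : S → boundedRadon S}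
    (hκ : ∀ x, absMeasure (κ x) ≤ m.map (p x))
    (hcont : ∀ g : S → ℂ, Continuous g → HasCompactSupport g → Continuous fun x => cint (κ x) g)
    {μ κ₀ : boundedRadon S} (h : ∀ g : S → ℂ, Continuous g → HasCompactSupport g →
      cint κ₀ g = cint μ fun x => cint (κ x) g)
    (F : StrongDual ℂ (boundedRadon S)) : F κ₀ = cint μ fun x => F (κ x) := by
  have hpx : ∀ x, Continuous (p x) := fun x => hp.comp (Continuous.prodMk_right x)
  have hmr : ∀ x, (m.map (p x)).Regular := fun x => regular_map (hpx x)
  refine functional_eq_cint_family (ν := fun x => m.map (p x)) hm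
    (C := m.real univ) (fun x => ?_) hκ hcont h F
  rw [measureReal_def, measureReal_def, Measure.map_apply (hpx x).measurable MeasurableSet.univ,
    preimage_univ]

section Associative

variable (hp : Continuous (Function.uncurry p)) (hassoc : ∀ x y z, p (p x y) z = p x (p y z))

include hp in
-- The formula for the convolution of `m` and `n`, assumed on test functions, extends to indicators
-- of Borel sets because the translates of `n` are continuous.
theorem TransCont.conv_apply [Nonempty S] {m n k : boundedRadon S} (hn : IsPos n) (hk : IsPos k)
    (h : TransCont p (absMeasure n))
    (hconv : ∀ g : S → ℂ, Continuous g → HasCompactSupport g →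
      cint k g = cint m fun z => cint n fun y => g (p z y)) {B : Set S} (hB : MeasurableSet B) :
    (((absMeasure k).real B : ℝ) : ℂ) =
      cint m fun z => (((absMeasure n).real (p z ⁻¹' B) : ℝ) : ℂ) := by
  have hpx : ∀ x, Continuous (p x) := fun x => hp.comp (Continuous.prodMk_right x)
  have hr : ∀ x, ((absMeasure n).map (p x)).Regular := fun x => regular_map (hpx x)
  have key := h.functional_eq_cint hp (κ := fun x => ofFiniteMeasure ((absMeasure n).map (p x)))
    (μ := m) (κ₀ := k) (fun x => by rw [absMeasure_ofFiniteMeasure]) (fun g hg hg' => by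
      obtain ⟨C, hC⟩ := hg'.exists_bound_of_continuous hg
      simp_rw [cint_ofFiniteMeasure_map (hpx _) hg hC, ← hn.eq]
      exact continuous_cint (H := fun x y => g (p x y)) _ (hg.comp hp) fun x y => hC _)
    (fun g hg hg' => by
      obtain ⟨C, hC⟩ := hg'.exists_bound_of_continuous hg
      simp_rw [cint_ofFiniteMeasure_map (hpx _) hg hC, ← hn.eq]
      exact hconv g hg hg') (evalSet B)
  rw [evalSet_apply, hk.eq, ofFiniteMeasure_apply hB] at key
  rw [key]
  congr 1
  ext x
  rw [evalSet_apply, ofFiniteMeasure_apply hB, measureReal_def, measureReal_def,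
    Measure.map_apply (hpx x).measurable hB]

include hp hassoc in
-- By associativity the translate of the convolution by `x` has on `B` the value `∫ |n|(p (p x z)
-- ⁻¹' B) dm(z)`, whose integrand is jointly continuous in `(x, z)`.
theorem TransCont.conv [Nonempty S] {m n k : boundedRadon S} (hn : IsPos n) (hk : IsPos k)
    (h : TransCont p (absMeasure n))
    (hconv : ∀ g : S → ℂ, Continuous g → HasCompactSupport g →
      cint k g = cint m fun z => cint n fun y => g (p z y)) : TransCont p (absMeasure k) := by
  have hpx : ∀ x, Continuous (p x) := fun x => hp.comp (Continuous.prodMk_right x)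
  rw [transCont_iff hp]
  intro B hB
  have e : ∀ x, (((absMeasure k).real (p x ⁻¹' B) : ℝ) : ℂ) =
      cint m fun z => (((absMeasure n).real (p (p x z) ⁻¹' B) : ℝ) : ℂ) := fun x => by
    rw [TransCont.conv_apply hp hn hk h hconv ((hpx x).measurable hB)]
    congr 1
    ext z
    have : p z ⁻¹' (p x ⁻¹' B) = p (p x z) ⁻¹' B := by
      ext y
      simp [hassoc]
    rw [this]
  have hc : Continuous fun u => (absMeasure n).real (p u ⁻¹' B) :=
    ENNReal.continuousOn_toReal.comp_continuous ((transCont_iff hp).1 h B hB)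
      fun x => measure_ne_top _ _
  have h1 : Continuous fun x => (((absMeasure k).real (p x ⁻¹' B) : ℝ) : ℂ) := by
    simp_rw [e]
    refine continuous_cint (C := (absMeasure n).real univ) m
      (Complex.continuous_ofReal.comp (hc.comp hp)) fun x z => ?_
    rw [Complex.norm_real, Real.norm_eq_abs, abs_of_nonneg measureReal_nonneg]
    exact measureReal_mono (subset_univ _)
  have h2 := ENNReal.continuous_ofReal.comp (Complex.continuous_re.comp h1)
  simpa [Function.comp_def] using h2

include hp hassoc in
-- Joint continuity comes from applying uniform absolute continuity twice. Right translates are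
-- controlled by a finite sum `l` of right translates; left and right translations commute, so `l`
-- has continuous left translates, and these are again controlled by a finite sum.
theorem TransCont.continuous_two_sided {n : boundedRadon S} (h : TransCont p (absMeasure n))
    (h' : TransCont (fun x y => p y x) (absMeasure n)) {B : Set S} (hB : MeasurableSet B) :
    Continuous fun w : S × S => absMeasure n ((fun y => p (p w.1 y) w.2) ⁻¹' B) := by
  have hpx : ∀ x, Continuous (p x) := fun x => hp.comp (Continuous.prodMk_right x)
  have hp' : Continuous (Function.uncurry fun x y => p y x) := hp.comp continuous_swap
  have hpx' : ∀ x, Continuous fun y => p y x := fun x => hp.comp (Continuous.prodMk_left x)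
  have hw : ∀ w : S × S, Continuous fun y => p (p w.1 y) w.2 := fun w =>
    (hpx' w.2).comp (hpx w.1)
  have hr : ∀ w : S × S, ((absMeasure n).map fun y => p (p w.1 y) w.2).Regular := fun w =>
    regular_map (hw w)
  have hr' : ∀ x, ((absMeasure n).map fun y => p y x).Regular := fun x => regular_map (hpx' x)
  have hU : ∀ K : Set (S × S), IsCompact K →
      UnifAC K fun w => (absMeasure n).map fun y => p (p w.1 y) w.2 := by
    intro K hK ε hε
    obtain ⟨s, -, δ, hδ, hs⟩ := BorelCont.exists_finset h' (hK.image continuous_snd) hε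
    obtain ⟨hfin, hreg⟩ := regular_finsetSum s fun x => (absMeasure n).map fun y => p y x
    set l := ∑ x ∈ s, (absMeasure n).map fun y => p y x with hl
    have hlT : TransCont p l := by
      refine TransCont.finsetSum hp s fun x _ => ?_
      rw [transCont_iff hp]
      intro A hA
      have e : ∀ z, ((absMeasure n).map fun y => p y x) (p z ⁻¹' A) =
          absMeasure n (p z ⁻¹' ((fun y => p y x) ⁻¹' A)) := fun z => by
        rw [Measure.map_apply (hpx' x).measurable ((hpx z).measurable hA)]
        congr 1
        ext y
        simp [hassoc]
      simp_rw [e]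
      exact (transCont_iff hp).1 h _ ((hpx' x).measurable hA)
    -- The tolerance `min δ 1 / 2` is nonzero and strictly below `δ`, even if `δ = ⊤`.
    obtain ⟨t, -, δ₂, hδ₂, ht⟩ := BorelCont.exists_finset hlT (hK.image continuous_fst)
      (ε := min δ 1 / 2) (by simp [hδ])
    have hlr : ∀ z, (l.map (p z)).Regular := fun z => regular_map (hpx z)
    obtain ⟨h1, h2⟩ := regular_finsetSum t fun z => l.map (p z)
    refine ⟨_, h1, h2, δ₂, hδ₂, fun A hA hlt w hwK => ?_⟩
    rw [Measure.finsetSum_apply] at hlt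
    have h3 := ht A hA hlt w.1 (mem_image_of_mem _ hwK)
    rw [Measure.map_apply (hpx _).measurable hA] at h3
    have h4 : min δ 1 / 2 < δ :=
      (ENNReal.half_lt_self (by simp [hδ]) (by simp)).trans_le (min_le_left _ _)
    have h5 := h3.trans_lt h4
    rw [hl, Measure.finsetSum_apply] at h5
    have h6 := hs _ ((hpx w.1).measurable hA) h5 w.2 (mem_image_of_mem _ hwK)
    rw [Measure.map_apply (hpx' _).measurable ((hpx _).measurable hA)] at h6
    rw [Measure.map_apply (hw w).measurable hA]
    convert h6 using 2
    ext y
    simp [hassoc]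
  have e : ∀ w : S × S, absMeasure n ((fun y => p (p w.1 y) w.2) ⁻¹' B) =
      (absMeasure n).map (fun y => p (p w.1 y) w.2) B := fun w =>
    (Measure.map_apply (hw w).measurable hB).symm
  simp_rw [e]
  refine continuous_measure_of_continuous_evalSet hB ?_
  refine continuous_functional_family hU (C := (absMeasure n).real univ) (fun w => ?_)
    (fun w => ?_) (fun g hg hg' => ?_) _
  · rw [measureReal_def, measureReal_def, Measure.map_apply (hw w).measurable MeasurableSet.univ,
      preimage_univ]
  · rw [absMeasure_ofFiniteMeasure]
  · obtain ⟨C, hC⟩ := hg'.exists_bound_of_continuous hg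
    simp_rw [cint_ofFiniteMeasure_map (hw _) hg hC]
    refine continuous_cint (H := fun (w : S × S) y => g (p (p w.1 y) w.2)) _ (hg.comp ?_)
      fun x y => hC _
    exact hp.comp ((hp.comp (continuous_fst.fst.prodMk continuous_snd)).prodMk continuous_fst.snd)

include hp hassoc in
-- Translating on the side opposite to `m` produces the two-sided translates of `n` by `(z, x)`, so
-- their joint continuity is what is needed under the integral over `z`.
theorem TransCont.conv_flip [Nonempty S] {m n k : boundedRadon S} (hn : IsPos n) (hk : IsPos k)
    (h : TransCont p (absMeasure n)) (h' : TransCont (fun x y => p y x) (absMeasure n))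
    (hconv : ∀ g : S → ℂ, Continuous g → HasCompactSupport g →
      cint k g = cint m fun z => cint n fun y => g (p z y)) :
    TransCont (fun x y => p y x) (absMeasure k) := by
  have hp' : Continuous (Function.uncurry fun x y => p y x) := hp.comp continuous_swap
  have hpx' : ∀ x, Continuous fun y => p y x := fun x => hp.comp (Continuous.prodMk_left x)
  rw [transCont_iff hp']
  intro B hB
  have e : ∀ x, (((absMeasure k).real ((fun y => p y x) ⁻¹' B) : ℝ) : ℂ) =
      cint m fun z => (((absMeasure n).real ((fun y => p (p z y) x) ⁻¹' B) : ℝ) : ℂ) := fun x =>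
    TransCont.conv_apply hp hn hk h hconv ((hpx' x).measurable hB)
  obtain ⟨G, hG⟩ : ∃ G : S → S → ℝ, ∀ z x, G z x =
    (absMeasure n).real ((fun y => p (p z y) x) ⁻¹' B) := ⟨_, fun _ _ => rfl⟩
  simp_rw [← hG] at e
  have hc : Continuous fun w : S × S => G w.1 w.2 := by
    simp_rw [hG]
    exact ENNReal.continuousOn_toReal.comp_continuous
      (TransCont.continuous_two_sided hp hassoc h h' hB) fun x => measure_ne_top _ _
  have hc' : Continuous (Function.uncurry fun x z : S => (G z x : ℂ)) :=
    Complex.continuous_ofReal.comp (hc.comp (continuous_snd.prodMk continuous_fst))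
  have hG' : ∀ z x, ‖(G z x : ℂ)‖ ≤ (absMeasure n).real univ := fun z x => by
    rw [Complex.norm_real, Real.norm_eq_abs, hG, abs_of_nonneg measureReal_nonneg]
    exact measureReal_mono (subset_univ _)
  have h1 : Continuous fun x => (((absMeasure k).real ((fun y => p y x) ⁻¹' B) : ℝ) : ℂ) := by
    simp_rw [e]
    exact continuous_cint m hc' fun x z => hG' z x
  have h2 := ENNReal.continuous_ofReal.comp (Complex.continuous_re.comp h1)
  simpa [Function.comp_def] using h2

end Associative

end TransCont

section WeightedImage

variable {S : Type*} [TopologicalSpace S] [T2Space S] [MeasurableSpace S] [BorelSpace S]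

/-- The image under `f` of the measure `θ • a`. -/
theorem exists_weighted_image (a : boundedRadon S) {f : S → S} (hf : Continuous f) {θ : S → ℂ}
    (hθ : Continuous θ) (hθ1 : ∀ y, ‖θ y‖ ≤ 1) :
    ∃ κ : boundedRadon S, absMeasure κ ≤ (absMeasure a).map f ∧
      ∀ g : S → ℂ, Continuous g → ∀ C, (∀ x, ‖g x‖ ≤ C) →
        cint κ g = cint a fun y => g (f y) * θ y := by
  obtain ⟨h, hh, e⟩ := exists_eq_dens (κ := a) (m := absMeasure a) Measure.AbsolutelyContinuous.rfl
  have hb : Integrable (fun y => θ y * h y) (absMeasure a) :=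
    hh.bdd_mul hθ.aestronglyMeasurable (Filter.Eventually.of_forall hθ1)
  set b := dens (absMeasure a) _ hb with hbdef
  have hle : absMeasure b ≤ absMeasure a := by
    have e2 := congrArg absMeasure e
    rw [absMeasure_dens] at e2
    rw [hbdef, absMeasure_dens]
    conv_rhs => rw [e2]
    refine withDensity_mono (Filter.Eventually.of_forall fun y => ?_)
    simp only [enorm_mul]
    refine mul_le_of_le_one_left' ?_
    rw [← ofReal_norm]
    exact ENNReal.ofReal_le_one.2 (hθ1 y)
  have hmap : ((b : ComplexMeasure S).map f).variation ≤ (absMeasure a).map f :=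
    VectorMeasure.variation_map_le.trans (Measure.map_mono hle hf.measurable)
  have hr : ((absMeasure a).map f).Regular := regular_map hf
  refine ⟨⟨(b : ComplexMeasure S).map f, isFiniteMeasure_of_le _ hmap,
    regular_of_le_of_regular hr hmap⟩, hmap, fun g hg C hC => ?_⟩
  have hi : Integrable (fun y => g (f y)) (absMeasure b) :=
    integrable_of_norm_le (hg.comp hf).measurable fun y => hC _
  have hi2 : Integrable (fun y => g (f y) * θ y) (absMeasure a) :=
    integrable_of_norm_le ((hg.comp hf).mul hθ).measurable (C := C * 1) fun y => by
      rw [norm_mul]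
      exact mul_le_mul (hC _) (hθ1 y) (norm_nonneg _) ((norm_nonneg _).trans (hC (f y)))
  have e3 : cint a (fun y => g (f y) * θ y) =
      cint (dens (absMeasure a) h hh) fun y => g (f y) * θ y := by rw [← e]
  rw [e3, cint_dens hh (by rw [← e]; exact hi2)]
  have e4 : cint b (fun y => g (f y)) = ∫ x, g (f x) * (θ x * h x) ∂(absMeasure a) :=
    cint_dens hb hi
  simp_rw [← mul_assoc] at e4
  rw [← e4]
  exact VectorMeasure.integral_map hf.measurable hg.aestronglyMeasurable hi

end WeightedImage

/-! ### M_a(S) described by values on Borel sets -/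

section AbsCont

theorem continuous_toWeakSpace_iff {E X : Type*} [NormedAddCommGroup E] [NormedSpace ℂ E]
    [TopologicalSpace X] {f : X → E} :
    (Continuous fun x => toWeakSpace ℂ E (f x)) ↔
      ∀ F : StrongDual ℂ E, Continuous fun x => F (f x) := by
  refine ⟨fun h F => ?_, fun h => WeakBilin.continuous_of_continuous_eval _ h⟩
  exact (WeakBilin.eval_continuous (topDualPairing ℂ E).flip F).comp h

variable {S : Type*} [TopologicalSpace S] [T2Space S] [MeasurableSpace S] [BorelSpace S]
  [LocallyCompactSpace S]

/-- One direction holds because evaluation on a Borel set is a bounded functional. The converse is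
the uniform absolute continuity argument. -/
theorem transCont_iff_continuous_toWeakSpace {p : S → S → S} (hp : Continuous (Function.uncurry p))
    (hpx : ∀ x, Continuous (p x)) (μ : boundedRadon S) :
    (Continuous fun x => toWeakSpace ℂ (boundedRadon S) (mapAbs μ ⟨p x, hpx x⟩)) ↔
      TransCont p (absMeasure μ) := by
  have hr : ∀ x, ((absMeasure μ).map (p x)).Regular := fun x => regular_map (hpx x)
  have e : ∀ x, mapAbs μ ⟨p x, hpx x⟩ = ofFiniteMeasure ((absMeasure μ).map (p x)) := fun _ => rfl
  rw [continuous_toWeakSpace_iff]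
  simp_rw [e]
  refine ⟨fun h B hB => continuous_measure_of_continuous_evalSet hB (h _), fun h F => ?_⟩
  refine h.continuous_functional hp (fun x => by rw [absMeasure_ofFiniteMeasure]) ?_ F
  intro g hg hg'
  obtain ⟨C, hC⟩ := hg'.exists_bound_of_continuous hg
  simp_rw [cint_ofFiniteMeasure_map (hpx _) hg hC]
  exact continuous_cint (H := fun x y => g (p x y)) _ (hg.comp hp) fun x y => hC _

theorem mem_absContMeasures_iff [Monoid S] [ContinuousMul S] {μ : boundedRadon S} :
    μ ∈ absContMeasures S ↔ TransCont (fun x y => x * y) (absMeasure μ) ∧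
      TransCont (fun x y => y * x) (absMeasure μ) :=
  and_congr (transCont_iff_continuous_toWeakSpace continuous_mul _ μ)
    (transCont_iff_continuous_toWeakSpace (p := fun x y => y * x)
      (continuous_snd.mul continuous_fst) _ μ)

end AbsCont

/-! ### The norm of M(S) by test functions -/

section Duality

variable {S : Type*} [TopologicalSpace S] [T2Space S] [MeasurableSpace S] [BorelSpace S]
  [LocallyCompactSpace S]

/-- A norming functional from Hahn-Banach is integration against a function bounded by `1`, which is
approximated in `L¹(|κ|)` by test functions with the same bound. -/
theorem boundedRadon.norm_le_of_forall_norm_cint_le {κ : boundedRadon S} {C : ℝ}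
    (h : ∀ g : S → ℂ, Continuous g → HasCompactSupport g → (∀ x, ‖g x‖ ≤ 1) → ‖cint κ g‖ ≤ C) :
    ‖κ‖ ≤ C := by
  obtain ⟨F, hF1, hF⟩ := exists_dual_vector'' ℂ κ
  obtain ⟨φ, hφ, hb, hFφ⟩ := exists_functional_eq_cint (absMeasure κ) F
  have hb1 : ∀ x, ‖φ x‖ ≤ 1 := fun x => (hb x).trans hF1
  refine le_of_forall_pos_le_add fun ε hε => ?_
  obtain ⟨g, hg, hg', hg1, hle⟩ := exists_hasCompactSupport_norm_le_integral_norm_sub_le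
    (m := absMeasure κ) hφ one_pos hb1 hε
  have e : cint κ φ = (‖κ‖ : ℂ) := by
    rw [← hFφ κ Measure.AbsolutelyContinuous.rfl, hF]
    rfl
  have h1 : ‖cint κ φ - cint κ g‖ ≤ ε :=
    (norm_cint_sub_le (integrable_of_norm_le hφ hb1)
      (integrable_of_norm_le hg.measurable hg1)).trans hle
  have h2 : ‖cint κ φ‖ = ‖κ‖ := by rw [e]; simp
  rw [← h2]
  have h3 := norm_sub_norm_le (cint κ φ) (cint κ g)
  have h4 := h g hg hg' hg1
  linarith

end Duality

/-- A continuous kernel `(p, θ)`: the corresponding convolution of `μ` and `ν` is the image of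
`θ • (μ ⊗ ν)` under `p`. -/
structure ConvKernel (S : Type*) [TopologicalSpace S] where
  p : S → S → S
  θ : S → S → ℝ
  continuous_p : Continuous (Function.uncurry p)
  continuous_θ : Continuous (Function.uncurry θ)
  θ_nonneg : ∀ x y, 0 ≤ θ x y
  θ_le_one : ∀ x y, θ x y ≤ 1

/-! ### Convolution with respect to a kernel -/

namespace ConvKernel

section Basic

variable {S : Type*} [TopologicalSpace S] (K : ConvKernel S)

theorem continuous_kernel {g : S → ℂ} (hg : Continuous g) :
    Continuous (Function.uncurry fun x y => g (K.p x y) * (K.θ x y : ℂ)) :=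
  (hg.comp K.continuous_p).mul (Complex.continuous_ofReal.comp K.continuous_θ)

theorem norm_θ_le (x y : S) : ‖(K.θ x y : ℂ)‖ ≤ 1 := by
  rw [Complex.norm_real, Real.norm_eq_abs, abs_of_nonneg (K.θ_nonneg x y)]
  exact K.θ_le_one x y

theorem norm_kernel_le {g : S → ℂ} {C : ℝ} (hC : ∀ x, ‖g x‖ ≤ C) (x y : S) :
    ‖g (K.p x y) * (K.θ x y : ℂ)‖ ≤ C := by
  rw [norm_mul]
  exact (mul_le_of_le_one_right (norm_nonneg _) (K.norm_θ_le x y)).trans (hC _)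

variable [T2Space S] [MeasurableSpace S] [BorelSpace S]

/-- The integral `∬ g (p x y) θ(x, y) dμ(x) dν(y)`. -/
noncomputable def bil (μ ν : boundedRadon S) (g : S → ℂ) : ℂ :=
  cint μ fun x => cint ν fun y => g (K.p x y) * (K.θ x y : ℂ)

variable {K} {μ μ' ν ν' : boundedRadon S} {g g' : S → ℂ} {C C' : ℝ}

theorem integrable_inner (m : boundedRadon S) (hg : Continuous g) (hC : ∀ x, ‖g x‖ ≤ C) (x : S) :
    Integrable (fun y => g (K.p x y) * (K.θ x y : ℂ)) (absMeasure m) :=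
  integrable_of_norm_le ((K.continuous_kernel hg).comp (Continuous.prodMk_right x)).measurable
    fun y => K.norm_kernel_le hC x y

theorem integrable_outer (m n : boundedRadon S) (hg : Continuous g) (hC : ∀ x, ‖g x‖ ≤ C) :
    Integrable (fun x => cint n fun y => g (K.p x y) * (K.θ x y : ℂ)) (absMeasure m) :=
  integrable_cint (K.continuous_kernel hg) fun x y => K.norm_kernel_le hC x y

theorem bil_add (hg : Continuous g) (hC : ∀ x, ‖g x‖ ≤ C) (hg' : Continuous g')
    (hC' : ∀ x, ‖g' x‖ ≤ C') :
    K.bil μ ν (fun x => g x + g' x) = K.bil μ ν g + K.bil μ ν g' := by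
  rw [bil, bil, bil, ← cint_add (integrable_outer μ ν hg hC) (integrable_outer μ ν hg' hC')]
  congr 1
  ext x
  rw [← cint_add (integrable_inner ν hg hC x) (integrable_inner ν hg' hC' x)]
  simp_rw [add_mul]

theorem bil_const_mul (c : ℂ) (hg : Continuous g) (hC : ∀ x, ‖g x‖ ≤ C) :
    K.bil μ ν (fun x => c * g x) = c * K.bil μ ν g := by
  rw [bil, bil, ← cint_const_mul c (integrable_outer μ ν hg hC)]
  congr 1
  ext x
  rw [← cint_const_mul c (integrable_inner ν hg hC x)]
  simp_rw [mul_assoc]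

theorem norm_bil_le (hC : ∀ x, ‖g x‖ ≤ C) : ‖K.bil μ ν g‖ ≤ C * ‖ν‖ * ‖μ‖ :=
  norm_cint_le_of_norm_le fun x => norm_cint_le_of_norm_le (K.norm_kernel_le hC x)

theorem bil_add_left (hg : Continuous g) (hC : ∀ x, ‖g x‖ ≤ C) :
    K.bil (μ + μ') ν g = K.bil μ ν g + K.bil μ' ν g :=
  cint_add_measure (integrable_outer μ ν hg hC) (integrable_outer μ' ν hg hC)

theorem bil_smul_left (c : ℂ) (hg : Continuous g) (hC : ∀ x, ‖g x‖ ≤ C) :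
    K.bil (c • μ) ν g = c * K.bil μ ν g :=
  cint_smul_measure c (integrable_outer μ ν hg hC)

theorem bil_add_right (hg : Continuous g) (hC : ∀ x, ‖g x‖ ≤ C) :
    K.bil μ (ν + ν') g = K.bil μ ν g + K.bil μ ν' g := by
  rw [bil, bil, bil, ← cint_add (integrable_outer μ ν hg hC) (integrable_outer μ ν' hg hC)]
  congr 1
  ext x
  exact cint_add_measure (integrable_inner ν hg hC x) (integrable_inner ν' hg hC x)

theorem bil_smul_right (c : ℂ) (hg : Continuous g) (hC : ∀ x, ‖g x‖ ≤ C) :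
    K.bil μ (c • ν) g = c * K.bil μ ν g := by
  rw [bil, bil, ← cint_const_mul c (integrable_outer μ ν hg hC)]
  congr 1
  ext x
  exact cint_smul_measure c (integrable_inner ν hg hC x)

/-- The integral `bil` of a real function against positive measures. -/
theorem bil_ofReal (hμ : IsPos μ) (hν : IsPos ν) {f : S → ℝ} (hf : Continuous f) {C : ℝ}
    (hC : ∀ x, |f x| ≤ C) :
    K.bil μ ν (fun x => (f x : ℂ)) =
      ((∫ x, ∫ y, f (K.p x y) * K.θ x y ∂(absMeasure ν) ∂(absMeasure μ) : ℝ) : ℂ) := by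
  have hfc : Continuous fun x => (f x : ℂ) := Complex.continuous_ofReal.comp hf
  have hC' : ∀ x, ‖(f x : ℂ)‖ ≤ C := fun x => by
    rw [Complex.norm_real]
    exact hC x
  have e : ∀ x, (cint ν fun y => (f (K.p x y) : ℂ) * (K.θ x y : ℂ)) =
      ((∫ y, f (K.p x y) * K.θ x y ∂(absMeasure ν) : ℝ) : ℂ) := fun x => by
    rw [hν.cint_eq (integrable_inner ν hfc hC' x), ← integral_complex_ofReal]
    simp
  have hi := integrable_outer (K := K) μ ν hfc hC'
  rw [bil, hμ.cint_eq hi]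
  simp_rw [e]
  rw [integral_complex_ofReal]

end Basic

section Existence

variable {S : Type*} [TopologicalSpace S] [T2Space S] [MeasurableSpace S] [BorelSpace S]
  [LocallyCompactSpace S] (K : ConvKernel S)

/-- `κ` is the convolution of `μ` and `ν` with respect to the kernel `K`. -/
def IsConv (μ ν κ : boundedRadon S) : Prop :=
  ∀ g : S → ℂ, Continuous g → ∀ C, (∀ x, ‖g x‖ ≤ C) → cint κ g = K.bil μ ν g

variable {K} {μ μ' ν ν' κ κ' : boundedRadon S}

/-- Tightness of `κ`, `μ` and `ν` makes `g (1 - u)` negligible on both sides for a suitable cutoff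
`u`. The extension to bounded functions is needed for associativity, where the partial integrals
need not have compact support. -/
theorem isConv_of_hasCompactSupport
    (h : ∀ g : S → ℂ, Continuous g → HasCompactSupport g → cint κ g = K.bil μ ν g) :
    K.IsConv μ ν κ := by
  intro g hg C hC
  rcases isEmpty_or_nonempty S with hS | ⟨⟨s⟩⟩
  · exact h g hg (HasCompactSupport.of_compactSpace g)
  have hC0 : 0 ≤ C := (norm_nonneg _).trans (hC s)
  refine eq_of_forall_dist_le fun ε hε => ?_
  set M := C * (1 + ‖μ‖ + ‖ν‖) + 1 with hM
  have hM0 : 0 < M := by positivity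
  have hδ : 0 < ε / M := div_pos hε hM0
  obtain ⟨Q, hQ, hQlt⟩ := exists_isCompact_real_compl_lt (absMeasure κ) hδ
  obtain ⟨Q₁, hQ₁, hQ₁lt⟩ := exists_isCompact_real_compl_lt (absMeasure μ) hδ
  obtain ⟨Q₂, hQ₂, hQ₂lt⟩ := exists_isCompact_real_compl_lt (absMeasure ν) hδ
  set δ := ε / M with hδdef
  -- The cutoff equals `1` both on the compact set carrying most of `κ` and on the image of the one
  -- carrying most of `μ ⊗ ν`.
  obtain ⟨u, hu, hu', hu1, hule, hule'⟩ :=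
    exists_cutoff (hQ.union ((hQ₁.prod hQ₂).image K.continuous_p))
  have huC : ∀ x, ‖g x * u x‖ ≤ C := fun x => by
    rw [norm_mul]
    exact (mul_le_of_le_one_right (norm_nonneg _) (hule x)).trans (hC x)
  have hvC : ∀ x, ‖g x * (1 - u x)‖ ≤ C := fun x => by
    rw [norm_mul]
    exact (mul_le_of_le_one_right (norm_nonneg _) (hule' x)).trans (hC x)
  have hgu : Continuous fun x => g x * u x := hg.mul hu
  have hgv : Continuous fun x => g x * (1 - u x) := hg.mul (continuous_const.sub hu)
  have e0 : g = fun x => g x * u x + g x * (1 - u x) := by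
    ext x
    ring
  have e1 : cint κ g = cint κ (fun x => g x * u x) + cint κ fun x => g x * (1 - u x) := by
    rw [← cint_add (integrable_of_norm_le hgu.measurable huC)
      (integrable_of_norm_le hgv.measurable hvC), ← e0]
  have e2 : K.bil μ ν g =
      K.bil μ ν (fun x => g x * u x) + K.bil μ ν fun x => g x * (1 - u x) := by
    rw [← bil_add hgu huC hgv hvC, ← e0]
  have e3 := h _ hgu hu'.mul_left
  have b1 : ‖cint κ fun x => g x * (1 - u x)‖ ≤ C * δ := by
    have := norm_cint_le_of_norm_le_add κ (f := fun x => g x * (1 - u x)) hQ.measurableSet le_rfl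
      (fun x hx => by rw [hu1 x (Or.inl hx)]; simp) hvC
    rw [zero_mul, zero_add] at this
    exact this.trans (by gcongr)
  have b2 : ‖K.bil μ ν fun x => g x * (1 - u x)‖ ≤ C * δ * ‖μ‖ + C * ‖ν‖ * δ := by
    have := norm_cint_le_of_norm_le_add μ (Q := Q₁) (δ := C * δ) (C := C * ‖ν‖)
      (f := fun x => cint ν fun y => (g (K.p x y) * (1 - u (K.p x y))) * (K.θ x y : ℂ))
      hQ₁.measurableSet (by positivity) (fun x hx => ?_) fun x =>
        norm_cint_le_of_norm_le fun y => K.norm_kernel_le hvC x y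
    · exact this.trans (by gcongr)
    · have := norm_cint_le_of_norm_le_add ν (Q := Q₂) (δ := 0) (C := C)
        (f := fun y => (g (K.p x y) * (1 - u (K.p x y))) * (K.θ x y : ℂ))
        hQ₂.measurableSet le_rfl (fun y hy => ?_) fun y => K.norm_kernel_le hvC x y
      · rw [zero_mul, zero_add] at this
        exact this.trans (by gcongr)
      · rw [show u (K.p x y) = 1 from hu1 _ (Or.inr ⟨(x, y), ⟨hx, hy⟩, rfl⟩)]
        simp
  rw [e1, e2, e3, dist_eq_norm, add_sub_add_left_eq_sub]
  refine (norm_sub_le _ _).trans ((add_le_add b1 b2).trans ?_)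
  have : C * δ + (C * δ * ‖μ‖ + C * ‖ν‖ * δ) = (M - 1) * δ := by
    rw [hM]
    ring
  rw [this]
  calc (M - 1) * δ ≤ M * δ := by gcongr; linarith
    _ = ε := by rw [hδdef]; field_simp

/-- The double integral is a positive functional on real test functions, so the Riesz-Markov theorem
provides the measure. -/
theorem exists_isConv_of_isPos (hμ : IsPos μ) (hν : IsPos ν) : ∃ κ, IsPos κ ∧ K.IsConv μ ν κ := by
  have hb : ∀ g : CompactlySupportedContinuousMap S ℝ, ∃ C, ∀ x, ‖((g x : ℝ) : ℂ)‖ ≤ C := by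
    intro g
    obtain ⟨C, hC⟩ := g.hasCompactSupport.exists_bound_of_continuous g.continuous
    exact ⟨C, fun x => by rw [Complex.norm_real]; exact hC x⟩
  have hc : ∀ g : CompactlySupportedContinuousMap S ℝ, Continuous fun x => ((g x : ℝ) : ℂ) :=
    fun g => Complex.continuous_ofReal.comp g.continuous
  have hreal : ∀ g : CompactlySupportedContinuousMap S ℝ, K.bil μ ν (fun x => (g x : ℂ)) =
      ((∫ x, ∫ y, g (K.p x y) * K.θ x y ∂(absMeasure ν) ∂(absMeasure μ) : ℝ) : ℂ) := fun g => by
    obtain ⟨C, hC⟩ := g.hasCompactSupport.exists_bound_of_continuous g.continuous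
    exact bil_ofReal hμ hν g.continuous hC
  let Λ₀ : CompactlySupportedContinuousMap S ℝ →ₗ[ℝ] ℝ :=
    { toFun := fun g => (K.bil μ ν fun x => (g x : ℂ)).re
      map_add' := fun g g' => by
        obtain ⟨C, hC⟩ := hb g
        obtain ⟨C', hC'⟩ := hb g'
        rw [← Complex.add_re, ← bil_add (hc g) hC (hc g') hC']
        simp
      map_smul' := fun c g => by
        obtain ⟨C, hC⟩ := hb g
        have := bil_const_mul (K := K) (μ := μ) (ν := ν) (c : ℂ) (hc g) hC
        simp only [CompactlySupportedContinuousMap.coe_smul, Pi.smul_apply, smul_eq_mul,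
          Complex.ofReal_mul, RingHom.id_apply]
        rw [this, Complex.re_ofReal_mul] }
  have hΛ₀ : ∀ g, 0 ≤ g → 0 ≤ Λ₀ g := fun g hg => by
    change 0 ≤ (K.bil μ ν fun x => (g x : ℂ)).re
    rw [hreal, Complex.ofReal_re]
    exact integral_nonneg fun x => integral_nonneg fun y => mul_nonneg (hg _) (K.θ_nonneg _ _)
  let Λ := PositiveLinearMap.mk₀ Λ₀ hΛ₀
  have hΛ : ∀ g : CompactlySupportedContinuousMap S ℝ,
      K.bil μ ν (fun x => (g x : ℂ)) = ((Λ g : ℝ) : ℂ) := fun g => by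
    change _ = (((K.bil μ ν fun x => (g x : ℂ)).re : ℝ) : ℂ)
    rw [hreal, Complex.ofReal_re]
  set m := RealRMK.rieszMeasure Λ with hm
  have hmr : m.Regular := inferInstance
  -- Compact sets have mass at most `‖ν‖ ‖μ‖`; inner regularity on the open set `univ` then gives
  -- finiteness.
  have hmK : ∀ Q : Set S, IsCompact Q → m Q ≤ ENNReal.ofReal (1 * ‖ν‖ * ‖μ‖) := fun Q hQ => by
    obtain ⟨u, hu1, hu2, -, hu4⟩ :=
      exists_continuousMap_one_of_isCompact_subset_isOpen hQ isOpen_univ (subset_univ _)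
    refine (RealRMK.rieszMeasure_le_of_eq_one Λ (f := ⟨u, hu2⟩) (fun x => (hu4 x).1) hQ
      fun x hx => hu1 hx).trans (ENNReal.ofReal_le_ofReal ?_)
    refine (Complex.re_le_norm _).trans (norm_bil_le fun x => ?_)
    rw [Complex.norm_real, Real.norm_eq_abs]
    exact abs_le.2 ⟨(neg_nonpos.2 zero_le_one).trans (hu4 x).1, (hu4 x).2⟩
  have hfin : IsFiniteMeasure m := by
    refine ⟨?_⟩
    rw [isOpen_univ.measure_eq_iSup_isCompact]
    exact (iSup₂_le fun Q _ => iSup_le fun hQ => hmK Q hQ).trans_lt ENNReal.ofReal_lt_top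
  refine ⟨ofFiniteMeasure m, isPos_ofFiniteMeasure m, isConv_of_hasCompactSupport ?_⟩
  have hR : ∀ g : CompactlySupportedContinuousMap S ℝ,
      cint (ofFiniteMeasure m) (fun x => (g x : ℂ)) = K.bil μ ν fun x => (g x : ℂ) := fun g => by
    obtain ⟨C, hC⟩ := hb g
    rw [cint_ofFiniteMeasure (integrable_of_norm_le (hc g).measurable hC), integral_complex_ofReal,
      RealRMK.integral_rieszMeasure, hΛ]
  intro g hg hg'
  let gr : CompactlySupportedContinuousMap S ℝ :=
    ⟨⟨fun x => (g x).re, Complex.continuous_re.comp hg⟩, hg'.comp_left (g := Complex.re) rfl⟩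
  let gi : CompactlySupportedContinuousMap S ℝ :=
    ⟨⟨fun x => (g x).im, Complex.continuous_im.comp hg⟩, hg'.comp_left (g := Complex.im) rfl⟩
  obtain ⟨C, hC⟩ := hb gr
  obtain ⟨C', hC'⟩ := hb gi
  have hiC : ∀ x, ‖Complex.I * (gi x : ℂ)‖ ≤ C' := fun x => by
    rw [norm_mul, Complex.norm_I, one_mul]
    exact hC' x
  have e : g = fun x => (gr x : ℂ) + Complex.I * (gi x : ℂ) := by
    ext x
    rw [mul_comm]
    exact (Complex.re_add_im (g x)).symm
  have hi : Continuous fun x => Complex.I * (gi x : ℂ) := continuous_const.mul (hc gi)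
  rw [e, cint_add (integrable_of_norm_le (hc gr).measurable hC)
    (integrable_of_norm_le hi.measurable hiC), bil_add (hc gr) hC hi hiC,
    bil_const_mul _ (hc gi) hC',
    cint_const_mul _ (integrable_of_norm_le (hc gi).measurable hC'), hR, hR]

omit [LocallyCompactSpace S] in
theorem IsConv.add_left (h : K.IsConv μ ν κ) (h' : K.IsConv μ' ν κ') :
    K.IsConv (μ + μ') ν (κ + κ') := fun g hg C hC => by
  rw [bil_add_left hg hC, ← h g hg C hC, ← h' g hg C hC]
  exact cint_add_measure (integrable_of_norm_le hg.measurable hC)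
    (integrable_of_norm_le hg.measurable hC)

omit [LocallyCompactSpace S] in
theorem IsConv.add_right (h : K.IsConv μ ν κ) (h' : K.IsConv μ ν' κ') :
    K.IsConv μ (ν + ν') (κ + κ') := fun g hg C hC => by
  rw [bil_add_right hg hC, ← h g hg C hC, ← h' g hg C hC]
  exact cint_add_measure (integrable_of_norm_le hg.measurable hC)
    (integrable_of_norm_le hg.measurable hC)

omit [LocallyCompactSpace S] in
theorem IsConv.smul_left (c : ℂ) (h : K.IsConv μ ν κ) : K.IsConv (c • μ) ν (c • κ) :=
  fun g hg C hC => by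
    rw [bil_smul_left c hg hC, ← h g hg C hC]
    exact cint_smul_measure c (integrable_of_norm_le hg.measurable hC)

omit [LocallyCompactSpace S] in
theorem IsConv.smul_right (c : ℂ) (h : K.IsConv μ ν κ) : K.IsConv μ (c • ν) (c • κ) :=
  fun g hg C hC => by
    rw [bil_smul_right c hg hC, ← h g hg C hC]
    exact cint_smul_measure c (integrable_of_norm_le hg.measurable hC)

theorem IsConv.unique (h : K.IsConv μ ν κ) (h' : K.IsConv μ ν κ') : κ = κ' := by
  refine boundedRadon.ext_of_cint fun g hg hg' => ?_
  obtain ⟨C, hC⟩ := hg'.exists_bound_of_continuous hg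
  rw [h g hg C hC, h' g hg C hC]

theorem IsConv.norm_le (h : K.IsConv μ ν κ) : ‖κ‖ ≤ ‖μ‖ * ‖ν‖ := by
  refine boundedRadon.norm_le_of_forall_norm_cint_le fun g hg _ hg1 => ?_
  rw [h g hg 1 hg1]
  refine (norm_bil_le hg1).trans_eq ?_
  ring

theorem exists_isConv (μ ν : boundedRadon S) : ∃ κ, K.IsConv μ ν κ := by
  induction μ using boundedRadon.isPos_induction with
  | hpos a ha =>
    induction ν using boundedRadon.isPos_induction with
    | hpos b hb => exact (exists_isConv_of_isPos ha hb).imp fun _ h => h.2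
    | hadd b b' hb hb' =>
      obtain ⟨k, hk⟩ := hb
      obtain ⟨k', hk'⟩ := hb'
      exact ⟨_, hk.add_right hk'⟩
    | hsmul c b hb =>
      obtain ⟨k, hk⟩ := hb
      exact ⟨_, hk.smul_right c⟩
  | hadd a a' ha ha' =>
    obtain ⟨k, hk⟩ := ha
    obtain ⟨k', hk'⟩ := ha'
    exact ⟨_, hk.add_left hk'⟩
  | hsmul c a ha =>
    obtain ⟨k, hk⟩ := ha
    exact ⟨_, hk.smul_left c⟩

variable (K) in
/-- The convolution with respect to the kernel `K`. -/
noncomputable def conv (μ ν : boundedRadon S) : boundedRadon S := (K.exists_isConv μ ν).choose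

variable (K) in
theorem isConv_conv (μ ν : boundedRadon S) : K.IsConv μ ν (K.conv μ ν) :=
  (K.exists_isConv μ ν).choose_spec

theorem IsConv.eq_conv (h : K.IsConv μ ν κ) : κ = K.conv μ ν := h.unique (K.isConv_conv μ ν)

theorem isPos_conv (hμ : IsPos μ) (hν : IsPos ν) : IsPos (K.conv μ ν) := by
  obtain ⟨κ, hκ, h⟩ := exists_isConv_of_isPos (K := K) hμ hν
  rwa [← h.eq_conv]

theorem add_conv : K.conv (μ + μ') ν = K.conv μ ν + K.conv μ' ν :=
  ((K.isConv_conv μ ν).add_left (K.isConv_conv μ' ν)).eq_conv.symm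

theorem conv_add : K.conv μ (ν + ν') = K.conv μ ν + K.conv μ ν' :=
  ((K.isConv_conv μ ν).add_right (K.isConv_conv μ ν')).eq_conv.symm

theorem smul_conv (c : ℂ) : K.conv (c • μ) ν = c • K.conv μ ν :=
  ((K.isConv_conv μ ν).smul_left c).eq_conv.symm

theorem conv_smul (c : ℂ) : K.conv μ (c • ν) = c • K.conv μ ν :=
  ((K.isConv_conv μ ν).smul_right c).eq_conv.symm

theorem norm_conv_le : ‖K.conv μ ν‖ ≤ ‖μ‖ * ‖ν‖ := (K.isConv_conv μ ν).norm_le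

end Existence

end ConvKernel

/-! ### The subspace M_a -/

section TransSubmodule

variable {S : Type*} [TopologicalSpace S] [T2Space S] [MeasurableSpace S] [BorelSpace S]

theorem ofFiniteMeasure_add (m n : Measure S) [IsFiniteMeasure m] [m.Regular] [IsFiniteMeasure n]
    [n.Regular] [(m + n).Regular] :
    ofFiniteMeasure (m + n) = ofFiniteMeasure m + ofFiniteMeasure n := by
  refine Subtype.ext (VectorMeasure.ext fun B hB => ?_)
  rw [ofFiniteMeasure_apply hB]
  change _ = (ofFiniteMeasure m : ComplexMeasure S) B + (ofFiniteMeasure n : ComplexMeasure S) B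
  rw [ofFiniteMeasure_apply hB, ofFiniteMeasure_apply hB, measureReal_add_apply]
  push_cast
  rfl

theorem IsPos.absMeasure_add {μ ν : boundedRadon S} (hμ : IsPos μ) (hν : IsPos ν) :
    absMeasure (μ + ν) = absMeasure μ + absMeasure ν := by
  have : (absMeasure μ + absMeasure ν).InnerRegular := inferInstance
  have : (absMeasure μ + absMeasure ν).Regular := inferInstance
  have h : μ + ν = ofFiniteMeasure (absMeasure μ + absMeasure ν) := by
    rw [ofFiniteMeasure_add, ← hμ.eq, ← hν.eq]
  rw [h, absMeasure_ofFiniteMeasure]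

theorem continuous_uncurry_flip {S : Type*} [TopologicalSpace S] {p : S → S → S}
    (hp : Continuous (Function.uncurry p)) : Continuous (Function.uncurry fun x y => p y x) :=
  hp.comp continuous_swap

variable [LocallyCompactSpace S]

/-- The measures whose total variation has continuous translates on both sides, with respect to
the product `p`. -/
noncomputable def transSubmodule (p : S → S → S) (hp : Continuous (Function.uncurry p)) :
    Submodule ℂ (boundedRadon S) where
  carrier := {μ | TransCont p (absMeasure μ) ∧ TransCont (fun x y => p y x) (absMeasure μ)}
  zero_mem' := by
    have h : absMeasure (0 : boundedRadon S) = 0 := VectorMeasure.variation_zero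
    have hp' := continuous_uncurry_flip hp
    simp only [mem_ofPred_eq, h]
    constructor
    · rw [transCont_iff hp]
      intro B _
      simpa using continuous_const
    · rw [transCont_iff hp']
      intro B _
      simpa using continuous_const
  add_mem' := by
    rintro μ ν ⟨hμ, hμ'⟩ ⟨hν, hν'⟩
    have hp' := continuous_uncurry_flip hp
    have : (absMeasure μ + absMeasure ν).InnerRegular := inferInstance
    have : (absMeasure μ + absMeasure ν).Regular := inferInstance
    exact ⟨(hμ.add hp hν).mono hp (absMeasure_add_le μ ν),
      (hμ'.add hp' hν').mono hp' (absMeasure_add_le μ ν)⟩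
  smul_mem' := by
    rintro c μ ⟨hμ, hμ'⟩
    simp only [mem_ofPred_eq, absMeasure_smul]
    exact ⟨hμ.smul hp _, hμ'.smul (continuous_uncurry_flip hp) _⟩

variable {p : S → S → S} {hp : Continuous (Function.uncurry p)}

theorem mem_transSubmodule {μ : boundedRadon S} : μ ∈ transSubmodule p hp ↔
    TransCont p (absMeasure μ) ∧ TransCont (fun x y => p y x) (absMeasure μ) := Iff.rfl

theorem mem_transSubmodule_of_le {μ ν : boundedRadon S} (h : absMeasure μ ≤ absMeasure ν)
    (hν : ν ∈ transSubmodule p hp) : μ ∈ transSubmodule p hp :=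
  ⟨hν.1.mono hp h, hν.2.mono (continuous_uncurry_flip hp) h⟩

end TransSubmodule

/-! ### Ideal property, associativity and translates -/

namespace ConvKernel

variable {S : Type*} [TopologicalSpace S]

/-- The kernel of the opposite convolution. -/
def flip (K : ConvKernel S) : ConvKernel S where
  p x y := K.p y x
  θ x y := K.θ y x
  continuous_p := K.continuous_p.comp continuous_swap
  continuous_θ := K.continuous_θ.comp continuous_swap
  θ_nonneg x y := K.θ_nonneg y x
  θ_le_one x y := K.θ_le_one y x

/-- The kernel with weight `1`. -/
def unweighted (K : ConvKernel S) : ConvKernel S where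
  p := K.p
  θ _ _ := 1
  continuous_p := K.continuous_p
  continuous_θ := continuous_const
  θ_nonneg _ _ := zero_le_one
  θ_le_one _ _ := le_rfl

/-- The kernel with weight `1 - θ`. -/
def compl (K : ConvKernel S) : ConvKernel S where
  p := K.p
  θ x y := 1 - K.θ x y
  continuous_p := K.continuous_p
  continuous_θ := (continuous_sub_left (1 : ℝ)).comp K.continuous_θ
  θ_nonneg x y := sub_nonneg.2 (K.θ_le_one x y)
  θ_le_one x y := sub_le_self _ (K.θ_nonneg x y)

variable [T2Space S] [MeasurableSpace S] [BorelSpace S] [LocallyCompactSpace S] (K : ConvKernel S)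
  {μ ν ρ a b : boundedRadon S}

/-- Fubini's theorem. It transfers each one-sided statement to the other side. -/
theorem flip_conv : K.flip.conv μ ν = K.conv ν μ := by
  refine IsConv.unique (K := K.flip) (K.flip.isConv_conv μ ν) fun g hg C hC => ?_
  rw [K.isConv_conv ν μ g hg C hC]
  exact cint_cint_swap ν μ (K.continuous_kernel hg) (K.norm_kernel_le hC)

theorem conv_add_compl_conv : K.conv μ ν + K.compl.conv μ ν = K.unweighted.conv μ ν := by
  refine IsConv.unique (K := K.unweighted) (fun g hg C hC => ?_) (K.unweighted.isConv_conv μ ν)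
  rw [cint_add_measure (integrable_of_norm_le hg.measurable hC)
    (integrable_of_norm_le hg.measurable hC), K.isConv_conv μ ν g hg C hC,
    K.compl.isConv_conv μ ν g hg C hC, bil, bil, bil,
    ← cint_add (integrable_outer μ ν hg hC) (integrable_outer (K := K.compl) μ ν hg hC)]
  congr 1
  ext x
  rw [← cint_add (integrable_inner ν hg hC x) (integrable_inner (K := K.compl) ν hg hC x)]
  congr 1
  ext y
  simp only [compl, unweighted]
  push_cast
  ring

/-- The difference is the convolution with the kernel `1 - θ`, which is positive. The weight can
thus be ignored when continuity of translates is proved. -/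
theorem absMeasure_conv_le (hμ : IsPos μ) (hν : IsPos ν) :
    absMeasure (K.conv μ ν) ≤ absMeasure (K.unweighted.conv μ ν) := by
  rw [← K.conv_add_compl_conv, (isPos_conv hμ hν).absMeasure_add (isPos_conv hμ hν)]
  exact Measure.le_add_right le_rfl

variable {K}

/-- Both factors are reduced to positive measures. The unweighted convolution then has continuous
translates on both sides, and it dominates the weighted one. -/
theorem conv_mem_transSubmodule [Nonempty S] (hassoc : ∀ x y z, K.p (K.p x y) z = K.p x (K.p y z))
    (μ : boundedRadon S) (ha : a ∈ transSubmodule K.p K.continuous_p) :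
    K.conv μ a ∈ transSubmodule K.p K.continuous_p := by
  induction μ using boundedRadon.isPos_induction with
  | hpos m hm =>
    have key : ∀ n : boundedRadon S, IsPos n → absMeasure n ≤ absMeasure a →
        K.conv m n ∈ transSubmodule K.p K.continuous_p := fun n hn hle => by
      have hn' : n ∈ transSubmodule K.p K.continuous_p := mem_transSubmodule_of_le hle ha
      have hk : IsPos (K.unweighted.conv m n) := isPos_conv hm hn
      have hconv : ∀ g : S → ℂ, Continuous g → HasCompactSupport g →
          cint (K.unweighted.conv m n) g = cint m fun z => cint n fun y => g (K.p z y) := by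
        intro g hg hg'
        obtain ⟨C, hC⟩ := hg'.exists_bound_of_continuous hg
        rw [K.unweighted.isConv_conv m n g hg C hC]
        simp [bil, unweighted]
      exact mem_transSubmodule_of_le (K.absMeasure_conv_le hm hn)
        ⟨hn'.1.conv K.continuous_p hassoc hn hk hconv,
          hn'.1.conv_flip K.continuous_p hassoc hn hk hn'.2 hconv⟩
    obtain ⟨x, y, z, w, ⟨hx, hy, hz, hw⟩, ⟨lx, ly, lz, lw⟩, e⟩ := exists_isPos_decomposition a
    have hsub : ∀ u v : boundedRadon S, K.conv m (u - v) = K.conv m u - K.conv m v := fun u v => by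
      rw [sub_eq_add_neg, ← neg_one_smul ℂ v, conv_add, conv_smul, neg_one_smul, sub_eq_add_neg]
    rw [e, conv_add, conv_smul, hsub, hsub]
    exact Submodule.add_mem _ (Submodule.sub_mem _ (key x hx lx) (key y hy ly))
      (Submodule.smul_mem _ _ (Submodule.sub_mem _ (key z hz lz) (key w hw lw)))
  | hadd m n hm hn =>
    rw [add_conv]
    exact Submodule.add_mem _ hm hn
  | hsmul c m hm =>
    rw [smul_conv]
    exact Submodule.smul_mem _ c hm

theorem conv_mem_transSubmodule' [Nonempty S] (hassoc : ∀ x y z, K.p (K.p x y) z = K.p x (K.p y z))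
    (μ : boundedRadon S) (ha : a ∈ transSubmodule K.p K.continuous_p) :
    K.conv a μ ∈ transSubmodule K.p K.continuous_p := by
  rw [← flip_conv]
  have := conv_mem_transSubmodule (K := K.flip) (fun x y z => (hassoc z y x).symm) μ
    (a := a) ⟨ha.2, ha.1⟩
  exact ⟨this.2, this.1⟩

/-- `hθ` is the cocycle identity that makes the weight of a triple product independent of the
bracketing. For `ω(xy) / (ω(x)ω(y))` both sides equal `ω(xyz) / (ω(x)ω(y)ω(z))`. -/
theorem conv_assoc (hassoc : ∀ x y z, K.p (K.p x y) z = K.p x (K.p y z))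
    (hθ : ∀ x y z, K.θ (K.p x y) z * K.θ x y = K.θ x (K.p y z) * K.θ y z) :
    K.conv (K.conv μ ν) ρ = K.conv μ (K.conv ν ρ) := by
  refine IsConv.unique (K := K) (K.isConv_conv _ _) fun g hg C hC => ?_
  have hG : Continuous fun u => cint ρ fun z => g (K.p u z) * (K.θ u z : ℂ) :=
    continuous_cint ρ (K.continuous_kernel hg) (K.norm_kernel_le hC)
  have hGC : ∀ u, ‖cint ρ fun z => g (K.p u z) * (K.θ u z : ℂ)‖ ≤ C * ‖ρ‖ := fun u =>
    norm_cint_le_of_norm_le (K.norm_kernel_le hC u)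
  rw [K.isConv_conv _ _ g hg C hC, bil, bil, K.isConv_conv μ ν _ hG _ hGC, bil]
  congr 1
  ext x
  have hgx : Continuous fun w => g (K.p x w) * (K.θ x w : ℂ) :=
    (K.continuous_kernel hg).comp (Continuous.prodMk_right x)
  rw [K.isConv_conv ν ρ _ hgx C (K.norm_kernel_le hC x), bil]
  congr 1
  ext y
  rw [mul_comm, ← cint_const_mul _ (integrable_inner ρ hg hC _)]
  congr 1
  ext z
  have := congrArg (fun t : ℝ => (t : ℂ)) (hθ x y z)
  simp only [Complex.ofReal_mul] at this
  rw [hassoc]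
  linear_combination (-(g (K.p x (K.p y z)))) * this

/-! ### Translates -/

omit [LocallyCompactSpace S] in
variable (K) in
theorem exists_translate (a : boundedRadon S) (x : S) :
    ∃ κ : boundedRadon S, absMeasure κ ≤ (absMeasure a).map (K.p x) ∧
      ∀ g : S → ℂ, Continuous g → ∀ C, (∀ x, ‖g x‖ ≤ C) →
        cint κ g = cint a fun y => g (K.p x y) * (K.θ x y : ℂ) :=
  exists_weighted_image a (K.continuous_p.comp (Continuous.prodMk_right x))
    (Complex.continuous_ofReal.comp (K.continuous_θ.comp (Continuous.prodMk_right x)))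
    (K.norm_θ_le x)

variable (K) in
/-- The translate of `a` by `x`: the image of `θ(x, ·) • a` under `p x`. -/
noncomputable def translate (a : boundedRadon S) (x : S) : boundedRadon S :=
  (K.exists_translate a x).choose

omit [LocallyCompactSpace S] in
theorem absMeasure_translate_le (a : boundedRadon S) (x : S) :
    absMeasure (K.translate a x) ≤ (absMeasure a).map (K.p x) :=
  (K.exists_translate a x).choose_spec.1

omit [LocallyCompactSpace S] in
theorem cint_translate (a : boundedRadon S) (x : S) {g : S → ℂ} (hg : Continuous g) {C : ℝ}
    (hC : ∀ x, ‖g x‖ ≤ C) :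
    cint (K.translate a x) g = cint a fun y => g (K.p x y) * (K.θ x y : ℂ) :=
  (K.exists_translate a x).choose_spec.2 g hg C hC

omit [LocallyCompactSpace S] in
theorem norm_translate_le (a : boundedRadon S) (x : S) : ‖K.translate a x‖ ≤ ‖a‖ := by
  refine (ENNReal.toReal_mono ?_ (absMeasure_translate_le (K := K) a x univ)).trans_eq ?_
  · exact measure_ne_top _ _
  · have : Continuous (K.p x) := K.continuous_p.comp (Continuous.prodMk_right x)
    rw [Measure.map_apply this.measurable MeasurableSet.univ, preimage_univ]
    rfl

omit [LocallyCompactSpace S] in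
theorem continuous_cint_translate (a : boundedRadon S) (g : S → ℂ) (hg : Continuous g)
    (hg' : HasCompactSupport g) : Continuous fun x => cint (K.translate a x) g := by
  obtain ⟨C, hC⟩ := hg'.exists_bound_of_continuous hg
  simp_rw [cint_translate a _ hg hC]
  exact continuous_cint a (K.continuous_kernel hg) (K.norm_kernel_le hC)

theorem continuous_functional_translate (ha : TransCont K.p (absMeasure a))
    (F : StrongDual ℂ (boundedRadon S)) : Continuous fun x => F (K.translate a x) :=
  ha.continuous_functional K.continuous_p (absMeasure_translate_le a)
    (continuous_cint_translate a) F

/-- This says that `K.conv μ a` is the weak integral of the translates of `a` against `μ`. It holds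
for test functions by definition and for all functionals because `a` has continuous translates. -/
theorem functional_conv [Nonempty S] (ha : TransCont K.p (absMeasure a)) (μ : boundedRadon S)
    (F : StrongDual ℂ (boundedRadon S)) :
    F (K.conv μ a) = cint μ fun x => F (K.translate a x) :=
  ha.functional_eq_cint K.continuous_p (absMeasure_translate_le a) (continuous_cint_translate a)
    (fun g hg hg' => by
      obtain ⟨C, hC⟩ := hg'.exists_bound_of_continuous hg
      simp_rw [cint_translate a _ hg hC]
      exact K.isConv_conv μ a g hg C hC) F

/-- Two functionals of `μ ↦ μ * a` and `μ ↦ b * μ` coincide if they do on point masses. -/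
theorem functional_conv_eq_of_translate [Nonempty S] (ha : TransCont K.p (absMeasure a))
    (hb : TransCont (fun x y => K.p y x) (absMeasure b)) {F G : StrongDual ℂ (boundedRadon S)}
    (h : ∀ x, F (K.translate a x) = G (K.flip.translate b x)) (μ : boundedRadon S) :
    F (K.conv μ a) = G (K.conv b μ) := by
  rw [← flip_conv (μ := μ) (ν := b), functional_conv ha, functional_conv (K := K.flip) hb]
  simp_rw [h]

end ConvKernel

/-! ### Mazur's lemma -/

section Mazur

/-- Mazur's lemma, in the form: a weak limit of elements of a convex set is in its closure. -/
theorem Convex.mem_closure_of_tendsto_functional {X ι : Type*} [NormedAddCommGroup X]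
    [NormedSpace ℂ X] {T : Set X} (hT : Convex ℝ T) {f : Filter ι} [f.NeBot] {u : ι → X} {x : X}
    (hu : ∀ᶠ i in f, u i ∈ T)
    (h : ∀ F : StrongDual ℂ X, Filter.Tendsto (fun i => F (u i)) f (𝓝 (F x))) : x ∈ closure T := by
  have h1 : Filter.Tendsto (fun i => toWeakSpace ℂ X (u i)) f (𝓝 (toWeakSpace ℂ X x)) := by
    refine (WeakBilin.tendsto_iff_forall_eval_tendsto (topDualPairing ℂ X).flip ?_).2 h
    intro y z hyz
    by_contra hne
    obtain ⟨F, hF⟩ := SeparatingDual.exists_separating_of_ne (R := ℂ) (x := (y : X)) (y := z) hne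
    exact hF (LinearMap.congr_fun hyz F)
  have h2 : toWeakSpace ℂ X x ∈ closure (toWeakSpace ℂ X '' T) :=
    mem_closure_of_tendsto h1 (hu.mono fun i hi => mem_image_of_mem _ hi)
  rw [← hT.toWeakSpace_closure ℂ] at h2
  exact (toWeakSpace ℂ X).injective.mem_set_image.1 h2

end Mazur

/-! ### The bounded approximate identity -/

namespace ConvKernel

variable {S : Type*} [TopologicalSpace S] [T2Space S] [MeasurableSpace S] [BorelSpace S]
  [LocallyCompactSpace S] (K : ConvKernel S)

omit [LocallyCompactSpace S] in
theorem norm_cint_sub_le_of_isPos {m : boundedRadon S} (hm : IsPos m) {U : Set S} (hU : IsOpen U)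
    (hmU : absMeasure m Uᶜ = 0) {f : S → ℂ} (hf : Continuous f) {C : ℝ} (hC : ∀ x, ‖f x‖ ≤ C)
    {z : ℂ} {ε : ℝ} (hε : 0 ≤ ε) (h : ∀ x ∈ U, ‖f x - z‖ ≤ ε) :
    ‖cint m f - ‖m‖ * z‖ ≤ ε * ‖m‖ := by
  have h1 : cint m (fun _ => z) = ‖m‖ * z := by
    rw [hm.cint_eq (integrable_const _), integral_const, norm_eq_real]
    simp
  rw [← h1, ← cint_sub (integrable_of_norm_le hf.measurable hC) (integrable_const _)]
  have h2 := norm_cint_le_of_norm_le_add m (f := fun x => f x - z) (C := C + ‖z‖) hU.measurableSet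
    hε h fun x => (norm_sub_le _ _).trans (by gcongr; exact hC x)
  rwa [measureReal_def, hmU, ENNReal.toReal_zero, mul_zero, add_zero] at h2

/-- Normalized restrictions of measures of `M_a` to small neighbourhoods of `e₀`. -/
theorem exists_tendsto_cint {p : S → S → S} {hp : Continuous (Function.uncurry p)} {e₀ : S} {c : ℝ}
    (hc : 0 ≤ c) (hdense : ∀ U : Set S, IsOpen U → e₀ ∈ U → ∃ a ∈ transSubmodule p hp,
      absMeasure a U ≠ 0) :
    ∃ l : Filter (boundedRadon S), l.NeBot ∧ (∀ᶠ e in l, e ∈ transSubmodule p hp ∧ ‖e‖ ≤ c) ∧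
      ∀ f : S → ℂ, Continuous f → ∀ C, (∀ x, ‖f x‖ ≤ C) →
        Filter.Tendsto (fun e => cint e f) l (𝓝 (c * f e₀)) := by
  have key : ∀ V : Set S, ∃ e : boundedRadon S, V ∈ 𝓝 e₀ → IsPos e ∧ ‖e‖ = c ∧
      e ∈ transSubmodule p hp ∧ absMeasure e (interior V)ᶜ = 0 := by
    intro V
    by_cases hV : V ∈ 𝓝 e₀
    swap
    · exact ⟨0, fun h => absurd h hV⟩
    obtain ⟨a, ha, haV⟩ := hdense (interior V) isOpen_interior (mem_interior_iff_mem_nhds.2 hV)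
    set U := interior V
    have hle : (absMeasure a).restrict U ≤ absMeasure a := Measure.restrict_le_self
    have hr : ((absMeasure a).restrict U).Regular := regular_of_le_of_regular inferInstance hle
    set t : ℝ := (absMeasure a).real U with ht
    have ht0 : 0 < t := ENNReal.toReal_pos haV (measure_ne_top _ _)
    -- Rescaling by `c / t` gives the restriction to `U` total mass exactly `c`.
    set n : NNReal := ⟨c / t, by positivity⟩ with hn
    have hr2 : (n • (absMeasure a).restrict U).InnerRegular := inferInstance
    have hr3 : (n • (absMeasure a).restrict U).Regular := inferInstance
    have hb : ofFiniteMeasure ((absMeasure a).restrict U) ∈ transSubmodule p hp :=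
      mem_transSubmodule_of_le (by rw [absMeasure_ofFiniteMeasure]; exact hle) ha
    refine ⟨ofFiniteMeasure (n • (absMeasure a).restrict U), fun _ =>
      ⟨isPos_ofFiniteMeasure _, ?_, ?_, ?_⟩⟩
    · rw [norm_ofFiniteMeasure, measureReal_def, Measure.smul_apply, Measure.restrict_apply_univ]
      change ((n : ENNReal) * absMeasure a U).toReal = c
      rw [ENNReal.toReal_mul, ← measureReal_def, ← ht]
      change c / t * t = c
      field_simp
    · rw [mem_transSubmodule, absMeasure_ofFiniteMeasure]
      rw [mem_transSubmodule, absMeasure_ofFiniteMeasure] at hb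
      exact ⟨hb.1.smul hp n, hb.2.smul (continuous_uncurry_flip hp) n⟩
    · rw [absMeasure_ofFiniteMeasure, Measure.smul_apply, Measure.restrict_apply
        isOpen_interior.measurableSet.compl, compl_inter_self, measure_empty, smul_zero]
  choose e he using key
  -- The index filter is that of neighbourhoods of `e₀` shrinking to `e₀`: `smallSets` also admits
  -- sets that are not neighbourhoods, which the principal filter removes.
  have hev : ∀ᶠ V in (𝓝 e₀).smallSets ⊓ Filter.principal {V | V ∈ 𝓝 e₀}, V ∈ 𝓝 e₀ :=
    Filter.mem_inf_of_right (Filter.mem_principal_self _)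
  refine ⟨Filter.map e ((𝓝 e₀).smallSets ⊓ Filter.principal {V | V ∈ 𝓝 e₀}), ?_, ?_, ?_⟩
  · refine Filter.NeBot.map (Filter.inf_principal_neBot_iff.2 fun W hW => ?_) e
    obtain ⟨V, hV, hVW⟩ := Filter.eventually_smallSets.1 hW
    exact ⟨V, hVW V subset_rfl, hV⟩
  · rw [Filter.eventually_map]
    exact hev.mono fun V hV => ⟨(he V hV).2.2.1, (he V hV).2.1.le⟩
  · intro f hf C hC
    rw [Filter.tendsto_map'_iff, Metric.tendsto_nhds]
    intro ε hε
    have hδ : 0 < ε / (c + 1) := by positivity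
    have hW : {x | ‖f x - f e₀‖ < ε / (c + 1)} ∈ 𝓝 e₀ := by
      have := Metric.tendsto_nhds.1 (hf.continuousAt (x := e₀)) _ hδ
      simp_rw [dist_eq_norm] at this
      exact this
    have h1 : ∀ᶠ V in (𝓝 e₀).smallSets ⊓ Filter.principal {V | V ∈ 𝓝 e₀},
        V ⊆ {x | ‖f x - f e₀‖ < ε / (c + 1)} :=
      Filter.mem_inf_of_left (Filter.eventually_smallSets_subset.2 hW)
    filter_upwards [hev, h1] with V hV hVs
    obtain ⟨hpos, hnorm, -, hnull⟩ := he V hV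
    have := norm_cint_sub_le_of_isPos hpos isOpen_interior hnull hf hC hδ.le fun x hx =>
      (hVs (interior_subset hx)).le
    rw [hnorm] at this
    rw [Function.comp_apply, dist_eq_norm]
    refine this.trans_lt ?_
    rw [div_mul_eq_mul_div, div_lt_iff₀ (by positivity)]
    nlinarith

variable {K}

theorem translate_eq_smul {e₀ : S} {t : ℝ} (hp : ∀ y, K.p e₀ y = y) (hθ : ∀ y, K.θ e₀ y = t)
    (a : boundedRadon S) : K.translate a e₀ = (t : ℂ) • a := by
  refine boundedRadon.ext_of_cint fun g hg hg' => ?_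
  obtain ⟨C, hC⟩ := hg'.exists_bound_of_continuous hg
  have hi : Integrable g (absMeasure a) := integrable_of_norm_le hg.measurable hC
  rw [cint_translate a e₀ hg hC, cint_smul_measure _ hi, ← cint_const_mul _ hi]
  simp_rw [hp, hθ, mul_comm]

/-- `F (K.conv e a)` is the integral against `e` of the continuous bounded function `x ↦ F
(K.translate a x)`. Translation by `e₀` multiplies `a` by `t`, which the limiting mass `t⁻¹`
compensates. -/
theorem tendsto_functional_conv {e₀ : S} {t : ℝ} (ht : 0 < t) (hp : ∀ y, K.p e₀ y = y)
    (hθ : ∀ y, K.θ e₀ y = t) {a : boundedRadon S} (ha : TransCont K.p (absMeasure a))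
    {l : Filter (boundedRadon S)} (hl : ∀ f : S → ℂ, Continuous f → ∀ C, (∀ x, ‖f x‖ ≤ C) →
        Filter.Tendsto (fun e => cint e f) l (𝓝 ((t⁻¹ : ℝ) * f e₀)))
    (F : StrongDual ℂ (boundedRadon S)) :
    Filter.Tendsto (fun e => F (K.conv e a)) l (𝓝 (F a)) := by
  have : Nonempty S := ⟨e₀⟩
  simp_rw [functional_conv ha]
  have h := hl _ (continuous_functional_translate ha F) (‖F‖ * ‖a‖) fun x =>
    (F.le_opNorm _).trans (by gcongr; exact norm_translate_le a x)
  have e : ((t⁻¹ : ℝ) : ℂ) * F (K.translate a e₀) = F a := by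
    rw [translate_eq_smul hp hθ, map_smul, smul_eq_mul, ← mul_assoc, ← Complex.ofReal_mul,
      inv_mul_cancel₀ ht.ne', Complex.ofReal_one, one_mul]
  rwa [e] at h

variable (K) in
/-- Convolution as a bilinear map. -/
noncomputable def convLinear : boundedRadon S →ₗ[ℂ] boundedRadon S →ₗ[ℂ] boundedRadon S :=
  LinearMap.mk₂ ℂ K.conv (fun _ _ _ => add_conv) (fun c _ _ => smul_conv c)
    (fun _ _ _ => conv_add) (fun c _ _ => conv_smul c)

/-- `M_a` has a bounded two-sided approximate identity. -/
theorem exists_approximate_identity {e₀ : S} {t : ℝ} (ht : 0 < t) (hp : ∀ y, K.p e₀ y = y)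
    (hp' : ∀ y, K.p y e₀ = y) (hθ : ∀ y, K.θ e₀ y = t) (hθ' : ∀ y, K.θ y e₀ = t)
    (hdense : ∀ U : Set S, IsOpen U → e₀ ∈ U → ∃ a ∈ transSubmodule K.p K.continuous_p,
      absMeasure a U ≠ 0) (s : Finset (boundedRadon S))
    (hs : ∀ a ∈ s, a ∈ transSubmodule K.p K.continuous_p) {ε : ℝ} (hε : 0 < ε) :
    ∃ e ∈ transSubmodule K.p K.continuous_p, ‖e‖ ≤ t⁻¹ ∧
      ∀ a ∈ s, ‖K.conv e a - a‖ < ε ∧ ‖K.conv a e - a‖ < ε := by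
  classical
  obtain ⟨l, hl, hmem, hlim⟩ := exists_tendsto_cint (inv_nonneg.2 ht.le) hdense
  -- All products `e * a` and `a * e` with `a ∈ s` are collected in one finite product space, so a
  -- single application of Mazur's lemma yields one `e` for all of them.
  let Φ : boundedRadon S →ₗ[ℂ] (s → boundedRadon S × boundedRadon S) :=
    LinearMap.pi fun i => (K.convLinear.flip i.1).prod (K.convLinear i.1)
  have hΦ : ∀ e i, Φ e i = (K.conv e i.1, K.conv i.1 e) := fun _ _ => rfl
  let T : Set (boundedRadon S) :=
    (transSubmodule K.p K.continuous_p : Set (boundedRadon S)) ∩ Metric.closedBall 0 t⁻¹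
  have hT : Convex ℝ T :=
    ((transSubmodule K.p K.continuous_p).restrictScalars ℝ).convex.inter (convex_closedBall _ _)
  have hT' : Convex ℝ (Φ '' T) := hT.linear_image (Φ.restrictScalars ℝ)
  have hcl : (fun i : s => ((i : boundedRadon S), (i : boundedRadon S))) ∈ closure (Φ '' T) := by
    refine hT'.mem_closure_of_tendsto_functional (f := l) (u := Φ) ?_ fun F => ?_
    · exact hmem.mono fun e he => mem_image_of_mem _ ⟨he.1, by simpa using he.2⟩
    -- A functional on the finite product is a sum of functionals of the coordinates, so weak
    -- convergence may be checked coordinatewise.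
    · have hdec : ∀ x : s → boundedRadon S × boundedRadon S, F x = ∑ i,
          ((F.comp ((ContinuousLinearMap.single ℂ
            (fun _ : s => boundedRadon S × boundedRadon S) i).comp
            (ContinuousLinearMap.inl ℂ _ _))) (x i).1 +
          (F.comp ((ContinuousLinearMap.single ℂ
            (fun _ : s => boundedRadon S × boundedRadon S) i).comp
            (ContinuousLinearMap.inr ℂ _ _))) (x i).2) := fun x => by
        simp only [ContinuousLinearMap.comp_apply, ← map_add]
        conv_lhs => rw [← Finset.univ_sum_single x, map_sum]
        simp
      rw [hdec]
      simp_rw [hdec (Φ _), hΦ]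
      refine tendsto_finsetSum _ fun i _ => ?_
      have hi := hs i.1 i.2
      refine (tendsto_functional_conv ht hp hθ hi.1 hlim _).add ?_
      have hflip : ∀ e, K.conv i.1 e = K.flip.conv e i.1 := fun e => K.flip_conv.symm
      simp_rw [hflip]
      exact tendsto_functional_conv (K := K.flip) ht hp' hθ' hi.2 hlim _
  obtain ⟨_, ⟨e, he, rfl⟩, hd⟩ := Metric.mem_closure_iff.1 hcl ε hε
  refine ⟨e, he.1, by simpa using he.2, fun a ha => ?_⟩
  have := (dist_pi_lt_iff hε).1 hd ⟨a, ha⟩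
  rw [hΦ, Prod.dist_eq, max_lt_iff] at this
  exact ⟨by rw [← dist_eq_norm, dist_comm]; exact this.1,
    by rw [← dist_eq_norm, dist_comm]; exact this.2⟩

end ConvKernel

/-! ### The convolution of M(S, ω) as a kernel convolution -/

section Weighted

variable {S : Type*} [Monoid S] [TopologicalSpace S] {ω : S → ℝ}

theorem IsWeight.pos (hω : IsWeight ω) (x : S) : 0 < ω x := by
  obtain ⟨c, hc, h⟩ := hω.inv_bddOn_compact {x} isCompact_singleton
  exact hc.trans_le (h x rfl)

variable [ContinuousMul S]

/-- The convolution of `M(S, ω)`, written in terms of the bounded measures `ωμ`, has the kernel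
`ω(xy) / (ω(x) ω(y))`. -/
noncomputable def IsWeight.kernel (hω : IsWeight ω) : ConvKernel S where
  p := fun x y => x * y
  θ x y := ω (x * y) / (ω x * ω y)
  continuous_p := continuous_mul
  continuous_θ := (hω.continuous.comp continuous_mul).div
    ((hω.continuous.comp continuous_fst).mul (hω.continuous.comp continuous_snd))
    fun w => (mul_pos (hω.pos w.1) (hω.pos w.2)).ne'
  θ_nonneg _ _ := div_nonneg (hω.nonneg _) (mul_nonneg (hω.nonneg _) (hω.nonneg _))
  θ_le_one _ _ := div_le_one_of_le₀ (hω.submul _ _) (mul_nonneg (hω.nonneg _) (hω.nonneg _))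

theorem IsWeight.kernel_p (hω : IsWeight ω) (x y : S) : hω.kernel.p x y = x * y := rfl

theorem IsWeight.kernel_θ (hω : IsWeight ω) (x y : S) :
    hω.kernel.θ x y = ω (x * y) / (ω x * ω y) := rfl

variable [T2Space S] [MeasurableSpace S] [BorelSpace S] [LocallyCompactSpace S]

omit [Monoid S] [ContinuousMul S] [LocallyCompactSpace S] in
theorem WeightedMeasure.integral_eq_cint (μ : WeightedMeasure ω) (f : S → ℂ) :
    μ.integral f = cint μ.weighted fun x => f x / (ω x : ℂ) := rfl

/-- `f(xy) / (ω(x)ω(y)) = (f/ω)(xy) θ(x, y)`. Fubini's theorem is needed because here the inner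
integral is over `μ`, whereas in `bil` it is over `ν`. -/
theorem WeightedMeasure.integral_conv_eq (hω : IsWeight ω) (μ ν : WeightedMeasure ω) {f : S → ℂ}
    (hf : Continuous f) (hf' : HasCompactSupport f) :
    ν.integral (fun y => μ.integral fun x => f (x * y)) =
      hω.kernel.bil μ.weighted ν.weighted fun x => f x / (ω x : ℂ) := by
  have hωc : Continuous fun x => (ω x : ℂ) := Complex.continuous_ofReal.comp hω.continuous
  have hω0 : ∀ x, (ω x : ℂ) ≠ 0 := fun x => Complex.ofReal_ne_zero.2 (hω.pos x).ne'
  have hg : Continuous fun x => f x / (ω x : ℂ) := hf.div hωc hω0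
  have hg' : HasCompactSupport fun x => f x / (ω x : ℂ) := by
    simp_rw [div_eq_mul_inv]
    exact hf'.mul_right
  obtain ⟨C, hC⟩ := hg'.exists_bound_of_continuous hg
  rw [ConvKernel.bil, cint_cint_swap _ _ (hω.kernel.continuous_kernel hg)
    (hω.kernel.norm_kernel_le hC), WeightedMeasure.integral_eq_cint]
  congr 1
  ext y
  have hi : Integrable (fun x => f (x * y) / (ω (x * y) : ℂ) * (hω.kernel.θ x y : ℂ))
      (absMeasure μ.weighted) :=
    integrable_of_norm_le ((hω.kernel.continuous_kernel hg).comp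
      (Continuous.prodMk_left y)).measurable fun x => hω.kernel.norm_kernel_le hC x y
  rw [WeightedMeasure.integral_eq_cint, div_eq_iff (hω0 y), mul_comm]
  simp_rw [hω.kernel_p]
  rw [← cint_const_mul _ hi]
  congr 1
  ext x
  rw [hω.kernel_θ]
  have h1 := hω0 x
  have h2 := hω0 y
  have h3 := hω0 (x * y)
  push_cast
  field_simp

/-- Division by `ω` is a bijection of the test functions. -/
theorem WeightedMeasure.integral_eq_iff (hω : IsWeight ω) (μ ν κ : WeightedMeasure ω) :
    (∀ f : S → ℂ, Continuous f → HasCompactSupport f →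
      κ.integral f = ν.integral (fun y => μ.integral fun x => f (x * y))) ↔
      hω.kernel.IsConv μ.weighted ν.weighted κ.weighted := by
  have hωc : Continuous fun x => (ω x : ℂ) := Complex.continuous_ofReal.comp hω.continuous
  have hω0 : ∀ x, (ω x : ℂ) ≠ 0 := fun x => Complex.ofReal_ne_zero.2 (hω.pos x).ne'
  constructor
  · refine fun h => ConvKernel.isConv_of_hasCompactSupport fun g hg hg' => ?_
    have hf : Continuous fun x => g x * (ω x : ℂ) := hg.mul hωc
    have hf' : HasCompactSupport fun x => g x * (ω x : ℂ) := hg'.mul_right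
    have e : (fun x => g x * (ω x : ℂ) / (ω x : ℂ)) = g := by
      ext x
      exact mul_div_cancel_right₀ _ (hω0 x)
    have := h _ hf hf'
    rwa [WeightedMeasure.integral_conv_eq hω μ ν hf hf', WeightedMeasure.integral_eq_cint,
      e] at this
  · intro h f hf hf'
    have hg : Continuous fun x => f x / (ω x : ℂ) := hf.div hωc hω0
    have hg' : HasCompactSupport fun x => f x / (ω x : ℂ) := by
      simp_rw [div_eq_mul_inv]
      exact hf'.mul_right
    obtain ⟨C, hC⟩ := hg'.exists_bound_of_continuous hg
    rw [WeightedMeasure.integral_conv_eq hω μ ν hf hf', WeightedMeasure.integral_eq_cint]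
    exact h _ hg C hC

theorem WeightedMeasure.mul_eq_conv (hω : IsWeight ω) (μ ν : WeightedMeasure ω) :
    μ * ν = hω.kernel.conv μ.weighted ν.weighted := by
  have h : ∃ κ : WeightedMeasure ω, ∀ f : S → ℂ, Continuous f → HasCompactSupport f →
      κ.integral f = ν.integral (fun y => μ.integral (fun x => f (x * y))) :=
    ⟨hω.kernel.conv μ.weighted ν.weighted,
      (WeightedMeasure.integral_eq_iff hω μ ν _).2 (hω.kernel.isConv_conv _ _)⟩
  have e : μ * ν = h.choose := dif_pos h
  rw [e]
  exact ((WeightedMeasure.integral_eq_iff hω μ ν _).1 h.choose_spec).eq_conv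

end Weighted

/-! ### Ideals with a bounded approximate identity -/

section LimitOperator

/-- A pointwise limit of eventually uniformly bounded operators. -/
theorem exists_clm_of_tendsto {E G ι : Type*} [NormedAddCommGroup E] [NormedSpace ℂ E]
    [NormedAddCommGroup G] [NormedSpace ℂ G] {f : Filter ι} [f.NeBot] {T : ι → E →L[ℂ] G} {C : ℝ}
    (hC : ∀ᶠ i in f, ∀ y, ‖T i y‖ ≤ C * ‖y‖)
    (h : ∀ y, ∃ w, Filter.Tendsto (fun i => T i y) f (𝓝 w)) :
    ∃ T' : E →L[ℂ] G, (∀ y, Filter.Tendsto (fun i => T i y) f (𝓝 (T' y))) ∧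
      ∀ y, ‖T' y‖ ≤ C * ‖y‖ := by
  choose w hw using h
  have hb : ∀ y, ‖w y‖ ≤ C * ‖y‖ := fun y =>
    le_of_tendsto (hw y).norm (hC.mono fun i hi => hi y)
  refine ⟨LinearMap.mkContinuous
    { toFun := w
      map_add' := fun x y => tendsto_nhds_unique (hw (x + y))
        (by simpa only [map_add] using (hw x).add (hw y))
      map_smul' := fun c x => tendsto_nhds_unique (hw (c • x))
        (by simpa only [map_smul, RingHom.id_apply] using (hw x).const_smul c) } C hb, hw, hb⟩

end LimitOperator

/-- `A` is a two-sided ideal of the (possibly non-unital) normed algebra `B`, and `f` is a bounded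
two-sided approximate identity of `A`. -/
structure IsApproxIdeal {B : Type*} [NormedAddCommGroup B] [NormedSpace ℂ B] [Mul B]
    (A : Submodule ℂ B) (f : Filter B) : Prop where
  add_mul : ∀ a b c : B, (a + b) * c = a * c + b * c
  mul_add : ∀ a b c : B, a * (b + c) = a * b + a * c
  smul_mul : ∀ (t : ℂ) (a b : B), (t • a) * b = t • (a * b)
  mul_smul : ∀ (t : ℂ) (a b : B), a * (t • b) = t • (a * b)
  assoc : ∀ a b c : B, a * b * c = a * (b * c)
  norm_mul_le : ∀ a b : B, ‖a * b‖ ≤ ‖a‖ * ‖b‖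
  mul_mem_left : ∀ b : B, ∀ a ∈ A, b * a ∈ A
  mul_mem_right : ∀ a ∈ A, ∀ b : B, a * b ∈ A
  eventually_bounded : ∃ M, 0 ≤ M ∧ ∀ᶠ e in f, e ∈ A ∧ ‖e‖ ≤ M
  tendsto_mul_right : ∀ a ∈ A, Filter.Tendsto (fun e => e * a) f (𝓝 a)
  tendsto_mul_left : ∀ a ∈ A, Filter.Tendsto (fun e => a * e) f (𝓝 a)

namespace IsApproxIdeal

variable {B E : Type*} [NormedAddCommGroup B] [NormedSpace ℂ B] [Mul B]
  [NormedAddCommGroup E] [NormedSpace ℂ E] {A : Submodule ℂ B} {f : Filter B}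

/-- Multiplication of `B` as a bilinear map. -/
noncomputable def mulLin (hA : IsApproxIdeal A f) : B →L[ℂ] B →L[ℂ] B :=
  LinearMap.mkContinuous₂
    (LinearMap.mk₂ ℂ (fun a b : B => a * b) hA.add_mul hA.smul_mul hA.mul_add
      fun c a b => hA.mul_smul c a b) 1 fun a b => by
    rw [one_mul]
    exact hA.norm_mul_le a b

theorem continuous_mul_left (hA : IsApproxIdeal A f) (b : B) : Continuous fun a : B => b * a :=
  (hA.mulLin b).continuous

theorem continuous_mul_right (hA : IsApproxIdeal A f) (b : B) : Continuous fun a : B => a * b :=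
  (hA.mulLin.flip b).continuous

end IsApproxIdeal

section Lipschitz

variable {B G : Type*} [NormedAddCommGroup B] [NormedSpace ℂ B] [NormedAddCommGroup G]
  [NormedSpace ℂ G] {A : Submodule ℂ B}

/-- A bounded linear map on `A`, given by a map on `B`, is continuous on `A`. -/
theorem continuousOn_of_bounded_linear {φ : B → G} (hadd : ∀ a ∈ A, ∀ b ∈ A, φ (a + b) = φ a + φ b)
    (hsmul : ∀ c : ℂ, ∀ a ∈ A, φ (c • a) = c • φ a) {K : ℝ} (hK : ∀ a ∈ A, ‖φ a‖ ≤ K * ‖a‖) :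
    ContinuousOn φ A := by
  rw [continuousOn_iff_continuous_domRestrict]
  exact (LinearMap.mkContinuous (σ := RingHom.id ℂ) (E := A)
    { toFun := fun a => φ a
      map_add' := fun a b => hadd a a.2 b b.2
      map_smul' := fun c a => hsmul c a a.2 } K fun a => hK a a.2).continuous

theorem tendsto_of_continuousOn {ι X Y : Type*} [TopologicalSpace X] [TopologicalSpace Y]
    {φ : X → Y} {s : Set X} (hφ : ContinuousOn φ s) {f : Filter ι} {u : ι → X} {a : X} (ha : a ∈ s)
    (hu : ∀ᶠ i in f, u i ∈ s) (h : Filter.Tendsto u f (𝓝 a)) :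
    Filter.Tendsto (fun i => φ (u i)) f (𝓝 (φ a)) :=
  (hφ a ha).tendsto.comp (tendsto_nhdsWithin_iff.2 ⟨h, hu⟩)

end Lipschitz

/-! ### Continuity for the strong operator topology -/

section StrongOperator

variable {B E : Type*} [NormedAddCommGroup B] [NormedSpace ℂ B] [Mul B]
  [NormedAddCommGroup E] [NormedSpace ℂ E] {A : Set B}

/-- The difference has the shape of `D(μ * a)(x) - D(a)(x · μ)`, the value of the extended
derivation at `a · x`. -/
theorem continuous_toWeakDual_of_eq_sub {X : Type*} [TopologicalSpace X] {g : X → StrongDual ℂ E}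
    (h : ∀ y, ∃ u v : X → ℂ, Continuous u ∧ Continuous v ∧ ∀ x, g x y = u x - v x) :
    Continuous fun x => StrongDual.toWeakDual (g x) := by
  refine WeakDual.continuous_of_continuous_eval fun y => ?_
  obtain ⟨u, v, hu, hv, e⟩ := h y
  exact (hu.sub hv).congr fun x => (e x).symm

theorem ContinuousOn.continuous_of_mem {X Y Z : Type*} [TopologicalSpace X] [TopologicalSpace Y]
    [TopologicalSpace Z] {φ : Y → Z} {s : Set Y} (hφ : ContinuousOn φ s) {u : X → Y}
    (hu : Continuous u) (h : ∀ x, u x ∈ s) : Continuous fun x => φ (u x) :=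
  hφ.comp_continuous hu h

omit [NormedSpace ℂ B] in
theorem continuous_strongOperatorTopology_mul_right {Y : Type*} [TopologicalSpace Y] {a : B}
    (ha : a ∈ A) {φ : B → Y} (hφ : ContinuousOn φ A) (hmem : ∀ b : B, b * a ∈ A) :
    Continuous[strongOperatorTopology A, _] fun b => φ (b * a) :=
  @ContinuousOn.continuous_of_mem B B Y (strongOperatorTopology A) _ _ φ A hφ _
    (continuous_iff_le_induced.2 ((iInf₂_le a ha).trans inf_le_left)) hmem

omit [NormedSpace ℂ B] in
theorem continuous_strongOperatorTopology_mul_left {Y : Type*} [TopologicalSpace Y] {a : B}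
    (ha : a ∈ A) {φ : B → Y} (hφ : ContinuousOn φ A) (hmem : ∀ b : B, a * b ∈ A) :
    Continuous[strongOperatorTopology A, _] fun b => φ (a * b) :=
  @ContinuousOn.continuous_of_mem B B Y (strongOperatorTopology A) _ _ φ A hφ _
    (continuous_iff_le_induced.2 ((iInf₂_le a ha).trans inf_le_right)) hmem

end StrongOperator

/-! ### Extension of module actions and derivations -/

section Extension

variable {B E : Type*} [NormedAddCommGroup B] [NormedSpace ℂ B] [Mul B]
  [NormedAddCommGroup E] [NormedSpace ℂ E] {A : Submodule ℂ B} {f : Filter B}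
  {l r L R : B → E →L[ℂ] E}

theorem IsBanachBimodule.exists_bound {A : Set B} (h : IsBanachBimodule A l r) :
    ∃ K, 0 ≤ K ∧ ∀ a ∈ A, ∀ x, ‖l a x‖ ≤ K * ‖a‖ * ‖x‖ ∧ ‖r a x‖ ≤ K * ‖a‖ * ‖x‖ := by
  obtain ⟨K, hK⟩ := h.bounded
  refine ⟨max K 0, le_max_right _ _, fun a ha x => ⟨(hK a ha x).1.trans ?_, (hK a ha x).2.trans ?_⟩⟩
  all_goals gcongr; exact le_max_left _ _

theorem IsContDerivation.exists_bound {A : Set B} {D : B → StrongDual ℂ E}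
    (h : IsContDerivation A l r D) : ∃ K, 0 ≤ K ∧ ∀ a ∈ A, ‖D a‖ ≤ K * ‖a‖ := by
  obtain ⟨K, hK⟩ := h.bounded
  refine ⟨max K 0, le_max_right _ _, fun a ha => (hK a ha).trans ?_⟩
  gcongr
  exact le_max_left _ _

theorem IsBanachBimodule.continuousOn_left (h : IsBanachBimodule (A : Set B) l r) (x : E) :
    ContinuousOn (fun a => l a x) A := by
  obtain ⟨K, -, hK⟩ := h.exists_bound
  refine continuousOn_of_bounded_linear (K := K * ‖x‖) (fun a ha b hb => ?_) (fun c a ha => ?_)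
    fun a ha => ((hK a ha x).1).trans_eq (by ring)
  · rw [h.left_add a ha b hb]; rfl
  · rw [h.left_smul c a ha]; rfl

theorem IsBanachBimodule.continuousOn_right (h : IsBanachBimodule (A : Set B) l r) (x : E) :
    ContinuousOn (fun a => r a x) A := by
  obtain ⟨K, -, hK⟩ := h.exists_bound
  refine continuousOn_of_bounded_linear (K := K * ‖x‖) (fun a ha b hb => ?_) (fun c a ha => ?_)
    fun a ha => ((hK a ha x).2).trans_eq (by ring)
  · rw [h.right_add a ha b hb]; rfl
  · rw [h.right_smul c a ha]; rfl

theorem IsContDerivation.continuousOn {D : B → StrongDual ℂ E}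
    (h : IsContDerivation (A : Set B) l r D) : ContinuousOn D A := by
  obtain ⟨K, -, hK⟩ := h.exists_bound
  exact continuousOn_of_bounded_linear h.map_add h.map_smul hK

/-- `y = a · x` for some `a` and `x`. -/
theorem IsNeoUnitalBanachBimodule.exists_left {A : Set B} (h : IsNeoUnitalBanachBimodule A l r)
    (y : E) : ∃ a ∈ A, ∃ x, y = l a x := by
  obtain ⟨a, ha, b, -, x, rfl⟩ := h.neoUnital y
  exact ⟨a, ha, _, rfl⟩

theorem IsNeoUnitalBanachBimodule.exists_right {A : Set B} (h : IsNeoUnitalBanachBimodule A l r)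
    (y : E) : ∃ b ∈ A, ∃ x, y = r b x := by
  obtain ⟨a, ha, b, hb, x, rfl⟩ := h.neoUnital y
  exact ⟨b, hb, l a x, (h.left_right a ha b hb x).symm⟩

variable [f.NeBot]

/-- The action of `μ` is the pointwise limit of the actions of `μ * e`. At `a · x` the limit is `(μ
* a) · x`, so it exists everywhere by neo-unitality and does not depend on the factorization. -/
theorem IsApproxIdeal.exists_left_action (hA : IsApproxIdeal A f)
    (h : IsNeoUnitalBanachBimodule (A : Set B) l r) :
    ∃ L : B → E →L[ℂ] E, (∀ μ, ∀ a ∈ A, ∀ x, L μ (l a x) = l (μ * a) x) ∧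
      ∃ K, ∀ μ x, ‖L μ x‖ ≤ K * ‖μ‖ * ‖x‖ := by
  obtain ⟨K, hK0, hK⟩ := h.exists_bound
  obtain ⟨M, hM0, hM⟩ := hA.eventually_bounded
  have hlim : ∀ μ, ∀ a ∈ A, ∀ x,
      Filter.Tendsto (fun e => l (μ * e) (l a x)) f (𝓝 (l (μ * a) x)) := fun μ a ha x => by
    have h1 : Filter.Tendsto (fun e => μ * (e * a)) f (𝓝 (μ * a)) :=
      ((hA.continuous_mul_left μ).tendsto a).comp (hA.tendsto_mul_right a ha)
    refine (tendsto_of_continuousOn (h.continuousOn_left x) (hA.mul_mem_left μ a ha)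
      (Filter.Eventually.of_forall fun e => hA.mul_mem_left μ _ (hA.mul_mem_left e a ha))
      h1).congr' ?_
    filter_upwards [hM] with e he
    rw [← hA.assoc, h.left_mul _ (hA.mul_mem_left μ e he.1) a ha]
  have hT : ∀ μ, ∃ T' : E →L[ℂ] E,
      (∀ y, Filter.Tendsto (fun e => l (μ * e) y) f (𝓝 (T' y))) ∧
        ∀ y, ‖T' y‖ ≤ K * M * ‖μ‖ * ‖y‖ := fun μ => by
    refine exists_clm_of_tendsto ?_ fun y => ?_
    · filter_upwards [hM] with e he y
      refine (hK _ (hA.mul_mem_left μ e he.1) y).1.trans ?_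
      have := (hA.norm_mul_le μ e).trans (mul_le_mul_of_nonneg_left he.2 (norm_nonneg _))
      calc K * ‖μ * e‖ * ‖y‖ ≤ K * (‖μ‖ * M) * ‖y‖ := by gcongr
        _ = K * M * ‖μ‖ * ‖y‖ := by ring
    · obtain ⟨a, ha, x, rfl⟩ := h.exists_left y
      exact ⟨_, hlim μ a ha x⟩
  choose L hL hLb using hT
  exact ⟨L, fun μ a ha x => tendsto_nhds_unique (hL μ _) (hlim μ a ha x), K * M, hLb⟩

theorem IsApproxIdeal.exists_right_action (hA : IsApproxIdeal A f)
    (h : IsNeoUnitalBanachBimodule (A : Set B) l r) :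
    ∃ R : B → E →L[ℂ] E, (∀ μ, ∀ a ∈ A, ∀ x, R μ (r a x) = r (a * μ) x) ∧
      ∃ K, ∀ μ x, ‖R μ x‖ ≤ K * ‖μ‖ * ‖x‖ := by
  obtain ⟨K, hK0, hK⟩ := h.exists_bound
  obtain ⟨M, hM0, hM⟩ := hA.eventually_bounded
  have hlim : ∀ μ, ∀ a ∈ A, ∀ x,
      Filter.Tendsto (fun e => r (e * μ) (r a x)) f (𝓝 (r (a * μ) x)) := fun μ a ha x => by
    have h1 : Filter.Tendsto (fun e => a * e * μ) f (𝓝 (a * μ)) :=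
      ((hA.continuous_mul_right μ).tendsto a).comp (hA.tendsto_mul_left a ha)
    refine (tendsto_of_continuousOn (h.continuousOn_right x) (hA.mul_mem_right a ha μ)
      (Filter.Eventually.of_forall fun e => hA.mul_mem_right _ (hA.mul_mem_right a ha e) μ)
      h1).congr' ?_
    filter_upwards [hM] with e he
    rw [hA.assoc, h.right_mul a ha _ (hA.mul_mem_right e he.1 μ)]
  have hT : ∀ μ, ∃ T' : E →L[ℂ] E,
      (∀ y, Filter.Tendsto (fun e => r (e * μ) y) f (𝓝 (T' y))) ∧
        ∀ y, ‖T' y‖ ≤ K * M * ‖μ‖ * ‖y‖ := fun μ => by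
    refine exists_clm_of_tendsto ?_ fun y => ?_
    · filter_upwards [hM] with e he y
      refine (hK _ (hA.mul_mem_right e he.1 μ) y).2.trans ?_
      have := (hA.norm_mul_le e μ).trans (mul_le_mul_of_nonneg_right he.2 (norm_nonneg _))
      calc K * ‖e * μ‖ * ‖y‖ ≤ K * (M * ‖μ‖) * ‖y‖ := by gcongr
        _ = K * M * ‖μ‖ * ‖y‖ := by ring
    · obtain ⟨a, ha, x, rfl⟩ := h.exists_right y
      exact ⟨_, hlim μ a ha x⟩
  choose R hR hRb using hT
  exact ⟨R, fun μ a ha x => tendsto_nhds_unique (hR μ _) (hlim μ a ha x), K * M, hRb⟩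

/-- The actions of an ideal with bounded approximate identity on a neo-unital module extend to the
whole algebra. -/
theorem IsApproxIdeal.exists_extension (hA : IsApproxIdeal A f)
    (h : IsNeoUnitalBanachBimodule (A : Set B) l r) :
    ∃ L R : B → E →L[ℂ] E, EqOn L l A ∧ EqOn R r A ∧ IsNeoUnitalBanachBimodule univ L R := by
  obtain ⟨L, hL, K, hLK⟩ := hA.exists_left_action h
  obtain ⟨R, hR, K', hRK⟩ := hA.exists_right_action h
  have hLl : EqOn L l A := fun a ha => by
    ext y
    obtain ⟨b, hb, x, rfl⟩ := h.exists_left y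
    rw [hL a b hb, h.left_mul a ha b hb]
  have hRr : EqOn R r A := fun a ha => by
    ext y
    obtain ⟨b, hb, x, rfl⟩ := h.exists_right y
    rw [hR a b hb, h.right_mul b hb a ha]
  refine ⟨L, R, hLl, hRr, ⟨?_, ?_, ?_, ?_, ?_, ?_, ?_, ?_⟩, ?_⟩
  · intro μ _ ν _
    ext y
    obtain ⟨a, ha, x, rfl⟩ := h.exists_left y
    rw [add_apply, hL _ a ha, hL _ a ha, hL _ a ha, hA.add_mul,
      h.left_add _ (hA.mul_mem_left μ a ha) _ (hA.mul_mem_left ν a ha)]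
    rfl
  · intro c μ _
    ext y
    obtain ⟨a, ha, x, rfl⟩ := h.exists_left y
    rw [smul_apply, hL _ a ha, hL _ a ha, hA.smul_mul,
      h.left_smul c _ (hA.mul_mem_left μ a ha)]
    rfl
  · intro μ _ ν _ y
    obtain ⟨a, ha, x, rfl⟩ := h.exists_left y
    rw [hL _ a ha, hL _ a ha, hL _ _ (hA.mul_mem_left ν a ha), hA.assoc]
  · intro μ _ ν _
    ext y
    obtain ⟨a, ha, x, rfl⟩ := h.exists_right y
    rw [add_apply, hR _ a ha, hR _ a ha, hR _ a ha, hA.mul_add,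
      h.right_add _ (hA.mul_mem_right a ha μ) _ (hA.mul_mem_right a ha ν)]
    rfl
  · intro c μ _
    ext y
    obtain ⟨a, ha, x, rfl⟩ := h.exists_right y
    rw [smul_apply, hR _ a ha, hR _ a ha, hA.mul_smul,
      h.right_smul c _ (hA.mul_mem_right a ha μ)]
    rfl
  · intro μ _ ν _ y
    obtain ⟨a, ha, x, rfl⟩ := h.exists_right y
    rw [hR _ a ha, hR _ a ha, hR _ _ (hA.mul_mem_right a ha μ), hA.assoc]
  · intro μ _ ν _ y
    -- Commutation of the two extended actions needs a factor on each side to absorb `μ` and `ν`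
    -- into the ideal.
    obtain ⟨a, ha, b, hb, x, rfl⟩ := h.neoUnital y
    rw [hL _ a ha, ← h.left_right _ (hA.mul_mem_left μ a ha) b hb, hR _ b hb,
      ← h.left_right a ha b hb, hR _ b hb, h.left_right a ha _ (hA.mul_mem_right b hb ν), hL _ a ha,
      h.left_right _ (hA.mul_mem_left μ a ha) _ (hA.mul_mem_right b hb ν)]
  · refine ⟨max K K', fun μ _ x => ⟨(hLK μ x).trans ?_, (hRK μ x).trans ?_⟩⟩
    · gcongr
      exact le_max_left _ _
    · gcongr
      exact le_max_right _ _
  · intro y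
    obtain ⟨a, ha, b, hb, x, rfl⟩ := h.neoUnital y
    exact ⟨a, trivial, b, trivial, x, by rw [hLl ha, hRr hb]⟩

omit [f.NeBot] in
/-- The Leibniz rule, as a formula for `D(μ)` on elements `a · x`. -/
theorem IsContDerivation.apply_left {D : B → StrongDual ℂ E} (hD : IsContDerivation univ L R D)
    (μ a : B) (x : E) : D μ (L a x) = D (μ * a) x - D a (R μ x) := by
  rw [hD.leibniz μ trivial a trivial]
  simp

/-- The extension of a derivation from the ideal to the whole algebra. -/
theorem IsApproxIdeal.exists_derivation (hA : IsApproxIdeal A f)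
    (h : IsNeoUnitalBanachBimodule (A : Set B) l r) (hLl : EqOn L l A) (hRr : EqOn R r A)
    (hLR : IsNeoUnitalBanachBimodule univ L R) {D : B → StrongDual ℂ E}
    (hD : IsContDerivation (A : Set B) l r D) :
    ∃ D' : B → StrongDual ℂ E, IsContDerivation univ L R D' ∧ EqOn D' D A ∧
      IsSoWeakStarContinuous (A : Set B) D' := by
  obtain ⟨K, hK0, hK⟩ := hD.exists_bound
  obtain ⟨K', hK'0, hK'⟩ := hLR.exists_bound
  obtain ⟨M, hM0, hM⟩ := hA.eventually_bounded
  have happ : ∀ a ∈ A, ∀ b ∈ A, ∀ x, D a (l b x) = D (a * b) x - D b (r a x) :=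
    fun a ha b hb x => by
      rw [hD.leibniz a ha b hb]
      simp
  have hLmul : ∀ μ, ∀ a ∈ A, ∀ x, L μ (l a x) = l (μ * a) x := fun μ a ha x => by
    rw [← hLl ha, ← hLl (hA.mul_mem_left μ a ha), hLR.left_mul μ trivial a trivial]
  have hRl : ∀ μ, ∀ a ∈ A, ∀ x, R μ (l a x) = l a (R μ x) := fun μ a ha x => by
    rw [← hLl ha, hLR.left_right a trivial μ trivial]
  have hrR : ∀ μ, ∀ e ∈ A, ∀ x, r e (R μ x) = r (μ * e) x := fun μ e he x => by
    rw [← hRr he, ← hRr (hA.mul_mem_left μ e he), hLR.right_mul μ trivial e trivial]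
  -- The Leibniz rule for `μ * e` gives `D'(μ) · e = D(μ * e) - μ · D(e)`. The right-hand side makes
  -- sense for `e ∈ A`, and `D'(μ)` is its w*-limit.
  have hlim : ∀ μ, ∀ a ∈ A, ∀ x,
      Filter.Tendsto (fun e => (D (μ * e) - (D e).comp (R μ)) (l a x)) f
        (𝓝 (D (μ * a) x - D a (R μ x))) := fun μ a ha x => by
    have h1 : Filter.Tendsto (fun e => μ * (e * a)) f (𝓝 (μ * a)) :=
      ((hA.continuous_mul_left μ).tendsto a).comp (hA.tendsto_mul_right a ha)
    have h2 := tendsto_of_continuousOn hD.continuousOn (hA.mul_mem_left μ a ha)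
      (Filter.Eventually.of_forall fun e => hA.mul_mem_left μ _ (hA.mul_mem_left e a ha)) h1
    have h3 := tendsto_of_continuousOn hD.continuousOn ha
      (Filter.Eventually.of_forall fun e => hA.mul_mem_left e a ha) (hA.tendsto_mul_right a ha)
    have h4 := ((ContinuousLinearMap.apply ℂ ℂ x).continuous.tendsto _).comp h2
    have h5 := ((ContinuousLinearMap.apply ℂ ℂ (R μ x)).continuous.tendsto _).comp h3
    refine (h4.sub h5).congr' ?_
    filter_upwards [hM] with e he
    simp only [Function.comp_apply, ContinuousLinearMap.apply_apply, sub_apply,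
      ContinuousLinearMap.comp_apply]
    rw [happ _ (hA.mul_mem_left μ e he.1) a ha, hRl μ a ha, happ e he.1 a ha, hrR μ e he.1,
      hA.assoc]
    ring
  have hT : ∀ μ, ∃ T' : StrongDual ℂ E,
      (∀ y, Filter.Tendsto (fun e => (D (μ * e) - (D e).comp (R μ)) y) f (𝓝 (T' y))) ∧
        ∀ y, ‖T' y‖ ≤ (K * M + K * M * K') * ‖μ‖ * ‖y‖ := fun μ => by
    refine exists_clm_of_tendsto ?_ fun y => ?_
    · filter_upwards [hM] with e he y
      have h1 : ‖D (μ * e) y‖ ≤ K * (‖μ‖ * M) * ‖y‖ := by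
        refine ((D _).le_opNorm y).trans ?_
        gcongr
        refine (hK _ (hA.mul_mem_left μ e he.1)).trans ?_
        gcongr
        exact (hA.norm_mul_le μ e).trans (mul_le_mul_of_nonneg_left he.2 (norm_nonneg _))
      have h2 : ‖D e (R μ y)‖ ≤ K * M * (K' * ‖μ‖ * ‖y‖) := by
        refine ((D _).le_opNorm _).trans ?_
        gcongr
        · refine (hK _ he.1).trans ?_
          gcongr
          exact he.2
        · exact (hK' μ trivial y).2
      refine (norm_sub_le _ _).trans ((add_le_add h1 h2).trans_eq ?_)
      ring
    · obtain ⟨a, ha, x, rfl⟩ := h.exists_left y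
      exact ⟨_, hlim μ a ha x⟩
  choose D' hD' hD'b using hT
  have key : ∀ μ, ∀ a ∈ A, ∀ x, D' μ (l a x) = D (μ * a) x - D a (R μ x) := fun μ a ha x =>
    tendsto_nhds_unique (hD' μ _) (hlim μ a ha x)
  refine ⟨D', ⟨?_, ?_, ?_, ?_⟩, ?_, ?_⟩
  · intro μ _ ν _
    ext y
    obtain ⟨a, ha, x, rfl⟩ := h.exists_left y
    rw [add_apply, key _ a ha, key _ a ha, key _ a ha, hA.add_mul,
      hD.map_add _ (hA.mul_mem_left μ a ha) _ (hA.mul_mem_left ν a ha),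
      hLR.right_add μ trivial ν trivial]
    simp only [add_apply, map_add]
    ring
  · intro c μ _
    ext y
    obtain ⟨a, ha, x, rfl⟩ := h.exists_left y
    rw [smul_apply, key _ a ha, key _ a ha, hA.smul_mul,
      hD.map_smul c _ (hA.mul_mem_left μ a ha), hLR.right_smul c μ trivial]
    simp only [smul_apply, map_smul, smul_eq_mul]
    ring
  · intro μ _ ν _
    ext y
    obtain ⟨a, ha, x, rfl⟩ := h.exists_left y
    rw [add_apply, ContinuousLinearMap.comp_apply,
      ContinuousLinearMap.comp_apply, hLmul ν a ha, hRl μ a ha, key _ a ha, key _ a ha,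
      key _ _ (hA.mul_mem_left ν a ha), hLR.right_mul μ trivial ν trivial, hA.assoc]
    ring
  · exact ⟨K * M + K * M * K', fun μ _ =>
      ContinuousLinearMap.opNorm_le_bound _ (by positivity) (hD'b μ)⟩
  · intro μ hμ
    ext y
    obtain ⟨a, ha, x, rfl⟩ := h.exists_left y
    rw [key μ a ha, happ μ hμ a ha, hRr hμ]
  · refine @continuous_toWeakDual_of_eq_sub E _ _ B (strongOperatorTopology (A : Set B)) D'
      fun y => ?_
    obtain ⟨a, ha, x, rfl⟩ := h.exists_left y
    obtain ⟨b, hb, z, rfl⟩ := h.exists_right x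
    -- With `y = a · (z · b)` the variable `μ` enters only through `μ * a` and `b * μ`, the two maps
    -- that the strong operator topology makes norm continuous.
    refine ⟨fun μ => D (μ * a) (r b z), fun μ => D a (r (b * μ) z), ?_, ?_, fun μ => ?_⟩
    · exact continuous_strongOperatorTopology_mul_right (φ := fun c => D c (r b z)) ha
        ((ContinuousLinearMap.apply ℂ ℂ (r b z)).continuous.comp_continuousOn hD.continuousOn)
        fun c => hA.mul_mem_left c a ha
    · exact continuous_strongOperatorTopology_mul_left (φ := fun c => D a (r c z)) hb
        ((D a).continuous.comp_continuousOn (h.continuousOn_right z))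
        fun c => hA.mul_mem_right b hb c
    · have e : R μ (r b z) = r (b * μ) z := by
        rw [← hRr hb, ← hRr (hA.mul_mem_right b hb μ), hLR.right_mul b trivial μ trivial]
      rw [key μ a ha, e]

/-- Derivations that agree on the ideal are equal. -/
theorem IsNeoUnitalBanachBimodule.derivation_eq_of_eqOn
    (h : IsNeoUnitalBanachBimodule (A : Set B) l r) (hLl : EqOn L l A)
    {D₁ D₂ : B → StrongDual ℂ E} (h₁ : IsContDerivation univ L R D₁)
    (h₂ : IsContDerivation univ L R D₂) (hA : ∀ b : B, ∀ a ∈ A, b * a ∈ A) (he : EqOn D₁ D₂ A) :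
    D₁ = D₂ := by
  ext μ y
  obtain ⟨a, ha, x, rfl⟩ := h.exists_left y
  rw [← hLl ha, h₁.apply_left, h₂.apply_left, he ha, he (hA μ a ha)]

/-- Derivations on the whole algebra that agree on a set of points are equal, if the points
determine the equality of functionals of `μ ↦ μ * a` and `μ ↦ b * μ`. -/
theorem IsNeoUnitalBanachBimodule.derivation_eq_of_points
    (h : IsNeoUnitalBanachBimodule (A : Set B) l r) (hLl : EqOn L l A) (hRr : EqOn R r A)
    (hLR : IsNeoUnitalBanachBimodule univ L R) {pts : Set B}
    (hpts : ∀ a ∈ A, ∀ b ∈ A, ∀ F G : StrongDual ℂ B, (∀ s ∈ pts, F (s * a) = G (b * s)) →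
      ∀ μ, F (μ * a) = G (b * μ))
    {D₁ D₂ : B → StrongDual ℂ E} (h₁ : IsContDerivation univ L R D₁)
    (h₂ : IsContDerivation univ L R D₂) (he : EqOn D₁ D₂ pts) : D₁ = D₂ := by
  have hcl : ∀ {D : B → StrongDual ℂ E}, IsContDerivation univ L R D →
      ∃ Φ : B →L[ℂ] StrongDual ℂ E, ∀ b, Φ b = D b := fun {D} hD => by
    obtain ⟨K, -, hK⟩ := hD.exists_bound
    exact ⟨LinearMap.mkContinuous
      { toFun := D
        map_add' := fun a b => hD.map_add a trivial b trivial
        map_smul' := fun c a => hD.map_smul c a trivial } K fun b => hK b trivial, fun _ => rfl⟩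
  obtain ⟨Φ₁, hΦ₁⟩ := hcl h₁
  obtain ⟨Φ₂, hΦ₂⟩ := hcl h₂
  have hR : ∀ z, ∃ Ψ : B →L[ℂ] E, ∀ b, Ψ b = R b z := fun z => by
    obtain ⟨K, -, hK⟩ := hLR.exists_bound
    refine ⟨LinearMap.mkContinuous
      { toFun := fun b => R b z
        map_add' := fun a b => by rw [hLR.right_add a trivial b trivial]; rfl
        map_smul' := fun c a => by rw [hLR.right_smul c a trivial]; rfl } (K * ‖z‖) fun b => ?_,
      fun _ => rfl⟩
    exact ((hK b trivial z).2).trans_eq (by ring)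
  ext μ y
  obtain ⟨a, ha, x, rfl⟩ := h.exists_left y
  obtain ⟨b, hb, z, rfl⟩ := h.exists_right x
  obtain ⟨Ψ, hΨ⟩ := hR z
  -- With `F = (D₁ - D₂)(·)(z · b)` and `G = (D₁ - D₂)(a)(z · (·))`, the difference `F(μ * a) - G(b
  -- * μ)` is `(D₁ - D₂)(μ)` evaluated at `a · (z · b)`.
  have key := hpts a ha b hb
    ((ContinuousLinearMap.apply ℂ ℂ (r b z)).comp (Φ₁ - Φ₂)) ((D₁ a - D₂ a).comp Ψ)
    (fun s hs => by
      have e₁ := h₁.apply_left s a (r b z)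
      have e₂ := h₂.apply_left s a (r b z)
      rw [he hs] at e₁
      simp only [ContinuousLinearMap.comp_apply, ContinuousLinearMap.apply_apply, sub_apply, hΦ₁,
        hΦ₂, hΨ]
      rw [hLR.right_mul b trivial s trivial, hRr hb]
      linear_combination e₂ - e₁) μ
  simp only [ContinuousLinearMap.comp_apply, ContinuousLinearMap.apply_apply, sub_apply, hΦ₁,
    hΦ₂, hΨ] at key
  rw [hLR.right_mul b trivial μ trivial, hRr hb] at key
  rw [← hLl ha, h₁.apply_left, h₂.apply_left]
  linear_combination key

end Extension

/-! ### Approximate units as a filter -/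

section ApproximateIdentity

/-- A filter of approximate units from approximate units for finite sets. -/
theorem exists_filter_of_approximate_units {B : Type*} [NormedAddCommGroup B] [Mul B] {A : Set B}
    {M : ℝ} (h : ∀ s : Finset B, (∀ a ∈ s, a ∈ A) → ∀ ε > 0, ∃ e ∈ A, ‖e‖ ≤ M ∧
      ∀ a ∈ s, ‖e * a - a‖ < ε ∧ ‖a * e - a‖ < ε) :
    ∃ f : Filter B, f.NeBot ∧ (∀ᶠ e in f, e ∈ A ∧ ‖e‖ ≤ M) ∧
      ∀ a ∈ A, Filter.Tendsto (fun e => e * a) f (𝓝 a) ∧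
        Filter.Tendsto (fun e => a * e) f (𝓝 a) := by
  classical
  -- Units are indexed by the directed set of pairs of a finite subset of `A` and a precision.
  have h' : ∀ i : Finset A × ℕ, ∃ e ∈ A, ‖e‖ ≤ M ∧ ∀ a ∈ i.1.image Subtype.val,
      ‖e * a - a‖ < 1 / ((i.2 : ℝ) + 1) ∧ ‖a * e - a‖ < 1 / ((i.2 : ℝ) + 1) := fun i => by
    refine h _ (fun a ha => ?_) _ Nat.one_div_pos_of_nat
    obtain ⟨b, -, rfl⟩ := Finset.mem_image.1 ha
    exact b.2
  choose e heA heM he using h'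
  refine ⟨Filter.map e Filter.atTop, inferInstance, ?_, fun a ha => ?_⟩
  · rw [Filter.eventually_map]
    exact Filter.Eventually.of_forall fun i => ⟨heA i, heM i⟩
  have hev : ∀ ε > 0, ∀ᶠ i in Filter.atTop, ‖e i * a - a‖ < ε ∧ ‖a * e i - a‖ < ε := fun ε hε => by
    obtain ⟨n, hn⟩ := exists_nat_one_div_lt hε
    filter_upwards [Filter.eventually_ge_atTop ({⟨a, ha⟩}, n)] with i hi
    have hmem : a ∈ i.1.image Subtype.val :=
      Finset.mem_image.2 ⟨⟨a, ha⟩, hi.1 (Finset.mem_singleton_self _), rfl⟩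
    have hle : 1 / ((i.2 : ℝ) + 1) < ε :=
      (Nat.one_div_le_one_div hi.2).trans_lt hn
    exact ⟨(he i a hmem).1.trans hle, (he i a hmem).2.trans hle⟩
  constructor
  · rw [Filter.tendsto_map'_iff, Metric.tendsto_nhds]
    exact fun ε hε => (hev ε hε).mono fun i hi => by rw [dist_eq_norm]; exact hi.1
  · rw [Filter.tendsto_map'_iff, Metric.tendsto_nhds]
    exact fun ε hε => (hev ε hε).mono fun i hi => by rw [dist_eq_norm]; exact hi.2

end ApproximateIdentity

/-! ### M_a(S, ω) as an ideal of M(S, ω) -/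

section WeightedAlgebra

variable {S : Type*} [Monoid S] [TopologicalSpace S] [T2Space S] [LocallyCompactSpace S]
  [ContinuousMul S] [MeasurableSpace S] [BorelSpace S] {ω : S → ℝ}

/-- `M_a(S, ω)` as a subspace of `M(S, ω)`. -/
noncomputable def weightedAbsContSubmodule (ω : S → ℝ) : Submodule ℂ (WeightedMeasure ω) :=
  (transSubmodule (fun x y : S => x * y) continuous_mul).comap
    (WeightedMeasure.weighted (ω := ω)).toLinearEquiv.toLinearMap

theorem mem_weightedAbsContSubmodule {μ : WeightedMeasure ω} :
    μ ∈ weightedAbsContSubmodule ω ↔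
      μ.weighted ∈ transSubmodule (fun x y : S => x * y) continuous_mul := Iff.rfl

theorem coe_weightedAbsContSubmodule :
    (weightedAbsContSubmodule ω : Set (WeightedMeasure ω)) = weightedAbsCont ω := by
  ext μ
  exact mem_absContMeasures_iff.symm

theorem WeightedMeasure.weighted_mul (hω : IsWeight ω) (μ ν : WeightedMeasure ω) :
    (μ * ν).weighted = hω.kernel.conv μ.weighted ν.weighted :=
  congrArg WeightedMeasure.weighted (WeightedMeasure.mul_eq_conv hω μ ν)

theorem IsFoundationSemigroup.exists_measure_ne_zero (hS : IsFoundationSemigroup S) {U : Set S}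
    (hU : IsOpen U) (hne : U.Nonempty) :
    ∃ a ∈ transSubmodule (fun x y : S => x * y) continuous_mul, absMeasure a U ≠ 0 := by
  have hd : Dense (⋃ μ ∈ absContMeasures S, (absMeasure μ).support) :=
    dense_iff_closure_eq.2 hS
  obtain ⟨x, hxU, hx⟩ := hd.inter_open_nonempty U hU hne
  simp only [mem_iUnion] at hx
  obtain ⟨μ, hμ, hx⟩ := hx
  exact ⟨μ, mem_absContMeasures_iff.1 hμ,
    ((Measure.mem_support_iff_forall x).1 hx U (hU.mem_nhds hxU)).ne'⟩

/-- The kernel has the constant value `1 / ω(1)` when one variable is `1`, so the approximating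
measures ωμ must have mass near `ω(1)`; this is the bound on the units. -/
theorem WeightedMeasure.exists_approximate_units (hS : IsFoundationSemigroup S) (hω : IsWeight ω)
    (s : Finset (WeightedMeasure ω)) (hs : ∀ a ∈ s, a ∈ weightedAbsContSubmodule ω) {ε : ℝ}
    (hε : 0 < ε) : ∃ e ∈ weightedAbsContSubmodule ω, ‖e‖ ≤ ω 1 ∧
      ∀ a ∈ s, ‖e * a - a‖ < ε ∧ ‖a * e - a‖ < ε := by
  classical
  have h1 := hω.pos 1
  obtain ⟨e, he, hle, hlim⟩ := hω.kernel.exists_approximate_identity (e₀ := 1) (t := (ω 1)⁻¹)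
    (inv_pos.2 h1) (fun y => one_mul y) (fun y => mul_one y)
    (fun y => by
      rw [hω.kernel_θ, one_mul]
      have := (hω.pos y).ne'
      field_simp)
    (fun y => by
      rw [hω.kernel_θ, mul_one]
      have := (hω.pos y).ne'
      field_simp)
    (fun U hU hU1 => hS.exists_measure_ne_zero hU ⟨1, hU1⟩)
    (s.image WeightedMeasure.weighted) (fun a ha => by
      obtain ⟨b, hb, rfl⟩ := Finset.mem_image.1 ha
      exact hs b hb) hε
  refine ⟨WeightedMeasure.weighted.symm e, he, by rwa [inv_inv] at hle, fun a ha => ?_⟩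
  have := hlim _ (Finset.mem_image_of_mem _ ha)
  rw [← WeightedMeasure.weighted.norm_map, ← WeightedMeasure.weighted.norm_map (_ * _ - _),
    map_sub, map_sub, WeightedMeasure.weighted_mul hω, WeightedMeasure.weighted_mul hω,
    LinearIsometryEquiv.apply_symm_apply]
  exact this

theorem WeightedMeasure.exists_isApproxIdeal (hS : IsFoundationSemigroup S) (hω : IsWeight ω) :
    ∃ f : Filter (WeightedMeasure ω), f.NeBot ∧ IsApproxIdeal (weightedAbsContSubmodule ω) f := by
  obtain ⟨f, hf, hfM, hft⟩ := exists_filter_of_approximate_units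
    (A := (weightedAbsContSubmodule ω : Set (WeightedMeasure ω))) (M := ω 1)
    fun s hs ε hε => WeightedMeasure.exists_approximate_units hS hω s hs hε
  have hinj := (WeightedMeasure.weighted (ω := ω) (S := S)).injective
  refine ⟨f, hf, ⟨?_, ?_, ?_, ?_, ?_, ?_, ?_, ?_, ⟨ω 1, (hω.pos 1).le, hfM⟩,
    fun a ha => (hft a ha).1, fun a ha => (hft a ha).2⟩⟩
  · intro a b c
    apply hinj
    simp only [map_add, WeightedMeasure.weighted_mul hω, ConvKernel.add_conv]
  · intro a b c
    apply hinj
    simp only [map_add, WeightedMeasure.weighted_mul hω, ConvKernel.conv_add]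
  · intro t a b
    apply hinj
    simp only [map_smul, WeightedMeasure.weighted_mul hω, ConvKernel.smul_conv]
  · intro t a b
    apply hinj
    simp only [map_smul, WeightedMeasure.weighted_mul hω, ConvKernel.conv_smul]
  · intro a b c
    apply hinj
    simp only [WeightedMeasure.weighted_mul hω]
    refine ConvKernel.conv_assoc (K := hω.kernel) (fun x y z => mul_assoc x y z) fun x y z => ?_
    simp only [hω.kernel_θ, hω.kernel_p]
    have hx := (hω.pos x).ne'
    have hy := (hω.pos y).ne'
    have hz := (hω.pos z).ne'
    have hxy := (hω.pos (x * y)).ne'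
    have hyz := (hω.pos (y * z)).ne'
    rw [mul_assoc x y z]
    field_simp
  · intro a b
    rw [← WeightedMeasure.weighted.norm_map, WeightedMeasure.weighted_mul hω]
    exact ConvKernel.norm_conv_le
  · intro b a ha
    rw [mem_weightedAbsContSubmodule, WeightedMeasure.weighted_mul hω]
    exact ConvKernel.conv_mem_transSubmodule (K := hω.kernel) (fun x y z => mul_assoc x y z) _ ha
  · intro a ha b
    rw [mem_weightedAbsContSubmodule, WeightedMeasure.weighted_mul hω]
    exact ConvKernel.conv_mem_transSubmodule' (K := hω.kernel) (fun x y z => mul_assoc x y z) _ ha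

omit [Monoid S] [LocallyCompactSpace S] [ContinuousMul S] in
theorem WeightedMeasure.cint_pointMass (s : S) {g : S → ℂ} (hg : Continuous g) :
    cint (WeightedMeasure.pointMass ω s).weighted g = g s * (ω s : ℂ) :=
  VectorMeasure.integral_dirac' hg.stronglyMeasurable

/-- Functionals of `μ ↦ μ * a` and of `μ ↦ b * μ` coincide if they do on point masses. -/
theorem WeightedMeasure.functional_mul_eq_of_pointMass (hω : IsWeight ω) {a b : WeightedMeasure ω}
    (ha : a ∈ weightedAbsContSubmodule ω) (hb : b ∈ weightedAbsContSubmodule ω)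
    {F G : StrongDual ℂ (WeightedMeasure ω)}
    (h : ∀ s, F (WeightedMeasure.pointMass ω s * a) = G (b * WeightedMeasure.pointMass ω s))
    (μ : WeightedMeasure ω) : F (μ * a) = G (b * μ) := by
  let F' : StrongDual ℂ (boundedRadon S) :=
    F.comp (WeightedMeasure.weighted (ω := ω)).symm.toContinuousLinearEquiv.toContinuousLinearMap
  let G' : StrongDual ℂ (boundedRadon S) :=
    G.comp (WeightedMeasure.weighted (ω := ω)).symm.toContinuousLinearEquiv.toContinuousLinearMap
  have hF : ∀ ν, F (ν * a) = F' (hω.kernel.conv ν.weighted a.weighted) := fun ν => by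
    rw [← WeightedMeasure.weighted_mul hω]
    rfl
  have hG : ∀ ν, G (b * ν) = G' (hω.kernel.conv b.weighted ν.weighted) := fun ν => by
    rw [← WeightedMeasure.weighted_mul hω]
    rfl
  have ha1 : TransCont hω.kernel.p (absMeasure a.weighted) := ha.1
  have hb1 : TransCont hω.kernel.flip.p (absMeasure b.weighted) := hb.2
  rw [hF, hG]
  refine ConvKernel.functional_conv_eq_of_translate ha1 hb1 (fun s => ?_) _
  have hs := h s
  rw [hF, hG, ← ConvKernel.flip_conv (ν := b.weighted), ConvKernel.functional_conv ha1,
    ConvKernel.functional_conv hb1,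
    WeightedMeasure.cint_pointMass s (ConvKernel.continuous_functional_translate ha1 F'),
    WeightedMeasure.cint_pointMass s (ConvKernel.continuous_functional_translate hb1 G')] at hs
  -- A point mass is recorded with mass `ω(s)`, a nonzero factor common to both sides.
  exact mul_right_cancel₀ (Complex.ofReal_ne_zero.2 (hω.pos s).ne') hs

end WeightedAlgebra

/-! ### The main theorem -/

theorem corollary2p5 {S : Type*} [Monoid S] [TopologicalSpace S] [T2Space S]
    [LocallyCompactSpace S] [ContinuousMul S] [MeasurableSpace S] [BorelSpace S]
    (hS : IsFoundationSemigroup S) (ω : S → ℝ) (hω : IsWeight ω)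
    {E : Type*} [NormedAddCommGroup E] [NormedSpace ℂ E] [CompleteSpace E]
    (l r : WeightedMeasure ω → E →L[ℂ] E)
    (hE : IsNeoUnitalBanachBimodule (weightedAbsCont ω) l r) :
    ∃ L R : WeightedMeasure ω → E →L[ℂ] E,
      EqOn L l (weightedAbsCont ω) ∧ EqOn R r (weightedAbsCont ω) ∧
      IsNeoUnitalBanachBimodule univ L R ∧
      (∀ D : WeightedMeasure ω → StrongDual ℂ E, IsContDerivation (weightedAbsCont ω) l r D →
        ∃! D' : WeightedMeasure ω → StrongDual ℂ E,
          IsContDerivation univ L R D' ∧ EqOn D' D (weightedAbsCont ω) ∧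
          IsSoWeakStarContinuous (weightedAbsCont ω) D') ∧
      (∀ D₁ D₂ : WeightedMeasure ω → StrongDual ℂ E,
        IsContDerivation univ L R D₁ → IsSoWeakStarContinuous (weightedAbsCont ω) D₁ →
        IsContDerivation univ L R D₂ → IsSoWeakStarContinuous (weightedAbsCont ω) D₂ →
        (∀ s : S, D₁ (WeightedMeasure.pointMass ω s) = D₂ (WeightedMeasure.pointMass ω s)) →
        D₁ = D₂) := by
  rw [← coe_weightedAbsContSubmodule] at hE ⊢
  obtain ⟨f, hf, hA⟩ := WeightedMeasure.exists_isApproxIdeal hS hω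
  obtain ⟨L, R, hL, hR, hLR⟩ := hA.exists_extension hE
  refine ⟨L, R, hL, hR, hLR, fun D hD => ?_, fun D₁ D₂ h₁ _ h₂ _ he => ?_⟩
  · obtain ⟨D', hD', hext, hcont⟩ := hA.exists_derivation hE hL hR hLR hD
    exact ⟨D', ⟨hD', hext, hcont⟩, fun D'' h => hE.derivation_eq_of_eqOn hL h.1 hD'
      hA.mul_mem_left (h.2.1.trans hext.symm)⟩
  · refine hE.derivation_eq_of_points hL hR hLR (pts := range (WeightedMeasure.pointMass ω))
      (fun a ha b hb F G h => ?_) h₁ h₂ ?_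
    · exact WeightedMeasure.functional_mul_eq_of_pointMass hω ha hb fun s => h _ ⟨s, rfl⟩
    · rintro _ ⟨s, rfl⟩
      exact he s
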